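/- Let $E\to M$ be a smooth real vector bundle of finite rank over a smooth manifold, equipped with a Lie algebroid structure (anchor $\rho:E\to TM$, bracket $[\cdot,\cdot]$ on the smooth sections $\mathrm{Sec}(E)$) and a Riemannian metric $G$, regarded also as a fibrewise quadratic function $G(e)=\langle e|e\rangle$ on $E$. Let $(\Sigma,g)$ be a non-empty Riemannian manifold without boundary, $\dim\Sigma\ge 1$. For a section $u$ let $d_T(u)$ be its tangent lift, the vector field on $E$ with $d_T(u)_{v(x)}=T_xv(\rho(u)_x)-[u,v](x)^{\mathrm{vert}}$ for every section $v$ and $x\in M$; put $\mathcal L_uq=d_T(u)[q]$ for functions $q$ on $E$, and call $u$ Killing if $\mathcal L_uG=0$. The sigma model has as fields the Lie algebroid morphisms $\Phi:T\Sigma\to E$ and the action $S[\Phi]=\int_\Sigma \mathrm{Tr}(g^{-1}\Phi^*G)\,d\mathrm{Vol}_g$; write $S_D$ for the same integral over a region $D\subseteq\Sigma$. For any smooth bundle map $\Phi:T\Sigma\to E$ the section $u$ induces the infinitesimal field redefinition $\delta_u\Phi=d_T(u)\circ\Phi$; the corresponding first variation of a functional is its derivative at $t=0$ along every smooth one-parameter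 family $\Phi_t$ of bundle maps with $\Phi_0=\Phi$ and $\partial_t|_{t=0}\Phi_t=d_T(u)\circ\Phi$. **Proposition.** 1. For every section $u$ and every bundle map $\Phi$, the first variation of the Lagrangian density $\mathrm{Tr}(g^{-1}\Phi^*G)$ is $\mathrm{Tr}(g^{-1}\Phi^*\mathcal L_uG)$ at each point of $\Sigma$, and the first variation of $S_D$ is $\int_D\mathrm{Tr}(g^{-1}\Phi^*\mathcal L_uG)\,d\mathrm{Vol}_g$ for every compact $D\subseteq\Sigma$. At Lie algebroid morphisms, $\delta_u$ satisfies the linearised morphism condition. 2. Call $u$ an internal symmetry if $\delta_u$ satisfies the linearised morphism condition at Lie algebroid morphisms and leaves the action invariant, i.e. the first variation of $S_D$ vanishes at every Lie algebroid morphism, for every measurable $D$ and all families that vanish on $D\setminus C$ for some compact $C$ (so that the integrals converge). Then $u$ is an internal symmetry if and only if $u$ is Killing. It already suffices for being Killing that the total action $S$ ($D=\Sigma$) is invariant in this sense. 3. The Killing sections form a Lie subalgebra $\mathrm{iso}(E,G)$ of $\mathrm{Sec}(E)$. The map $\delta:u\mapsto d_T(u)$ is a homomorphism of Lie algebras into the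 vector fields on $E$, and the field redefinitions close off-shell: $[\delta_u,\delta_v]=\delta_{[u,v]}$ on all local functionals $\Phi\mapsto f(\Phi(p))$, $f\in C^\infty(E)$, $p\in T\Sigma$, at arbitrary bundle maps $\Phi$ (no field equation is used). The Lie algebra of the redefinitions induced by internal symmetries is $\delta(\mathrm{iso}(E,G))$, and $\delta_u=0$ (as a vector field on $E$) exactly for the central sections, $[u,v]=0$ for all $v\in\mathrm{Sec}(E)$. -/

import Mathlib

open Bundle MeasureTheory Set
open scoped Manifold ContDiff Topology

noncomputable section

/-- The derivative `X f` of a real function `f` along the tangent vector `X` at `x`. -/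
def dirDeriv {V H M : Type*} [NormedAddCommGroup V] [NormedSpace ℝ V] [TopologicalSpace H]
    (I : ModelWithCorners ℝ V H) [TopologicalSpace M] [ChartedSpace H M]
    (f : M → ℝ) (x : M) (X : TangentSpace I x) : ℝ :=
  mfderiv I 𝓘(ℝ, ℝ) f x X

/-! ### Lie algebroids -/

section Algebroid

variable {EM : Type*} [NormedAddCommGroup EM] [NormedSpace ℝ EM]
  {M : Type*} [TopologicalSpace M] [ChartedSpace EM M] [IsManifold 𝓘(ℝ, EM) ∞ M]
  {F : Type*} [NormedAddCommGroup F] [NormedSpace ℝ F]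
  {E : M → Type*} [∀ x, AddCommGroup (E x)] [∀ x, Module ℝ (E x)]
  [∀ x, TopologicalSpace (E x)] [TopologicalSpace (TotalSpace F E)]
  [FiberBundle F E] [VectorBundle ℝ F E]

/-- The product `f v` of a smooth function and a smooth section. -/
def functionSmul (f : C^∞⟮𝓘(ℝ, EM), M; ℝ⟯) (v : Cₛ^∞⟮𝓘(ℝ, EM); F, E⟯) :
    Cₛ^∞⟮𝓘(ℝ, EM); F, E⟯ :=
  ⟨fun x => f x • v x, f.contMDiff.smul_section v.contMDiff⟩

variable (EM M F E) in
/-- A Lie algebroid structure on the smooth vector bundle `E → M`: a smooth bundle map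
`ρ : E → TM` (the anchor) and a Lie bracket on the real vector space of smooth sections of `E`
such that `[u, f v] = f [u, v] + (ρ(u) f) v` and `ρ([u, v]) = [ρ(u), ρ(v)]`. -/
structure LieAlgebroid where
  anchor : ∀ x, E x →ₗ[ℝ] TangentSpace 𝓘(ℝ, EM) x
  contMDiff_anchor : ContMDiff (𝓘(ℝ, EM).prod 𝓘(ℝ, F)) 𝓘(ℝ, EM).tangent ∞
    (fun e : TotalSpace F E => (⟨e.1, anchor e.1 e.2⟩ : TangentBundle 𝓘(ℝ, EM) M))
  bracket : Cₛ^∞⟮𝓘(ℝ, EM); F, E⟯ →ₗ[ℝ] Cₛ^∞⟮𝓘(ℝ, EM); F, E⟯ →ₗ[ℝ] Cₛ^∞⟮𝓘(ℝ, EM); F, E⟯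
  bracket_self : ∀ u, bracket u u = 0
  jacobi : ∀ u v w, bracket u (bracket v w) = bracket (bracket u v) w + bracket v (bracket u w)
  leibniz : ∀ (u v : Cₛ^∞⟮𝓘(ℝ, EM); F, E⟯) (f : C^∞⟮𝓘(ℝ, EM), M; ℝ⟯) (x : M),
    bracket u (functionSmul f v) x =
      f x • bracket u v x + dirDeriv 𝓘(ℝ, EM) f x (anchor x (u x)) • v x
  anchor_bracket : ∀ (u v : Cₛ^∞⟮𝓘(ℝ, EM); F, E⟯) (x : M),
    anchor x (bracket u v x) =
      VectorField.mlieBracket 𝓘(ℝ, EM) (fun y => anchor y (u y)) (fun y => anchor y (v y)) x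

/-- The space of smooth sections `Sec(E)`, as a Lie algebra with the bracket of the
algebroid `A`. -/
@[nolint unusedArguments]
def LieAlgebroid.Sec (_A : LieAlgebroid EM M F E) := Cₛ^∞⟮𝓘(ℝ, EM); F, E⟯

instance (A : LieAlgebroid EM M F E) : AddCommGroup A.Sec :=
  inferInstanceAs (AddCommGroup Cₛ^∞⟮𝓘(ℝ, EM); F, E⟯)

instance (A : LieAlgebroid EM M F E) : Module ℝ A.Sec :=
  inferInstanceAs (Module ℝ Cₛ^∞⟮𝓘(ℝ, EM); F, E⟯)

instance (A : LieAlgebroid EM M F E) : DFunLike A.Sec M E :=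
  inferInstanceAs (DFunLike Cₛ^∞⟮𝓘(ℝ, EM); F, E⟯ M E)

instance (A : LieAlgebroid EM M F E) : LieRing A.Sec where
  bracket u v := A.bracket u v
  add_lie u v w := LinearMap.congr_fun (map_add A.bracket u v) w
  lie_add u v w := map_add (A.bracket u) v w
  lie_self u := A.bracket_self u
  leibniz_lie u v w := A.jacobi u v w

instance (A : LieAlgebroid EM M F E) : LieAlgebra ℝ A.Sec where
  lie_smul c u v := map_smul (A.bracket u) c v

/-- Through every point of the total space there passes a smooth global section. -/
theorem exists_section_through [FiniteDimensional ℝ EM] [T2Space M] [SigmaCompactSpace M] [ContMDiffVectorBundle ∞ F E 𝓘(ℝ, EM)]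
    (e : TotalSpace F E) : ∃ v : Cₛ^∞⟮𝓘(ℝ, EM); F, E⟯, v e.1 = e.2 := by
  obtain ⟨x, a⟩ := e
  obtain ⟨s, hs⟩ := exists_contMDiffSection_forall_mem_convex_of_local (n := (⊤ : ℕ∞))
    𝓘(ℝ, EM) E (fun y => {w : E y | y = x → (⟨y, w⟩ : TotalSpace F E) = ⟨x, a⟩})
    (fun y => by
      by_cases h : y = x
      · subst h
        intro v hv w hw s t _ _ hst
        simp only [Set.mem_ofPred_eq, forall_const, TotalSpace.mk_inj] at hv hw ⊢
        rw [hv, hw, ← add_smul, hst, one_smul]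
      · simp [h, convex_univ])
    (fun y => by
      by_cases h : y = x
      · subst h
        obtain ⟨U, hU, hs⟩ : ∃ U ∈ 𝓝 y, ContMDiffOn 𝓘(ℝ, EM) (𝓘(ℝ, EM).prod 𝓘(ℝ, F)) ∞
            (fun z => (⟨z, FiberBundle.extend F a z⟩ : TotalSpace F E)) U :=
          FiberBundle.exists_contMDiffOn_extend _ _ _
        refine ⟨U, hU, FiberBundle.extend F a, hs, ?_⟩
        rintro z - rfl
        simp
      · refine ⟨{x}ᶜ, isOpen_compl_singleton.mem_nhds h, 0,
          (contMDiff_zeroSection ℝ E).contMDiffOn, ?_⟩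
        intro z hz hzx
        exact absurd hzx hz)
  exact ⟨s, by simpa [TotalSpace.mk_inj] using hs x rfl⟩

variable [FiniteDimensional ℝ EM] [T2Space M] [SigmaCompactSpace M] [ContMDiffVectorBundle ∞ F E 𝓘(ℝ, EM)]

/-- Some smooth section of `E` through the point `e` of the total space. -/
def sectionThrough (e : TotalSpace F E) : Cₛ^∞⟮𝓘(ℝ, EM); F, E⟯ :=
  (exists_section_through e).choose

namespace LieAlgebroid

variable (A : LieAlgebroid EM M F E)

/-- The vertical lift of `w ∈ E_x` to the point `e ∈ E_x`: the velocity at `s = 0` of the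
curve `s ↦ e + s w`. -/
def verticalLift (e : TotalSpace F E) (w : E e.1) :
    TangentSpace (𝓘(ℝ, EM).prod 𝓘(ℝ, F)) e :=
  mfderiv 𝓘(ℝ, ℝ) (𝓘(ℝ, EM).prod 𝓘(ℝ, F))
    (fun s : ℝ => (⟨e.1, e.2 + s • w⟩ : TotalSpace F E)) 0 (1 : ℝ)

/-- The tangent lift `d_T(u)` of a section `u`, a vector field on the total space of `E`. At
`e ∈ E_x` it is `T_x v (ρ(u)_x) - ([u, v]_x)^vert`, where `v` is any section with `v(x) = e`; by
the Leibniz rule the value does not depend on `v`. Evaluated on a frame `s_a` it is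
`u^a Q_a^A ∂/∂x^A + (y^a Q_a^A ∂u^c/∂x^A - y^a u^b Q_{ba}^c) ∂/∂y^c`. -/
def tangentLift (u : A.Sec) (e : TotalSpace F E) :
    TangentSpace (𝓘(ℝ, EM).prod 𝓘(ℝ, F)) e :=
  let v : A.Sec := sectionThrough e
  mfderiv 𝓘(ℝ, EM) (𝓘(ℝ, EM).prod 𝓘(ℝ, F)) (fun y => (⟨y, v y⟩ : TotalSpace F E)) e.1
      (A.anchor e.1 (u e.1))
    - verticalLift e (⁅u, v⁆ e.1)

/-- The derivative `d_T(u)[q]` of a function `q` on `E` along the tangent lift of `u`. -/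
def lieDeriv (u : A.Sec) (q : TotalSpace F E → ℝ) (e : TotalSpace F E) : ℝ :=
  dirDeriv (𝓘(ℝ, EM).prod 𝓘(ℝ, F)) q e (A.tangentLift u e)

/-- `α` is a smooth section of the dual bundle `E*`, i.e. a fibrewise linear map which is a smooth
function on the total space. -/
def IsOneForm (α : ∀ x, E x →ₗ[ℝ] ℝ) : Prop :=
  ContMDiff (𝓘(ℝ, EM).prod 𝓘(ℝ, F)) 𝓘(ℝ, ℝ) ∞ (fun e : TotalSpace F E => α e.1 e.2)

/-- The algebroid differential of a section `α` of `E*`: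
`(d_E α)(u, v) = ρ(u)(α(v)) - ρ(v)(α(u)) - α([u, v])`, evaluated at `a, b ∈ E_x` through any
sections `u, v` with `u(x) = a`, `v(x) = b` (the value does not depend on them). -/
def dOneForm (α : ∀ x, E x →ₗ[ℝ] ℝ) (x : M) (a b : E x) : ℝ :=
  let u : A.Sec := sectionThrough ⟨x, a⟩
  let v : A.Sec := sectionThrough ⟨x, b⟩
  dirDeriv 𝓘(ℝ, EM) (fun y => α y (v y)) x (A.anchor x a)
    - dirDeriv 𝓘(ℝ, EM) (fun y => α y (u y)) x (A.anchor x b)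
    - α x (⁅u, v⁆ x)

end LieAlgebroid

/-- A Riemannian metric on `E` as a quadratic function on the total space. -/
def metricFunction [∀ x, IsTopologicalAddGroup (E x)] [∀ x, ContinuousConstSMul ℝ (E x)]
    (G : ContMDiffRiemannianMetric 𝓘(ℝ, EM) ∞ F E) (e : TotalSpace F E) : ℝ :=
  G.inner e.1 e.2 e.2

/-- `u` is a Killing section of `(E, G)`: `L_u G = d_T(u)[G] = 0`. -/
def LieAlgebroid.IsKilling [∀ x, IsTopologicalAddGroup (E x)] [∀ x, ContinuousConstSMul ℝ (E x)]
    (A : LieAlgebroid EM M F E) (G : ContMDiffRiemannianMetric 𝓘(ℝ, EM) ∞ F E)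
    (u : A.Sec) : Prop :=
  ∀ e, A.lieDeriv u (metricFunction G) e = 0

end Algebroid

/-! ### The Riemannian manifold `(N, g)`: trace and volume -/

section Source

variable {k : ℕ} {N : Type*} [TopologicalSpace N] [ChartedSpace (EuclideanSpace ℝ (Fin k)) N]
  [IsManifold (𝓡 k) ∞ N]

/-- The matrix `g(b_i, b_j)` of a family of tangent vectors. -/
def gramMatrix
    (g : ContMDiffRiemannianMetric (𝓡 k) ∞ (EuclideanSpace ℝ (Fin k))
      (TangentSpace (𝓡 k) : N → Type _))
    (z : N) (b : Fin k → TangentSpace (𝓡 k) z) : Matrix (Fin k) (Fin k) ℝ :=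
  Matrix.of fun i j => g.inner z (b i) (b j)

/-- The trace `Tr(g⁻¹ q) = ∑ g^{ij} q_{ij}` of a quadratic form `q` on `T_z N`, where
`q_{ij} = (q(b_i + b_j) - q(b_i) - q(b_j)) / 2` in the coordinate basis `b` of `T_z N`. -/
def metricTrace
    (g : ContMDiffRiemannianMetric (𝓡 k) ∞ (EuclideanSpace ℝ (Fin k))
      (TangentSpace (𝓡 k) : N → Type _))
    (z : N) (q : TangentSpace (𝓡 k) z → ℝ) : ℝ :=
  let b : Fin k → TangentSpace (𝓡 k) z := fun i => EuclideanSpace.basisFun (Fin k) ℝ i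
  ∑ i, ∑ j, (gramMatrix g z b)⁻¹ i j * ((q (b i + b j) - q (b i) - q (b j)) / 2)

variable [MeasurableSpace N]

/-- The Riemannian measure on the domain of the chart at `c`, given by `√(det g_{ij}) dz`, where
`g_{ij}` are the components of `g` in the coordinate basis of this chart. -/
def chartVolume
    (g : ContMDiffRiemannianMetric (𝓡 k) ∞ (EuclideanSpace ℝ (Fin k))
      (TangentSpace (𝓡 k) : N → Type _)) (c : N) : Measure N :=
  let ψ := (chartAt (EuclideanSpace ℝ (Fin k)) c).symm
  Measure.map ψ ((volume.restrict ψ.source).withDensity fun y =>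
    ENNReal.ofReal (Real.sqrt (gramMatrix g (ψ y) fun i =>
      mfderiv (𝓡 k) (𝓡 k) ψ y (EuclideanSpace.basisFun (Fin k) ℝ i)).det))

variable [T2Space N] [SigmaCompactSpace N]

variable (k N) in
/-- A smooth partition of unity subordinate to the charts. -/
def chartPartition : SmoothPartitionOfUnity N (𝓡 k) N univ :=
  (SmoothPartitionOfUnity.exists_isSubordinate_chartAt_source (𝓡 k) N).choose

/-- The Riemannian volume measure `dVol_g`: the measures `√(det g_{ij}) dz` on the charts, glued
by a partition of unity (by the change of variables formula, the result does not depend on the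
partition). -/
def riemannianVolume
    (g : ContMDiffRiemannianMetric (𝓡 k) ∞ (EuclideanSpace ℝ (Fin k))
      (TangentSpace (𝓡 k) : N → Type _)) : Measure N :=
  Measure.sum fun c : N =>
    (chartVolume g c).withDensity fun z => ENNReal.ofReal (chartPartition k N c z)

end Source

/-! ### The sigma model -/

section SigmaModel

variable {EM : Type*} [NormedAddCommGroup EM] [NormedSpace ℝ EM] [FiniteDimensional ℝ EM]
  {M : Type*} [TopologicalSpace M] [ChartedSpace EM M] [IsManifold 𝓘(ℝ, EM) ∞ M]
  [T2Space M] [SigmaCompactSpace M]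
  {F : Type*} [NormedAddCommGroup F] [NormedSpace ℝ F]
  {E : M → Type*} [∀ x, AddCommGroup (E x)] [∀ x, Module ℝ (E x)]
  [∀ x, TopologicalSpace (E x)] [TopologicalSpace (TotalSpace F E)]
  [FiberBundle F E] [VectorBundle ℝ F E] [ContMDiffVectorBundle ∞ F E 𝓘(ℝ, EM)]
  {k : ℕ} {N : Type*} [TopologicalSpace N] [ChartedSpace (EuclideanSpace ℝ (Fin k)) N]
  [IsManifold (𝓡 k) ∞ N]

variable (EM F E k N) in
/-- A smooth vector bundle morphism `Φ : TN → E` over a map `φ : N → M`. -/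
structure BundleMap where
  base : N → M
  fiber : ∀ z, TangentSpace (𝓡 k) z →ₗ[ℝ] E (base z)
  contMDiff : ContMDiff (𝓡 k).tangent (𝓘(ℝ, EM).prod 𝓘(ℝ, F)) ∞
    (fun p : TangentBundle (𝓡 k) N => (⟨base p.1, fiber p.1 p.2⟩ : TotalSpace F E))

namespace BundleMap

/-- `Φ` as a map of total spaces. -/
def toMap (Φ : BundleMap EM F E k N) (p : TangentBundle (𝓡 k) N) : TotalSpace F E :=
  ⟨Φ.base p.1, Φ.fiber p.1 p.2⟩

/-- `(d(Φ^* f) - Φ^*(d_E f))(X)` for a function `f` on `M` and `X ∈ T_z N`. -/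
def defectZero (A : LieAlgebroid EM M F E) (Φ : BundleMap EM F E k N)
    (f : C^∞⟮𝓘(ℝ, EM), M; ℝ⟯) (z : N) (X : TangentSpace (𝓡 k) z) : ℝ :=
  dirDeriv (𝓡 k) (fun w => f (Φ.base w)) z X
    - dirDeriv 𝓘(ℝ, EM) f (Φ.base z) (A.anchor (Φ.base z) (Φ.fiber z X))

/-- `(d(Φ^* α) - Φ^*(d_E α))(X, Y)` at `z`, for a section `α` of `E*` and vector fields
`X, Y` on `N`. -/
def defectOne (A : LieAlgebroid EM M F E) (Φ : BundleMap EM F E k N)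
    (α : ∀ x, E x →ₗ[ℝ] ℝ) (X Y : ∀ z : N, TangentSpace (𝓡 k) z) (z : N) : ℝ :=
  dirDeriv (𝓡 k) (fun w => α (Φ.base w) (Φ.fiber w (Y w))) z (X z)
    - dirDeriv (𝓡 k) (fun w => α (Φ.base w) (Φ.fiber w (X w))) z (Y z)
    - α (Φ.base z) (Φ.fiber z (VectorField.mlieBracket (𝓡 k) X Y z))
    - A.dOneForm α (Φ.base z) (Φ.fiber z (X z)) (Φ.fiber z (Y z))

/-- `Φ : TN → E` is a morphism of Lie algebroids: `Φ^*` commutes with the differentials on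
functions and on one-forms (which generate all algebroid forms). -/
def IsLieAlgebroidMorphism (A : LieAlgebroid EM M F E) (Φ : BundleMap EM F E k N) : Prop :=
  (∀ (f : C^∞⟮𝓘(ℝ, EM), M; ℝ⟯) (z : N) (X : TangentSpace (𝓡 k) z), Φ.defectZero A f z X = 0) ∧
  ∀ (α : ∀ x, E x →ₗ[ℝ] ℝ) (X Y : Cₛ^∞⟮𝓡 k; EuclideanSpace ℝ (Fin k),
      (TangentSpace (𝓡 k) : N → Type _)⟯) (z : N),
    LieAlgebroid.IsOneForm (EM := EM) (F := F) α → Φ.defectOne A α X Y z = 0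

/-- `Tr(g⁻¹ Φ^* q)` at `z`, for a function `q` on `E` that is quadratic on the fibres. -/
def pullbackTrace
    (g : ContMDiffRiemannianMetric (𝓡 k) ∞ (EuclideanSpace ℝ (Fin k))
      (TangentSpace (𝓡 k) : N → Type _))
    (Φ : BundleMap EM F E k N) (q : TotalSpace F E → ℝ) (z : N) : ℝ :=
  metricTrace g z fun X => q (Φ.toMap ⟨z, X⟩)

/-- The sigma model action `∫_D Tr(g⁻¹ Φ^* G) dVol_g` over a region `D ⊆ N`. The action `S[Φ]` of
the model is the case `D = N`. -/
def action [MeasurableSpace N] [T2Space N] [SigmaCompactSpace N]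
    [∀ x, IsTopologicalAddGroup (E x)] [∀ x, ContinuousConstSMul ℝ (E x)]
    (g : ContMDiffRiemannianMetric (𝓡 k) ∞ (EuclideanSpace ℝ (Fin k))
      (TangentSpace (𝓡 k) : N → Type _))
    (G : ContMDiffRiemannianMetric 𝓘(ℝ, EM) ∞ F E) (D : Set N)
    (Φ : BundleMap EM F E k N) : ℝ :=
  ∫ z in D, Φ.pullbackTrace g (metricFunction G) z ∂(riemannianVolume g)

end BundleMap

namespace LieAlgebroid

variable (A : LieAlgebroid EM M F E)

/-- The infinitesimal field redefinition induced by the section `u`: the value at the field `Φ` is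
the vector field `d_T(u) ∘ Φ` along `Φ`, i.e. in coordinates
`δφ^A = u^a Q_a^A`, `δχ_i^a = χ_i^b (Q_b^A ∂u^a/∂x^A - u^c Q_{cb}^a)`. -/
def redefinition (u : A.Sec) (Φ : BundleMap EM F E k N) (p : TangentBundle (𝓡 k) N) :
    TangentSpace (𝓘(ℝ, EM).prod 𝓘(ℝ, F)) (Φ.toMap p) :=
  A.tangentLift u (Φ.toMap p)

/-- The smooth one-parameter family of fields `Ψ t` realises, to first order at `t = 0`, the
field redefinition of `Ψ 0` induced by `u`. No field equation and no morphism condition is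
imposed. -/
def IsRedefinitionFamily (u : A.Sec) (Ψ : ℝ → BundleMap EM F E k N) : Prop :=
  ContMDiff (𝓘(ℝ, ℝ).prod (𝓡 k).tangent) (𝓘(ℝ, EM).prod 𝓘(ℝ, F)) ∞
    (fun r : ℝ × TangentBundle (𝓡 k) N => (Ψ r.1).toMap r.2) ∧
  ∀ p, mfderiv 𝓘(ℝ, ℝ) (𝓘(ℝ, EM).prod 𝓘(ℝ, F)) (fun t => (Ψ t).toMap p) 0 (1 : ℝ) =
    A.redefinition u (Ψ 0) p

/-- `O'` is the first variation of the functional `O` of the fields under the redefinition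
induced by `u`. -/
def HasVariation (u : A.Sec) (O O' : BundleMap EM F E k N → ℝ) : Prop :=
  ∀ Ψ : ℝ → BundleMap EM F E k N, A.IsRedefinitionFamily u Ψ →
    HasDerivAt (fun t => O (Ψ t)) (O' (Ψ 0)) 0

/-- At Lie algebroid morphisms, the redefinition induced by `u` satisfies the linearised morphism
condition, i.e. it is tangent to the space of fields of the model. -/
def PreservesMorphisms (k : ℕ) (N : Type*) [TopologicalSpace N]
    [ChartedSpace (EuclideanSpace ℝ (Fin k)) N] [IsManifold (𝓡 k) ∞ N] (u : A.Sec) : Prop :=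
  ∀ Ψ : ℝ → BundleMap EM F E k N, A.IsRedefinitionFamily u Ψ →
    (Ψ 0).IsLieAlgebroidMorphism A →
    (∀ (f : C^∞⟮𝓘(ℝ, EM), M; ℝ⟯) (z : N) (X : TangentSpace (𝓡 k) z),
      HasDerivAt (fun t => (Ψ t).defectZero A f z X) 0 0) ∧
    ∀ (α : ∀ x, E x →ₗ[ℝ] ℝ) (X Y : Cₛ^∞⟮𝓡 k; EuclideanSpace ℝ (Fin k),
        (TangentSpace (𝓡 k) : N → Type _)⟯) (z : N),
      IsOneForm (EM := EM) (F := F) α → HasDerivAt (fun t => (Ψ t).defectOne A α X Y z) 0 0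

variable [MeasurableSpace N] [T2Space N] [SigmaCompactSpace N]
    [∀ x, IsTopologicalAddGroup (E x)] [∀ x, ContinuousConstSMul ℝ (E x)]
    (g : ContMDiffRiemannianMetric (𝓡 k) ∞ (EuclideanSpace ℝ (Fin k))
      (TangentSpace (𝓡 k) : N → Type _))
    (G : ContMDiffRiemannianMetric 𝓘(ℝ, EM) ∞ F E)

/-- The action over the region `D` is invariant under the field redefinition induced by `u`: its
first variation vanishes at every Lie algebroid morphism. For the integral to converge, the part
of `D` on which the fields are not zero is required to lie in a compact set; for compact `D`, in
particular if `N` is compact and `D = N`, this is no restriction. -/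
def LeavesActionInvariant (D : Set N) (u : A.Sec) : Prop :=
  ∀ Ψ : ℝ → BundleMap EM F E k N, A.IsRedefinitionFamily u Ψ →
    (Ψ 0).IsLieAlgebroidMorphism A →
    (∃ C : Set N, IsCompact C ∧ ∀ t, ∀ z ∈ D \ C, (Ψ t).fiber z = 0) →
    HasDerivAt (fun t => (Ψ t).action g G D) 0 0

/-- `u` induces an internal symmetry of the sigma model: the induced field redefinition is tangent
to the space of Lie algebroid morphisms and leaves the action invariant, over every region. -/
def IsInternalSymmetry (u : A.Sec) : Prop :=
  A.PreservesMorphisms k N u ∧ ∀ D : Set N, MeasurableSet D → A.LeavesActionInvariant g G D u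

end LieAlgebroid

end SigmaModel

end

open Bundle MeasureTheory Set
open scoped Manifold ContDiff Topology

noncomputable section

set_option linter.unusedSectionVars false

/-! ### Directional derivatives on manifolds -/

section DirDeriv

variable {V H P : Type*} [NormedAddCommGroup V] [NormedSpace ℝ V] [TopologicalSpace H]
  {I : ModelWithCorners ℝ V H} [TopologicalSpace P] [ChartedSpace H P]
  {V' H' P' : Type*} [NormedAddCommGroup V'] [NormedSpace ℝ V'] [TopologicalSpace H']
  {I' : ModelWithCorners ℝ V' H'} [TopologicalSpace P'] [ChartedSpace H' P']

/-! Everything rests on the tangent lift being a well-defined, smooth, fibrewise linear vector field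
on `E` that depends on `u` as a Lie algebra homomorphism. Tangent vectors of the total space are
separated by two kinds of functions: basic functions `f ∘ π`, and one-forms read as fibrewise linear
functions (`eq_zero_of_dirDeriv_eq_zero`). On these, `d_T(u)` acts by `ρ(u) f` and by `ρ(u)(α(v)) -
α([u, v])`; the Leibniz rule makes the second expression depend on `v` only through its value at the
point. Identities between vector fields on `E` are therefore checked on these two classes alone.
Compatibility of the anchor with brackets and the Jacobi identity then give `L_[u,v] = [L_u, L_v]`
on all functions (`lieDeriv_lie`). Hence Killing sections are closed under the bracket and the
redefinitions close without any field equation.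

The first variation of a function of the field at a point is the chain rule along the curve `t ↦ Ψ t
p`. For the Lagrangian it is applied to the values of `G` that enter the trace; for the action one
differentiates under the integral over a compact set. This yields `L_u G` in place of `G`, so
Killing implies invariance. For the morphism condition, the first variation of the defect at `f` or
`α` is the defect of the same field at `ρ(u) f` or `L_u α`, because `L_u` commutes with `d_E`; at a
morphism these defects vanish.

The converse needs enough Lie algebroid morphisms to detect `L_u G`. If `L_u G` is non-zero at `e₀`,
take a section `v` through `e₀`, an integral curve `γ` of `ρ(v)`, and a compactly supported function
`h` on `N` with small values and `dh ≠ 0` somewhere. Then `Φ = dh ⊗ v(γ(h))` factors as `TN → Tℝ →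
E` and is a morphism (`isLieAlgebroidMorphism_rankOne`), with `Tr(g⁻¹ Φ^* L_u G) = |dh|² · L_u
G(v(γ(h)))`. For small `h` this density has a fixed sign and does not vanish identically. A family
with the prescribed velocity at `Φ` exists by moving `v(γ(h))` in a chart of `E`
(`exists_family_hasVelocity`), so the first variation of the total action is non-zero, a
contradiction. -/

theorem ContMDiff.mdiffAt {f : P → P'} (hf : ContMDiff I I' ∞ f) (x : P) :
    MDifferentiableAt I I' f x :=
  (hf x).mdifferentiableAt (by simp)

theorem ContMDiffAt.mdiffAt {f : P → P'} {x : P} (hf : ContMDiffAt I I' ∞ f x) :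
    MDifferentiableAt I I' f x :=
  hf.mdifferentiableAt (by simp)

theorem dirDeriv_comp {q : P' → ℝ} {F : P → P'} {x : P}
    (hq : MDifferentiableAt I' 𝓘(ℝ, ℝ) q (F x)) (hF : MDifferentiableAt I I' F x)
    (X : TangentSpace I x) :
    dirDeriv I (fun y => q (F y)) x X = dirDeriv I' q (F x) (mfderiv I I' F x X) := by
  unfold dirDeriv
  have := mfderiv_comp x hq hF
  exact DFunLike.congr_fun this X

theorem dirDeriv_congr {f f' : P → ℝ} {x : P} (h : f =ᶠ[𝓝 x] f') (X : TangentSpace I x) :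
    dirDeriv I f x X = dirDeriv I f' x X := by
  unfold dirDeriv
  rw [h.mfderiv_eq]
  rfl

theorem dirDeriv_const (c : ℝ) (x : P) (X : TangentSpace I x) :
    dirDeriv I (fun _ => c) x X = 0 := by
  unfold dirDeriv
  rw [mfderiv_const]
  rfl

theorem dirDeriv_zero (f : P → ℝ) (x : P) : dirDeriv I f x 0 = 0 := map_zero _

theorem dirDeriv_vec_add (f : P → ℝ) (x : P) (X Y : TangentSpace I x) :
    dirDeriv I f x (X + Y) = dirDeriv I f x X + dirDeriv I f x Y := map_add _ _ _

theorem dirDeriv_vec_sub (f : P → ℝ) (x : P) (X Y : TangentSpace I x) :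
    dirDeriv I f x (X - Y) = dirDeriv I f x X - dirDeriv I f x Y := map_sub _ _ _

theorem dirDeriv_vec_smul (f : P → ℝ) (x : P) (c : ℝ) (X : TangentSpace I x) :
    dirDeriv I f x (c • X) = c * dirDeriv I f x X := map_smul _ _ _

theorem dirDeriv_add {f f' : P → ℝ} {x : P} (hf : MDifferentiableAt I 𝓘(ℝ, ℝ) f x)
    (hf' : MDifferentiableAt I 𝓘(ℝ, ℝ) f' x) (X : TangentSpace I x) :
    dirDeriv I (fun y => f y + f' y) x X = dirDeriv I f x X + dirDeriv I f' x X := by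
  unfold dirDeriv
  exact DFunLike.congr_fun (hf.hasMFDerivAt.add hf'.hasMFDerivAt).mfderiv X

theorem dirDeriv_sub {f f' : P → ℝ} {x : P} (hf : MDifferentiableAt I 𝓘(ℝ, ℝ) f x)
    (hf' : MDifferentiableAt I 𝓘(ℝ, ℝ) f' x) (X : TangentSpace I x) :
    dirDeriv I (fun y => f y - f' y) x X = dirDeriv I f x X - dirDeriv I f' x X := by
  unfold dirDeriv
  exact DFunLike.congr_fun (hf.hasMFDerivAt.sub hf'.hasMFDerivAt).mfderiv X

theorem dirDeriv_mul {f f' : P → ℝ} {x : P} (hf : MDifferentiableAt I 𝓘(ℝ, ℝ) f x)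
    (hf' : MDifferentiableAt I 𝓘(ℝ, ℝ) f' x) (X : TangentSpace I x) :
    dirDeriv I (fun y => f y * f' y) x X = f x * dirDeriv I f' x X + f' x * dirDeriv I f x X := by
  unfold dirDeriv
  exact DFunLike.congr_fun (hf.hasMFDerivAt.mul hf'.hasMFDerivAt).mfderiv X

theorem dirDeriv_const_mul {f : P → ℝ} {x : P} (hf : MDifferentiableAt I 𝓘(ℝ, ℝ) f x) (c : ℝ)
    (X : TangentSpace I x) :
    dirDeriv I (fun y => c * f y) x X = c * dirDeriv I f x X := by
  have := dirDeriv_mul (mdifferentiableAt_const (c := c)) hf X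
  rw [this, dirDeriv_const, mul_zero, add_zero]

theorem mdifferentiableAt_finset_sum {ι : Type*} {s : Finset ι} {f : ι → P → ℝ} {x : P}
    (hf : ∀ i ∈ s, MDifferentiableAt I 𝓘(ℝ, ℝ) (f i) x) :
    MDifferentiableAt I 𝓘(ℝ, ℝ) (fun y => ∑ i ∈ s, f i y) x := by
  classical
  induction s using Finset.induction_on with
  | empty => simpa using mdifferentiableAt_const
  | insert a s ha ih =>
    simp only [Finset.sum_insert ha]
    exact (hf a (Finset.mem_insert_self _ _)).add
      (ih fun i hi => hf i (Finset.mem_insert_of_mem hi))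

theorem dirDeriv_sum {ι : Type*} {s : Finset ι} {f : ι → P → ℝ} {x : P}
    (hf : ∀ i ∈ s, MDifferentiableAt I 𝓘(ℝ, ℝ) (f i) x) (X : TangentSpace I x) :
    dirDeriv I (fun y => ∑ i ∈ s, f i y) x X = ∑ i ∈ s, dirDeriv I (f i) x X := by
  classical
  induction s using Finset.induction_on with
  | empty => simpa using dirDeriv_const 0 x X
  | insert a s ha ih =>
    simp only [Finset.sum_insert ha]
    rw [dirDeriv_add (hf a (Finset.mem_insert_self _ _))
        (mdifferentiableAt_finset_sum fun i hi => hf i (Finset.mem_insert_of_mem hi)),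
      ih fun i hi => hf i (Finset.mem_insert_of_mem hi)]

theorem dirDeriv_real (f : ℝ → ℝ) (x c : ℝ) : dirDeriv 𝓘(ℝ, ℝ) f x c = c * deriv f x := by
  unfold dirDeriv
  rw [mfderiv_eq_fderiv]
  have : c = c • (1 : ℝ) := by simp
  change fderiv ℝ f x c = _
  rw [this, map_smul]
  simp

/-- The chain rule along a curve. -/
theorem hasDerivAt_comp_curve {q : P → ℝ} {c : ℝ → P} {t : ℝ}
    (hq : MDifferentiableAt I 𝓘(ℝ, ℝ) q (c t)) (hc : MDifferentiableAt 𝓘(ℝ, ℝ) I c t) :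
    HasDerivAt (fun s => q (c s)) (dirDeriv I q (c t) (mfderiv 𝓘(ℝ, ℝ) I c t (1 : ℝ))) t := by
  have h := (dirDeriv_comp hq hc (1 : ℝ)).symm.trans (dirDeriv_real _ _ _)
  rw [one_mul] at h
  have : MDifferentiableAt 𝓘(ℝ, ℝ) 𝓘(ℝ, ℝ) (fun s => q (c s)) t := hq.comp t hc
  exact h ▸ this.differentiableAt.hasDerivAt

/-- The derivative of a function in a chart. -/
theorem dirDeriv_eq_fderiv [IsManifold I ∞ P] [I.Boundaryless] {f : P → ℝ} {x₀ x : P}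
    (hx : x ∈ (extChartAt I x₀).source) (hf : MDifferentiableAt I 𝓘(ℝ, ℝ) f x)
    (X : TangentSpace I x) :
    dirDeriv I f x X = fderiv ℝ (fun y => f ((extChartAt I x₀).symm y)) (extChartAt I x₀ x)
      (mfderiv I 𝓘(ℝ, V) (extChartAt I x₀) x X) := by
  have : IsManifold I 1 P := IsManifold.of_le (n := ∞) (by simp)
  have hs : MDifferentiableAt 𝓘(ℝ, V) I (extChartAt I x₀).symm (extChartAt I x₀ x) := by
    have := mdifferentiableWithinAt_extChartAt_symm (I := I) (x := x₀)
      ((extChartAt I x₀).map_source hx)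
    rwa [I.range_eq_univ, mdifferentiableWithinAt_univ] at this
  have hφ : MDifferentiableAt I 𝓘(ℝ, V) (extChartAt I x₀) x :=
    mdifferentiableAt_extChartAt (by simpa using hx)
  have hf' : MDifferentiableAt I 𝓘(ℝ, ℝ) f ((extChartAt I x₀).symm (extChartAt I x₀ x)) := by
    rwa [(extChartAt I x₀).left_inv hx]
  have hfs : MDifferentiableAt 𝓘(ℝ, V) 𝓘(ℝ, ℝ) (fun y => f ((extChartAt I x₀).symm y))
      (extChartAt I x₀ x) := hf'.comp _ hs
  have h : f =ᶠ[𝓝 x] fun z => (fun y => f ((extChartAt I x₀).symm y)) (extChartAt I x₀ z) := by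
    filter_upwards [extChartAt_source_mem_nhds' hx] with z hz
    exact congrArg f ((extChartAt I x₀).left_inv hz).symm
  rw [dirDeriv_congr h, dirDeriv_comp hfs hφ, dirDeriv, mfderiv_eq_fderiv]
  rfl

theorem mdifferentiableAt_extChartAt_symm [IsManifold I ∞ P] [I.Boundaryless] {x₀ : P} {y : V}
    (hy : y ∈ (extChartAt I x₀).target) :
    MDifferentiableAt 𝓘(ℝ, V) I (extChartAt I x₀).symm y := by
  have : IsManifold I 1 P := IsManifold.of_le (n := ∞) (by simp)
  have := mdifferentiableWithinAt_extChartAt_symm (I := I) (x := x₀) hy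
  rwa [I.range_eq_univ, mdifferentiableWithinAt_univ] at this

/-- The pullback of a vector field inverts the differential of the inverse chart, so the chain rule
cancels the two. This lets iterated directional derivatives be computed entirely in coordinates. -/
theorem fderiv_mpullbackWithin_extChartAt_symm [IsManifold I ∞ P] [I.Boundaryless] {f : P → ℝ}
    {x₀ : P} {y : V} (hy : y ∈ (extChartAt I x₀).target)
    (hf : MDifferentiableAt I 𝓘(ℝ, ℝ) f ((extChartAt I x₀).symm y))
    (X : ∀ z : P, TangentSpace I z) :
    fderiv ℝ (fun y => f ((extChartAt I x₀).symm y)) y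
      (VectorField.mpullbackWithin 𝓘(ℝ, V) I (extChartAt I x₀).symm X (range I) y) =
    dirDeriv I f ((extChartAt I x₀).symm y) (X ((extChartAt I x₀).symm y)) := by
  have : IsManifold I 1 P := IsManifold.of_le (n := ∞) (by simp)
  have hs := mdifferentiableAt_extChartAt_symm hy
  have h := dirDeriv_comp hf hs
    (VectorField.mpullbackWithin 𝓘(ℝ, V) I (extChartAt I x₀).symm X (range I) y)
  rw [dirDeriv, mfderiv_eq_fderiv] at h
  refine h.trans ?_
  congr 1
  rw [VectorField.mpullbackWithin_apply, I.range_eq_univ, mfderivWithin_univ]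
  have hinv := isInvertible_mfderivWithin_extChartAt_symm (I := I) (x := x₀) hy
  rw [I.range_eq_univ, mfderivWithin_univ] at hinv
  exact hinv.self_apply_inverse _

/-- In the commutator of iterated derivatives the second derivative of `f` enters symmetrically and
cancels, leaving `df` applied to `DY(X) - DX(Y)`. -/
theorem fderiv_lieBracket {V : Type*} [NormedAddCommGroup V] [NormedSpace ℝ V] {f : V → ℝ}
    {X Y : V → V} {y : V} (hf : ContDiffAt ℝ ∞ f y) (hX : DifferentiableAt ℝ X y)
    (hY : DifferentiableAt ℝ Y y) :
    fderiv ℝ f y (VectorField.lieBracket ℝ X Y y) =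
      fderiv ℝ (fun z => fderiv ℝ f z (Y z)) y (X y)
        - fderiv ℝ (fun z => fderiv ℝ f z (X z)) y (Y y) := by
  have hder : DifferentiableAt ℝ (fderiv ℝ f) y :=
    (hf.fderiv_right (m := ∞) (by simp)).differentiableAt (by simp)
  have hsymm : IsSymmSndFDerivAt ℝ f y := by
    apply hf.isSymmSndFDerivAt
    simp only [minSmoothness_of_isRCLikeNormedField]
    exact WithTop.coe_le_coe.2 le_top
  rw [fderiv_clm_apply hder hY, fderiv_clm_apply hder hX, VectorField.lieBracket]
  have := hsymm.eq (X y) (Y y)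
  simp only [map_sub, add_apply, ContinuousLinearMap.comp_apply,
    ContinuousLinearMap.flip_apply, this]
  ring

/-- The Lie bracket of vector fields is the commutator of directional derivatives. -/
theorem dirDeriv_mlieBracket [IsManifold I ∞ P] [I.Boundaryless] [CompleteSpace V] {f : P → ℝ}
    (hf : ContMDiff I 𝓘(ℝ, ℝ) ∞ f) {X Y : ∀ z : P, TangentSpace I z} {x₀ : P}
    (hX : MDifferentiableAt I I.tangent (fun z => (X z : TangentBundle I P)) x₀)
    (hY : MDifferentiableAt I I.tangent (fun z => (Y z : TangentBundle I P)) x₀)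
    (hXf : MDifferentiableAt I 𝓘(ℝ, ℝ) (fun z => dirDeriv I f z (X z)) x₀)
    (hYf : MDifferentiableAt I 𝓘(ℝ, ℝ) (fun z => dirDeriv I f z (Y z)) x₀) :
    dirDeriv I f x₀ (VectorField.mlieBracket I X Y x₀) =
      dirDeriv I (fun z => dirDeriv I f z (Y z)) x₀ (X x₀)
        - dirDeriv I (fun z => dirDeriv I f z (X z)) x₀ (Y x₀) := by
  have : IsManifold I 1 P := IsManifold.of_le (n := ∞) (by simp)
  have : IsManifold I 2 P := IsManifold.of_le (n := ∞) (WithTop.coe_le_coe.2 le_top)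
  set y₀ : V := extChartAt I x₀ x₀ with hy₀
  have hy₀t : y₀ ∈ (extChartAt I x₀).target := mem_extChartAt_target x₀
  have hback : (extChartAt I x₀).symm y₀ = x₀ := extChartAt_to_inv x₀
  set f' : V → ℝ := fun y => f ((extChartAt I x₀).symm y) with hf'
  -- `mlieBracket` is by definition computed from these pullbacks through the inverse chart, so the
  -- claim is transported to the vector space `V`.
  let pb : (∀ z : P, TangentSpace I z) → V → V := fun Z =>
    VectorField.mpullbackWithin 𝓘(ℝ, V) I (extChartAt I x₀).symm Z (range I)
  have key : ∀ Z : ∀ z : P, TangentSpace I z,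
      MDifferentiableAt I I.tangent (fun z => (Z z : TangentBundle I P)) x₀ →
      DifferentiableAt ℝ (pb Z) y₀ := by
    intro Z hZ
    rw [← mdifferentiableWithinAt_univ] at hZ
    have := hZ.differentiableWithinAt_mpullbackWithin_vectorField
    have hu : (extChartAt I x₀).symm ⁻¹' univ ∩ range I = univ := by simp [I.range_eq_univ]
    exact (this.mono (s := univ) hu.symm.subset).differentiableAt Filter.univ_mem
  have hf'2 : ContDiffAt ℝ ∞ f' y₀ := by
    have h1 : ContMDiffAt 𝓘(ℝ, V) I ∞ (extChartAt I x₀).symm y₀ :=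
      contMDiffOn_extChartAt_symm (I := I) (n := ∞) x₀ |>.contMDiffAt
        (extChartAt_target_mem_nhds x₀)
    exact (hf.contMDiffAt.comp y₀ h1).contDiffAt
  -- The inner derivative must agree with its coordinate expression on a whole neighbourhood of
  -- `y₀`, since it is differentiated once more.
  have second : ∀ Z W : ∀ z : P, TangentSpace I z,
      MDifferentiableAt I 𝓘(ℝ, ℝ) (fun z => dirDeriv I f z (W z)) x₀ →
      dirDeriv I (fun z => dirDeriv I f z (W z)) x₀ (Z x₀) =
        fderiv ℝ (fun z => fderiv ℝ f' z (pb W z)) y₀ (pb Z y₀) := by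
    intro Z W hWf
    have h1 := fderiv_mpullbackWithin_extChartAt_symm (f := fun z => dirDeriv I f z (W z)) hy₀t
      (by rwa [hback]) Z
    have h2 : (fun y => dirDeriv I f ((extChartAt I x₀).symm y) (W ((extChartAt I x₀).symm y)))
        =ᶠ[𝓝 y₀] fun y => fderiv ℝ f' y (pb W y) := by
      filter_upwards [extChartAt_target_mem_nhds x₀] with y hy
      exact (fderiv_mpullbackWithin_extChartAt_symm hy (hf.mdiffAt _) W).symm
    rw [h2.fderiv_eq, hback] at h1
    exact h1.symm
  have hb : dirDeriv I f x₀ (VectorField.mlieBracket I X Y x₀) =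
      fderiv ℝ f' y₀ (VectorField.lieBracket ℝ (pb X) (pb Y) y₀) := by
    rw [dirDeriv_eq_fderiv (mem_extChartAt_source x₀) (hf.mdiffAt _)]
    congr 1
    rw [← VectorField.mlieBracketWithin_univ, VectorField.mlieBracketWithin_apply]
    have hinv := isInvertible_mfderiv_extChartAt (I := I) (mem_extChartAt_source x₀)
    refine (hinv.self_apply_inverse _).trans ?_
    have hu : (extChartAt I x₀).symm ⁻¹' univ ∩ range I = univ := by simp [I.range_eq_univ]
    rw [hu]
    exact congrFun (VectorField.lieBracketWithin_univ (V := pb X) (W := pb Y)) y₀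
  rw [second X Y hYf, second Y X hXf, hb]
  exact fderiv_lieBracket hf'2 (key X hX) (key Y hY)

end DirDeriv

/-! ### Smooth families and vector fields -/

section Calculus

variable {V H P : Type*} [NormedAddCommGroup V] [NormedSpace ℝ V] [TopologicalSpace H]
  {I : ModelWithCorners ℝ V H} [TopologicalSpace P] [ChartedSpace H P]
  {V' H' P' : Type*} [NormedAddCommGroup V'] [NormedSpace ℝ V'] [TopologicalSpace H']
  {I' : ModelWithCorners ℝ V' H'} [TopologicalSpace P'] [ChartedSpace H' P']

/-- The directional derivative is the fibre component of the tangent map of `f`, which is smooth on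
the whole tangent bundle. -/
theorem ContMDiff.contMDiffAt_dirDeriv [IsManifold I ∞ P] {f : P → ℝ}
    (hf : ContMDiff I 𝓘(ℝ, ℝ) ∞ f) {F : P' → TangentBundle I P} {x : P'}
    (hF : ContMDiffAt I' I.tangent ∞ F x) :
    ContMDiffAt I' 𝓘(ℝ, ℝ) ∞ (fun y => dirDeriv I f (F y).1 (F y).2) x := by
  have : IsManifold I 1 P := IsManifold.of_le (n := ∞) (by simp)
  have h1 : ContMDiff I.tangent 𝓘(ℝ, ℝ).tangent ∞ (tangentMap I 𝓘(ℝ, ℝ) f) :=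
    hf.contMDiff_tangentMap (by simp)
  exact (contMDiff_snd_tangentBundle_modelSpace ℝ 𝓘(ℝ, ℝ)).contMDiffAt.comp x
    (h1.contMDiffAt.comp x hF)

theorem ContMDiff.dirDeriv [IsManifold I ∞ P] {f : P → ℝ} (hf : ContMDiff I 𝓘(ℝ, ℝ) ∞ f)
    {F : P' → TangentBundle I P} (hF : ContMDiff I' I.tangent ∞ F) :
    ContMDiff I' 𝓘(ℝ, ℝ) ∞ (fun y => dirDeriv I f (F y).1 (F y).2) :=
  fun x => hf.contMDiffAt_dirDeriv (hF x)

/-- The tangent vector `(a, b)` of a product manifold depends smoothly on `a` and `b`. -/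
theorem contMDiffAt_tangentBundle_prodMk [IsManifold I ∞ P] [IsManifold I' ∞ P']
    {V₁ H₁ Q : Type*} [NormedAddCommGroup V₁] [NormedSpace ℝ V₁] [TopologicalSpace H₁]
    {J : ModelWithCorners ℝ V₁ H₁} [TopologicalSpace Q] [ChartedSpace H₁ Q]
    {F : Q → TangentBundle I P} {F' : Q → TangentBundle I' P'} {x : Q}
    (hF : ContMDiffAt J I.tangent ∞ F x) (hF' : ContMDiffAt J I'.tangent ∞ F' x) :
    ContMDiffAt J (I.prod I').tangent ∞ (fun y => (⟨((F y).1, (F' y).1), ((F y).2, (F' y).2)⟩ :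
      TangentBundle (I.prod I') (P × P'))) x := by
  have : IsManifold I 1 P := IsManifold.of_le (n := ∞) (by simp)
  have : IsManifold I' 1 P' := IsManifold.of_le (n := ∞) (by simp)
  exact (contMDiff_equivTangentBundleProd_symm (I := I) (M := P) (I' := I') (M' := P')
    (n := ∞)).contMDiffAt.comp x (hF.prodMk hF')

theorem deriv_eq_dirDeriv {h : ℝ × P → ℝ} (hh : ContMDiff (𝓘(ℝ, ℝ).prod I) 𝓘(ℝ, ℝ) ∞ h)
    (t : ℝ) (p : P) :
    HasDerivAt (fun s => h (s, p))
      (dirDeriv (𝓘(ℝ, ℝ).prod I) h (t, p) ((1 : ℝ), (0 : TangentSpace I p))) t := by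
  have hc : MDifferentiableAt 𝓘(ℝ, ℝ) (𝓘(ℝ, ℝ).prod I) (fun s : ℝ => (s, p)) t :=
    mdifferentiableAt_id.prodMk mdifferentiableAt_const
  have := hasDerivAt_comp_curve (hh.mdiffAt (t, p)) hc
  rw [mfderiv_prod_left] at this
  exact this

/-- The derivative in the parameter of a smooth family of functions is smooth. -/
theorem contMDiff_deriv_fst [IsManifold I ∞ P] {h : ℝ × P → ℝ}
    (hh : ContMDiff (𝓘(ℝ, ℝ).prod I) 𝓘(ℝ, ℝ) ∞ h) :
    ContMDiff (𝓘(ℝ, ℝ).prod I) 𝓘(ℝ, ℝ) ∞ (fun r : ℝ × P => deriv (fun s => h (s, r.2)) r.1) := by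
  have : IsManifold I 1 P := IsManifold.of_le (n := ∞) (by simp)
  have e : (fun r : ℝ × P => deriv (fun s => h (s, r.2)) r.1) =
      fun r : ℝ × P => dirDeriv (𝓘(ℝ, ℝ).prod I) h r ((1 : ℝ), (0 : TangentSpace I r.2)) := by
    ext ⟨t, p⟩
    exact (deriv_eq_dirDeriv hh t p).deriv
  rw [e]
  have h1 : ContMDiff 𝓘(ℝ, ℝ) 𝓘(ℝ, ℝ).tangent ∞
      (fun t : ℝ => (⟨t, (1 : ℝ)⟩ : TangentBundle 𝓘(ℝ, ℝ) ℝ)) :=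
    contMDiff_vectorSpace_iff_contDiff.2 contDiff_const
  have h2 : ContMDiff I I.tangent ∞ (fun p : P => (⟨p, 0⟩ : TangentBundle I P)) :=
    contMDiff_zeroSection ℝ _
  intro r
  exact hh.contMDiffAt_dirDeriv (F := fun r : ℝ × P =>
    (⟨(r.1, r.2), ((1 : ℝ), (0 : TangentSpace I r.2))⟩ :
      TangentBundle (𝓘(ℝ, ℝ).prod I) (ℝ × P)))
    (contMDiffAt_tangentBundle_prodMk (h1.comp contMDiff_fst).contMDiffAt
      (h2.comp contMDiff_snd).contMDiffAt)

/-- Both sides are values of the second derivative of `h` at `(t, y)` on the directions `(1, 0)` and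
`(0, X)`, in opposite orders. -/
theorem hasDerivAt_fderiv_snd {h : ℝ × V → ℝ} {t : ℝ} {y : V} (hh : ContDiffAt ℝ ∞ h (t, y))
    (X : V) :
    HasDerivAt (fun s => fderiv ℝ (fun z => h (s, z)) y X)
      (fderiv ℝ (fun z => deriv (fun s => h (s, z)) t) y X) t := by
  have hev : ∀ᶠ r in 𝓝 (t, y), DifferentiableAt ℝ h r := by
    have : ContDiffAt ℝ 1 h (t, y) := hh.of_le (by simp)
    filter_upwards [this.eventually (by simp)] with r hr
    exact hr.differentiableAt (by simp)
  have hder : DifferentiableAt ℝ (fderiv ℝ h) (t, y) :=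
    (hh.fderiv_right (m := ∞) (by simp)).differentiableAt (by simp)
  have hsymm : IsSymmSndFDerivAt ℝ h (t, y) := by
    apply hh.isSymmSndFDerivAt
    simp only [minSmoothness_of_isRCLikeNormedField]
    exact WithTop.coe_le_coe.2 le_top
  have e1 : (fun s => fderiv ℝ (fun z => h (s, z)) y X) =ᶠ[𝓝 t]
      fun s => fderiv ℝ h (s, y) (0, X) := by
    have : Filter.Tendsto (fun s : ℝ => (s, y)) (𝓝 t) (𝓝 (t, y)) :=
      (Continuous.prodMk_left y).tendsto t
    filter_upwards [this.eventually hev] with s hs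
    have h2 : HasFDerivAt (fun z : V => (s, z)) (ContinuousLinearMap.inr ℝ ℝ V) y :=
      hasFDerivAt_prodMk_right s y
    have := (HasFDerivAt.comp y hs.hasFDerivAt h2).fderiv
    exact DFunLike.congr_fun this X
  have e2 : (fun z => deriv (fun s => h (s, z)) t) =ᶠ[𝓝 y]
      fun z => fderiv ℝ h (t, z) (1, 0) := by
    have : Filter.Tendsto (fun z : V => (t, z)) (𝓝 y) (𝓝 (t, y)) :=
      (Continuous.prodMk_right t).tendsto y
    filter_upwards [this.eventually hev] with z hz
    have h2 : HasFDerivAt (fun s : ℝ => (s, z)) (ContinuousLinearMap.inl ℝ ℝ V) t :=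
      hasFDerivAt_prodMk_left t z
    have h3 := (HasFDerivAt.comp t hz.hasFDerivAt h2).hasDerivAt.deriv
    exact h3
  rw [e2.fderiv_eq]
  refine HasDerivAt.congr_of_eventuallyEq ?_ e1
  have d1 : HasDerivAt (fun s => fderiv ℝ h (s, y)) (fderiv ℝ (fderiv ℝ h) (t, y) (1, 0)) t := by
    have := HasFDerivAt.comp t hder.hasFDerivAt (hasFDerivAt_prodMk_left (𝕜 := ℝ) t y)
    exact this.hasDerivAt
  have d2 : HasFDerivAt (fun z => fderiv ℝ h (t, z))
      ((fderiv ℝ (fderiv ℝ h) (t, y)).comp (ContinuousLinearMap.inr ℝ ℝ V)) y :=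
    HasFDerivAt.comp y hder.hasFDerivAt (hasFDerivAt_prodMk_right (𝕜 := ℝ) t y)
  have d2' := (d2.clm_apply (hasFDerivAt_const ((1 : ℝ), (0 : V)) y)).fderiv
  have d1' := d1.clm_apply (hasDerivAt_const t ((0 : ℝ), X))
  rw [d2']
  convert d1' using 1
  simp [hsymm.eq (0, X) (1, 0)]

/-- Directional derivatives commute with the derivative in the parameter of a smooth family. -/
theorem hasDerivAt_dirDeriv [IsManifold I ∞ P] [I.Boundaryless] {h : ℝ × P → ℝ}
    (hh : ContMDiff (𝓘(ℝ, ℝ).prod I) 𝓘(ℝ, ℝ) ∞ h) (t : ℝ) (x : P) (X : TangentSpace I x) :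
    HasDerivAt (fun s => dirDeriv I (fun y => h (s, y)) x X)
      (dirDeriv I (fun y => deriv (fun s => h (s, y)) t) x X) t := by
  have hs : ∀ s, ContMDiff I 𝓘(ℝ, ℝ) ∞ (fun y => h (s, y)) := fun s =>
    hh.comp (contMDiff_const.prodMk contMDiff_id)
  have hd : ContMDiff I 𝓘(ℝ, ℝ) ∞ (fun y => deriv (fun s => h (s, y)) t) :=
    (contMDiff_deriv_fst hh).comp (contMDiff_const.prodMk contMDiff_id)
  simp_rw [fun s => dirDeriv_eq_fderiv (mem_extChartAt_source x) ((hs s).mdiffAt x) X]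
  rw [dirDeriv_eq_fderiv (mem_extChartAt_source x) (hd.mdiffAt x) X]
  refine hasDerivAt_fderiv_snd (h := fun r : ℝ × V => h (r.1, (extChartAt I x).symm r.2)) ?_ _
  have h1 : ContMDiffAt 𝓘(ℝ, V) I ∞ (extChartAt I x).symm (extChartAt I x x) :=
    contMDiffOn_extChartAt_symm (I := I) (n := ∞) x |>.contMDiffAt (extChartAt_target_mem_nhds x)
  have h2 : ContMDiffAt (𝓘(ℝ, ℝ).prod 𝓘(ℝ, V)) (𝓘(ℝ, ℝ).prod I) ∞
      (fun r : ℝ × V => (r.1, (extChartAt I x).symm r.2)) (t, extChartAt I x x) :=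
    contMDiffAt_fst.prodMk (h1.comp (t, extChartAt I x x) contMDiffAt_snd)
  have h3 := hh.contMDiffAt.comp _ h2
  rw [← modelWithCornersSelf_prod, chartedSpaceSelf_prod] at h3
  exact h3.contDiffAt

/-- Smooth functions separate tangent vectors. -/
theorem eq_zero_of_forall_dirDeriv_eq_zero [IsManifold I ∞ P] [I.Boundaryless] [T2Space P]
    [FiniteDimensional ℝ V] {x : P} {X : TangentSpace I x}
    (h : ∀ f : C^∞⟮I, P; ℝ⟯, dirDeriv I f x X = 0) : X = 0 := by
  have : IsManifold I 1 P := IsManifold.of_le (n := ∞) (by simp)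
  obtain ⟨χ⟩ : Nonempty (SmoothBumpFunction I x) := inferInstance
  have hφ : MDifferentiableAt I 𝓘(ℝ, V) (extChartAt I x) x :=
    mdifferentiableAt_extChartAt (mem_chart_source H x)
  have key : ∀ l : V →L[ℝ] ℝ, l (mfderiv I 𝓘(ℝ, V) (extChartAt I x) x X) = 0 := by
    intro l
    -- A linear coordinate multiplied by a bump function is globally smooth and has the same
    -- differential at `x`.
    have hg : ContMDiffOn I 𝓘(ℝ, ℝ) ∞ (fun y => l (extChartAt I x y)) (chartAt H x).source :=
      l.contMDiff.comp_contMDiffOn contMDiffOn_extChartAt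
    have h0 := h ⟨_, χ.contMDiff_smul hg⟩
    have he : (fun y => χ y • l (extChartAt I x y)) =ᶠ[𝓝 x] fun y => l (extChartAt I x y) := by
      filter_upwards [χ.eventuallyEq_one] with y hy
      rw [hy, Pi.one_apply, one_smul]
    have h1 := (dirDeriv_congr he X).symm.trans h0
    have h2 := dirDeriv_comp (I := I) (I' := 𝓘(ℝ, V)) (q := l) l.mdifferentiableAt hφ X
    rw [h1] at h2
    rw [dirDeriv, ContinuousLinearMap.mfderiv_eq] at h2
    exact h2.symm
  have h0 : mfderiv I 𝓘(ℝ, V) (extChartAt I x) x X = 0 := by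
    have hw : ∀ w : V, (∀ l : V →L[ℝ] ℝ, l w = 0) → w = 0 := by
      intro w hw
      by_contra hne
      obtain ⟨l, hl⟩ := SeparatingDual.exists_ne_zero (R := ℝ) (V := V) hne
      exact hl (hw l)
    exact hw _ key
  have hinv := isInvertible_mfderiv_extChartAt (I := I) (mem_extChartAt_source x)
  exact hinv.injective (h0.trans (map_zero _).symm)

/-- A smooth vector field is smooth in a chart. -/
theorem contMDiffOn_mfderiv_extChartAt [IsManifold I ∞ P] {Z : ∀ p : P, TangentSpace I p}
    (hZ : ContMDiff I I.tangent ∞ (fun p => (⟨p, Z p⟩ : TangentBundle I P))) (p₀ : P) :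
    ContMDiffOn I 𝓘(ℝ, V) ∞
      (fun p => (mfderiv I 𝓘(ℝ, V) (extChartAt I p₀) p (Z p) : V)) (extChartAt I p₀).source := by
  have : IsManifold I 1 P := IsManifold.of_le (n := ∞) (by simp)
  have h1 : ContMDiffOn I 𝓘(ℝ, V) ∞ (fun p => (trivializationAt V (TangentSpace I) p₀
      (⟨p, Z p⟩ : TangentBundle I P)).2) (extChartAt I p₀).source := by
    rw [← (trivializationAt V (TangentSpace I) p₀).contMDiffOn_section_iff (IB := I)
      (isOpen_extChartAt_source p₀) (by simp)]
    exact hZ.contMDiffOn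
  refine h1.congr fun p hp => ?_
  have hp' : p ∈ (chartAt H p₀).source := by simpa using hp
  have := TangentBundle.continuousLinearMapAt_trivializationAt (I := I) (𝕜 := ℝ) hp'
  have h2 := DFunLike.congr_fun this (Z p)
  refine Eq.trans h2.symm ?_
  rw [Trivialization.continuousLinearMapAt_apply, Trivialization.coe_linearMapAt_of_mem]
  simpa using hp'

/-- The velocity field of a smooth local family of maps can be prescribed. -/
theorem exists_family_hasVelocity [IsManifold I ∞ P] [I.Boundaryless]
    {Z : ∀ p : P, TangentSpace I p}
    (hZ : ContMDiff I I.tangent ∞ (fun p => (⟨p, Z p⟩ : TangentBundle I P))) (p₀ : P) :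
    ∃ U : Set P, IsOpen U ∧ p₀ ∈ U ∧ ∃ R : ℝ → P → P,
      (∀ t, ∀ p ∈ U, ContMDiffAt (𝓘(ℝ, ℝ).prod I) I ∞ (fun r : ℝ × P => R r.1 r.2) (t, p)) ∧
      (∀ p ∈ U, R 0 p = p) ∧
      ∀ p ∈ U, mfderiv 𝓘(ℝ, ℝ) I (fun t => R t p) 0 (1 : ℝ) = Z p := by
  have : IsManifold I 1 P := IsManifold.of_le (n := ∞) (by simp)
  let z : P → V := fun p => mfderiv I 𝓘(ℝ, V) (extChartAt I p₀) p (Z p)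
  have hzs : ContMDiffOn I 𝓘(ℝ, V) ∞ z (extChartAt I p₀).source :=
    contMDiffOn_mfderiv_extChartAt hZ p₀
  obtain ⟨r, hr, hrt⟩ := Metric.isOpen_iff.1 (isOpen_extChartAt_target (I := I) p₀)
    (extChartAt I p₀ p₀) (mem_extChartAt_target p₀)
  set C : ℝ := ‖z p₀‖ + 1 with hC
  have hC0 : 0 < C := by positivity
  -- With `‖z p‖ < C` on `U`, a displacement of at most `ε • z p` has length at most `r / 2`. Points
  -- of `U` lie within `r / 2` of the centre, so the sum stays in the ball of radius `r` inside the
  -- chart.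
  set ε : ℝ := r / (2 * C) with hε
  have hε0 : 0 < ε := by positivity
  have hφc : ContinuousOn (extChartAt I p₀) (extChartAt I p₀).source := continuousOn_extChartAt p₀
  let U : Set P := (extChartAt I p₀).source ∩
    (fun p => (extChartAt I p₀ p, z p)) ⁻¹' (Metric.ball (extChartAt I p₀ p₀) (r / 2) ×ˢ {w | ‖w‖ < C})
  have hUo : IsOpen U := by
    refine (hφc.prodMk hzs.continuousOn).isOpen_inter_preimage (isOpen_extChartAt_source p₀) ?_
    exact Metric.isOpen_ball.prod (isOpen_lt continuous_norm continuous_const)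
  have hU0 : p₀ ∈ U := ⟨mem_extChartAt_source p₀, by simp [hr], by simp [hC]⟩
  -- A reparametrised time with `τ 0 = 0` and `τ' 0 = 1`, bounded by `ε`. The straight line in the
  -- chart then never leaves it, and the family is defined for all real `t` without using a flow:
  -- only the velocity at `t = 0` is prescribed.
  let τ : ℝ → ℝ := fun t => ε * Real.sin (t / ε)
  have hτ : ContDiff ℝ ∞ τ := contDiff_const.mul (Real.contDiff_sin.comp (contDiff_id.div_const ε))
  have hτ0 : τ 0 = 0 := by simp [τ]
  have hτd : HasDerivAt τ 1 0 := by
    have h1 : HasDerivAt (fun t : ℝ => t / ε) (1 / ε) 0 := (hasDerivAt_id 0).div_const ε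
    have h2 := ((Real.hasDerivAt_sin (0 / ε)).comp 0 h1).const_mul ε
    refine h2.congr_deriv ?_
    field_simp
    simp
  have htgt : ∀ t, ∀ p ∈ U, extChartAt I p₀ p + τ t • z p ∈ (extChartAt I p₀).target := by
    intro t p hp
    apply hrt
    have h1 : dist (extChartAt I p₀ p) (extChartAt I p₀ p₀) < r / 2 := hp.2.1
    have h2 : ‖z p‖ < C := hp.2.2
    have h3 : ‖τ t • z p‖ ≤ r / 2 := by
      rw [norm_smul]
      have h4 : ‖τ t‖ ≤ ε := by
        rw [norm_mul, Real.norm_of_nonneg hε0.le]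
        exact mul_le_of_le_one_right hε0.le (Real.abs_sin_le_one _)
      calc ‖τ t‖ * ‖z p‖ ≤ ε * C := mul_le_mul h4 h2.le (norm_nonneg _) hε0.le
        _ = r / 2 := by rw [hε]; field_simp
    rw [dist_eq_norm] at h1
    rw [Metric.mem_ball, dist_eq_norm]
    calc ‖extChartAt I p₀ p + τ t • z p - extChartAt I p₀ p₀‖
        = ‖(extChartAt I p₀ p - extChartAt I p₀ p₀) + τ t • z p‖ := by congr 1; abel
      _ ≤ ‖extChartAt I p₀ p - extChartAt I p₀ p₀‖ + ‖τ t • z p‖ := norm_add_le _ _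
      _ < r := by linarith
  refine ⟨U, hUo, hU0, fun t p => (extChartAt I p₀).symm (extChartAt I p₀ p + τ t • z p),
    ?_, ?_, ?_⟩
  · intro t p hp
    have h1 : ContMDiffAt 𝓘(ℝ, V) I ∞ (extChartAt I p₀).symm (extChartAt I p₀ p + τ t • z p) :=
      (contMDiffOn_extChartAt_symm (I := I) (n := ∞) p₀).contMDiffAt
        ((isOpen_extChartAt_target p₀).mem_nhds (htgt t p hp))
    have hpn : (extChartAt I p₀).source ∈ 𝓝 p := (isOpen_extChartAt_source p₀).mem_nhds hp.1
    have h2 : ContMDiffAt (𝓘(ℝ, ℝ).prod I) 𝓘(ℝ, V) ∞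
        (fun r : ℝ × P => extChartAt I p₀ r.2) (t, p) :=
      ((contMDiffAt_extChartAt' (I := I) (n := ∞) (x := p₀) (by simpa using hp.1))).comp (t, p)
        contMDiffAt_snd
    have h3 : ContMDiffAt (𝓘(ℝ, ℝ).prod I) 𝓘(ℝ, V) ∞ (fun r : ℝ × P => z r.2) (t, p) :=
      (hzs.contMDiffAt hpn).comp (t, p) contMDiffAt_snd
    have h4 : ContMDiffAt (𝓘(ℝ, ℝ).prod I) 𝓘(ℝ, ℝ) ∞ (fun r : ℝ × P => τ r.1) (t, p) :=
      hτ.contMDiff.contMDiffAt.comp (t, p) contMDiffAt_fst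
    exact h1.comp (t, p) (h2.add (h4.smul h3))
  · intro p hp
    simp only [hτ0, zero_smul, add_zero]
    exact (extChartAt I p₀).left_inv hp.1
  · intro p hp
    have hc : HasDerivAt (fun t => extChartAt I p₀ p + τ t • z p) (z p) 0 := by
      simpa using (hτd.smul_const (z p)).const_add (extChartAt I p₀ p)
    have hs : MDifferentiableAt 𝓘(ℝ, V) I (extChartAt I p₀).symm (extChartAt I p₀ p + τ 0 • z p) :=
      mdifferentiableAt_extChartAt_symm (htgt 0 p hp)
    have h1 := DFunLike.congr_fun (mfderiv_comp (0 : ℝ)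
      (f := fun t => extChartAt I p₀ p + τ t • z p) hs hc.differentiableAt.mdifferentiableAt)
      (1 : ℝ)
    have h2 : mfderiv 𝓘(ℝ, ℝ) 𝓘(ℝ, V) (fun t => extChartAt I p₀ p + τ t • z p) 0 (1 : ℝ) = z p := by
      rw [mfderiv_eq_fderiv]
      exact hc.deriv
    have h3 : extChartAt I p₀ p + τ 0 • z p = extChartAt I p₀ p := by simp [hτ0]
    have h4 := mfderivWithin_extChartAt_symm_comp_mfderiv_extChartAt' (I := I) hp.1
    rw [I.range_eq_univ, mfderivWithin_univ] at h4
    let D : V → V → V := fun y w => mfderiv 𝓘(ℝ, V) I (extChartAt I p₀).symm y w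
    have h5 : D (extChartAt I p₀ p + τ 0 • z p) (mfderiv 𝓘(ℝ, ℝ) 𝓘(ℝ, V)
        (fun t => extChartAt I p₀ p + τ t • z p) 0 (1 : ℝ)) = D (extChartAt I p₀ p) (z p) := by
      rw [h3]
      exact congrArg _ h2
    exact h1.trans (h5.trans (DFunLike.congr_fun h4 (Z p)))

end Calculus

/-! ### Smooth maps into vector bundles, and local frames -/

section Bundle

variable {EM : Type*} [NormedAddCommGroup EM] [NormedSpace ℝ EM] [FiniteDimensional ℝ EM]
  {M : Type*} [TopologicalSpace M] [ChartedSpace EM M] [IsManifold 𝓘(ℝ, EM) ∞ M]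
  [T2Space M] [SigmaCompactSpace M]
  {F : Type*} [NormedAddCommGroup F] [NormedSpace ℝ F]
  {E : M → Type*} [∀ x, AddCommGroup (E x)] [∀ x, Module ℝ (E x)]
  [∀ x, TopologicalSpace (E x)] [TopologicalSpace (TotalSpace F E)]
  [FiberBundle F E] [VectorBundle ℝ F E] [ContMDiffVectorBundle ∞ F E 𝓘(ℝ, EM)]
  {V H Q : Type*} [NormedAddCommGroup V] [NormedSpace ℝ V] [TopologicalSpace H]
  {I : ModelWithCorners ℝ V H} [TopologicalSpace Q] [ChartedSpace H Q]

/-- The trivialization at `b q` is linear on the fibres, so fibrewise operations become operations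
in `F`. The base map may be any smooth map, which is what sums along fields require. -/
theorem ContMDiffAt.totalSpace_add {b : Q → M} {s s' : ∀ q, E (b q)} {q : Q}
    (hs : ContMDiffAt I (𝓘(ℝ, EM).prod 𝓘(ℝ, F)) ∞ (fun q => (⟨b q, s q⟩ : TotalSpace F E)) q)
    (hs' : ContMDiffAt I (𝓘(ℝ, EM).prod 𝓘(ℝ, F)) ∞ (fun q => (⟨b q, s' q⟩ : TotalSpace F E)) q) :
    ContMDiffAt I (𝓘(ℝ, EM).prod 𝓘(ℝ, F)) ∞
      (fun q => (⟨b q, s q + s' q⟩ : TotalSpace F E)) q := by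
  rw [contMDiffAt_totalSpace] at *
  refine ⟨hs.1, (hs.2.add hs'.2).congr_of_eventuallyEq ?_⟩
  have hb : ∀ᶠ r in 𝓝 q, b r ∈ (trivializationAt F E (b q)).baseSet :=
    hs.1.continuousAt.eventually ((trivializationAt F E (b q)).open_baseSet.mem_nhds
      (mem_baseSet_trivializationAt F E _))
  filter_upwards [hb] with r hr
  exact ((trivializationAt F E (b q)).linear ℝ hr).map_add _ _

theorem ContMDiffAt.totalSpace_smul {b : Q → M} {c : Q → ℝ} {s : ∀ q, E (b q)} {q : Q}
    (hc : ContMDiffAt I 𝓘(ℝ, ℝ) ∞ c q)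
    (hs : ContMDiffAt I (𝓘(ℝ, EM).prod 𝓘(ℝ, F)) ∞ (fun q => (⟨b q, s q⟩ : TotalSpace F E)) q) :
    ContMDiffAt I (𝓘(ℝ, EM).prod 𝓘(ℝ, F)) ∞
      (fun q => (⟨b q, c q • s q⟩ : TotalSpace F E)) q := by
  rw [contMDiffAt_totalSpace] at *
  refine ⟨hs.1, (hc.smul hs.2).congr_of_eventuallyEq ?_⟩
  have hb : ∀ᶠ r in 𝓝 q, b r ∈ (trivializationAt F E (b q)).baseSet :=
    hs.1.continuousAt.eventually ((trivializationAt F E (b q)).open_baseSet.mem_nhds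
      (mem_baseSet_trivializationAt F E _))
  filter_upwards [hb] with r hr
  exact ((trivializationAt F E (b q)).linear ℝ hr).map_smul _ _

theorem ContMDiffAt.totalSpace_sum {ι : Type*} {t : Finset ι} {b : Q → M}
    {s : ι → ∀ q, E (b q)} {q : Q} (hb : ContMDiffAt I 𝓘(ℝ, EM) ∞ b q)
    (hs : ∀ i ∈ t, ContMDiffAt I (𝓘(ℝ, EM).prod 𝓘(ℝ, F)) ∞
      (fun q => (⟨b q, s i q⟩ : TotalSpace F E)) q) :
    ContMDiffAt I (𝓘(ℝ, EM).prod 𝓘(ℝ, F)) ∞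
      (fun q => (⟨b q, ∑ i ∈ t, s i q⟩ : TotalSpace F E)) q := by
  classical
  induction t using Finset.induction_on with
  | empty =>
    simp only [Finset.sum_empty]
    exact (contMDiff_zeroSection ℝ E).contMDiffAt.comp q hb
  | insert a t ha ih =>
    simp only [Finset.sum_insert ha]
    exact (hs a (Finset.mem_insert_self _ _)).totalSpace_add
      (ih fun i hi => hs i (Finset.mem_insert_of_mem hi))

/-- A linear combination of sections is smooth in the coefficients and the base point. -/
theorem contMDiff_linearCombination {ι : Type*} [Fintype ι]
    (s : ι → Cₛ^∞⟮𝓘(ℝ, EM); F, E⟯) :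
    ContMDiff (𝓘(ℝ, ι → ℝ).prod 𝓘(ℝ, EM)) (𝓘(ℝ, EM).prod 𝓘(ℝ, F)) ∞
      (fun r : (ι → ℝ) × M => (⟨r.2, ∑ i, r.1 i • s i r.2⟩ : TotalSpace F E)) := by
  intro r
  refine ContMDiffAt.totalSpace_sum (s := fun i (r : (ι → ℝ) × M) => r.1 i • s i r.2)
    contMDiffAt_snd fun i _ => ?_
  refine ContMDiffAt.totalSpace_smul (b := fun r : (ι → ℝ) × M => r.2) (c := fun r => r.1 i)
    (s := fun r => s i r.2) ?_ ?_
  · have h1 : ContDiff ℝ ∞ (fun c : ι → ℝ => c i) := contDiff_apply ℝ ℝ i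
    exact h1.contMDiff.contMDiffAt.comp r contMDiffAt_fst
  · exact (s i).contMDiff.contMDiffAt.comp r contMDiffAt_snd

/-- Near every point a smooth vector bundle has a frame consisting of global sections, with a
dual frame consisting of global one-forms. -/
theorem exists_frame [FiniteDimensional ℝ F] (x : M) :
    ∃ (s : Fin (Module.finrank ℝ F) → Cₛ^∞⟮𝓘(ℝ, EM); F, E⟯)
      (θ : Fin (Module.finrank ℝ F) → ∀ y, E y →ₗ[ℝ] ℝ),
      (∀ i, LieAlgebroid.IsOneForm (EM := EM) (F := F) (θ i)) ∧
      ∀ᶠ y in 𝓝 x, (∀ a : E y, ∑ i, θ i y a • s i y = a) ∧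
        ∀ i j, θ i y (s j y) = if i = j then 1 else 0 := by
  classical
  let t := trivializationAt F E x
  let b := Module.finBasis ℝ F
  have htx : t.baseSet ∈ 𝓝 x :=
    t.open_baseSet.mem_nhds (mem_baseSet_trivializationAt F E x)
  obtain ⟨χ, hχ, -⟩ := (SmoothBumpFunction.nhds_basis_support (I := 𝓘(ℝ, EM)) htx).mem_iff.1 htx
  -- The support of the cutoff lies in the domain of the trivialization, so every smoothness check
  -- splits into a local computation and a trivial case.
  have hcov : ∀ y, y ∈ t.baseSet ∨ ∀ᶠ z in 𝓝 y, χ z = 0 := by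
    intro y
    by_cases hy : y ∈ tsupport χ
    · exact Or.inl (hχ hy)
    · right
      filter_upwards [(isClosed_tsupport χ).isOpen_compl.mem_nhds hy] with z hz
      exact image_eq_zero_of_notMem_tsupport hz
  have hs : ∀ i, ContMDiff 𝓘(ℝ, EM) (𝓘(ℝ, EM).prod 𝓘(ℝ, F)) ∞
      (fun y => (⟨y, χ y • t.symmₗ ℝ y (b i)⟩ : TotalSpace F E)) := by
    intro i y
    rcases hcov y with hy | hy
    · refine ContMDiffAt.totalSpace_smul (b := fun y => y) χ.contMDiff.contMDiffAt ?_
      refine (t.contMDiffAt_section_iff (s := fun y => t.symmₗ ℝ y (b i)) hy).2 ?_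
      refine (contMDiffAt_const (c := b i)).congr_of_eventuallyEq ?_
      filter_upwards [t.open_baseSet.mem_nhds hy] with z hz
      have := t.linearMapAt_symmₗ (R := ℝ) hz (b i)
      rwa [t.coe_linearMapAt_of_mem hz] at this
    · refine (contMDiff_zeroSection ℝ E).contMDiffAt.congr_of_eventuallyEq ?_
      filter_upwards [hy] with z hz
      rw [hz, zero_smul]
      rfl
  -- Frame and coframe are both cut off. The duality relations hold only where `χ = 1`, which is a
  -- neighbourhood of `x`.
  refine ⟨fun i => ⟨fun y => χ y • t.symmₗ ℝ y (b i), hs i⟩,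
    fun i y => χ y • (b.coord i).comp (t.linearMapAt ℝ y), ?_, ?_⟩
  · intro i e
    change ContMDiffAt (𝓘(ℝ, EM).prod 𝓘(ℝ, F)) 𝓘(ℝ, ℝ) ∞
      (fun e : TotalSpace F E => χ e.1 * b.coord i (t.linearMapAt ℝ e.1 e.2)) e
    rcases hcov e.1 with hy | hy
    · have h1 : ContMDiffAt (𝓘(ℝ, EM).prod 𝓘(ℝ, F)) 𝓘(ℝ, F) ∞
          (fun e : TotalSpace F E => (t e).2) e :=
        ((t.contMDiffAt_iff (f := fun e : TotalSpace F E => e) (t.mem_source.2 hy)).1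
          contMDiffAt_id).2
      have h2 : ContDiff ℝ ∞ (b.coord i) :=
        (LinearMap.toContinuousLinearMap (b.coord i)).contDiff
      have h3 : ContMDiffAt (𝓘(ℝ, EM).prod 𝓘(ℝ, F)) 𝓘(ℝ, ℝ) ∞
          (fun e : TotalSpace F E => χ e.1 * b.coord i (t e).2) e :=
        (χ.contMDiff.contMDiffAt.comp e (contMDiff_proj E).contMDiffAt).mul
          (h2.contMDiff.contMDiffAt.comp e h1)
      refine h3.congr_of_eventuallyEq ?_
      have : ∀ᶠ e' in 𝓝 e, e'.1 ∈ t.baseSet :=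
        (FiberBundle.continuous_proj F E).continuousAt.eventually (t.open_baseSet.mem_nhds hy)
      filter_upwards [this] with e' he'
      rw [t.coe_linearMapAt_of_mem he']
    · refine (contMDiffAt_const (c := (0 : ℝ))).congr_of_eventuallyEq ?_
      filter_upwards [(FiberBundle.continuous_proj F E).continuousAt.eventually hy] with e' he'
      change χ e'.1 = 0 at he'
      rw [he', zero_mul]
  · filter_upwards [χ.eventuallyEq_one, htx] with y hy hty
    simp only [Pi.one_apply] at hy
    constructor
    · intro a
      change ∑ i, (χ y * b.coord i (t.linearMapAt ℝ y a)) • (χ y • t.symmₗ ℝ y (b i)) = a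
      simp only [hy, one_mul, one_smul, Module.Basis.coord_apply]
      simp only [← map_smul, ← map_sum, b.sum_repr]
      exact t.symmₗ_linearMapAt hty a
    · intro i j
      change χ y * b.coord i (t.linearMapAt ℝ y (χ y • t.symmₗ ℝ y (b j))) = _
      rw [hy, one_mul, one_smul, t.linearMapAt_symmₗ hty, Module.Basis.coord_apply,
        Module.Basis.repr_self, Finsupp.single_apply]
      simp only [eq_comm]

end Bundle

/-! ### The tangent lift of a section -/

theorem dirDeriv_continuousLinearMap {V : Type*} [NormedAddCommGroup V] [NormedSpace ℝ V]
    (l : V →L[ℝ] ℝ) (x X : V) : dirDeriv 𝓘(ℝ, V) l x X = l X := by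
  unfold dirDeriv
  rw [ContinuousLinearMap.mfderiv_eq]
  rfl

section Algebroid

variable {EM : Type*} [NormedAddCommGroup EM] [NormedSpace ℝ EM] [FiniteDimensional ℝ EM]
  {M : Type*} [TopologicalSpace M] [ChartedSpace EM M] [IsManifold 𝓘(ℝ, EM) ∞ M]
  [T2Space M] [SigmaCompactSpace M]
  {F : Type*} [NormedAddCommGroup F] [NormedSpace ℝ F] [FiniteDimensional ℝ F]
  {E : M → Type*} [∀ x, AddCommGroup (E x)] [∀ x, Module ℝ (E x)]
  [∀ x, TopologicalSpace (E x)] [TopologicalSpace (TotalSpace F E)]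
  [FiberBundle F E] [VectorBundle ℝ F E] [ContMDiffVectorBundle ∞ F E 𝓘(ℝ, EM)]
  {V H Q : Type*} [NormedAddCommGroup V] [NormedSpace ℝ V] [TopologicalSpace H]
  {I : ModelWithCorners ℝ V H} [TopologicalSpace Q] [ChartedSpace H Q]

namespace LieAlgebroid

theorem IsOneForm.comp {α : ∀ x, E x →ₗ[ℝ] ℝ} (hα : IsOneForm (EM := EM) (F := F) α)
    {f : Q → TotalSpace F E} (hf : ContMDiff I (𝓘(ℝ, EM).prod 𝓘(ℝ, F)) ∞ f) :
    ContMDiff I 𝓘(ℝ, ℝ) ∞ (fun q => α (f q).1 (f q).2) :=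
  ContMDiff.comp (g := fun e : TotalSpace F E => α e.1 e.2) hα hf

variable {A : LieAlgebroid EM M F E}

theorem contMDiff_sec (v : A.Sec) :
    ContMDiff 𝓘(ℝ, EM) (𝓘(ℝ, EM).prod 𝓘(ℝ, F)) ∞ (fun y => (⟨y, v y⟩ : TotalSpace F E)) :=
  ContMDiffSection.contMDiff (V := E) v

theorem Sec.ext {u v : A.Sec} (h : ∀ x, u x = v x) : u = v :=
  ContMDiffSection.ext (V := E) h

theorem Sec.add_apply (u v : A.Sec) (x : M) : (u + v) x = u x + v x := rfl

theorem Sec.smul_apply (c : ℝ) (u : A.Sec) (x : M) : (c • u) x = c • u x := rfl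

theorem Sec.sub_apply (u v : A.Sec) (x : M) : (u - v) x = u x - v x := rfl

theorem Sec.zero_apply (x : M) : (0 : A.Sec) x = 0 := rfl

theorem Sec.sum_apply {ι : Type*} (t : Finset ι) (u : ι → A.Sec) (x : M) :
    (∑ i ∈ t, u i) x = ∑ i ∈ t, u i x :=
  map_sum (⟨⟨fun u => u x, rfl⟩, fun _ _ => rfl⟩ : A.Sec →+ E x) u t

theorem exists_sec (A : LieAlgebroid EM M F E) (e : TotalSpace F E) :
    ∃ v : A.Sec, v e.1 = e.2 :=
  exists_section_through e

/-- The product of a smooth function and a section. -/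
def fsmul (f : C^∞⟮𝓘(ℝ, EM), M; ℝ⟯) (v : A.Sec) : A.Sec := functionSmul f v

theorem fsmul_apply (f : C^∞⟮𝓘(ℝ, EM), M; ℝ⟯) (v : A.Sec) (x : M) :
    fsmul f v x = f x • v x := rfl

theorem lie_fsmul (u v : A.Sec) (f : C^∞⟮𝓘(ℝ, EM), M; ℝ⟯) (x : M) :
    ⁅u, fsmul f v⁆ x =
      f x • ⁅u, v⁆ x + dirDeriv 𝓘(ℝ, EM) f x (A.anchor x (u x)) • v x :=
  A.leibniz u v f x

/-- The pairing of a one-form with a section. -/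
def pairing {α : ∀ x, E x →ₗ[ℝ] ℝ} (hα : IsOneForm (EM := EM) (F := F) α) (v : A.Sec) :
    C^∞⟮𝓘(ℝ, EM), M; ℝ⟯ :=
  ⟨fun y => α y (v y), hα.comp (contMDiff_sec v)⟩

theorem contMDiff_anchor_sec (u : A.Sec) : ContMDiff 𝓘(ℝ, EM) 𝓘(ℝ, EM).tangent ∞
    (fun y => (⟨y, A.anchor y (u y)⟩ : TangentBundle 𝓘(ℝ, EM) M)) :=
  A.contMDiff_anchor.comp (contMDiff_sec u)

/-- The derivative of a function along the anchor of a section. -/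
def anchorDeriv (u : A.Sec) (f : C^∞⟮𝓘(ℝ, EM), M; ℝ⟯) : C^∞⟮𝓘(ℝ, EM), M; ℝ⟯ :=
  ⟨fun y => dirDeriv 𝓘(ℝ, EM) f y (A.anchor y (u y)), f.contMDiff.dirDeriv (contMDiff_anchor_sec u)⟩

theorem anchorDeriv_apply (u : A.Sec) (f : C^∞⟮𝓘(ℝ, EM), M; ℝ⟯) (x : M) :
    anchorDeriv u f x = dirDeriv 𝓘(ℝ, EM) f x (A.anchor x (u x)) := rfl

/-- The anchor intertwines the brackets, and the bracket of vector fields acts on functions as a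
commutator. -/
theorem anchorDeriv_lie (u v : A.Sec) (f : C^∞⟮𝓘(ℝ, EM), M; ℝ⟯) (x : M) :
    anchorDeriv ⁅u, v⁆ f x = anchorDeriv u (anchorDeriv v f) x - anchorDeriv v (anchorDeriv u f) x := by
  rw [anchorDeriv_apply]
  have h : A.anchor x (⁅u, v⁆ x) =
      VectorField.mlieBracket 𝓘(ℝ, EM) (fun y => A.anchor y (u y)) (fun y => A.anchor y (v y)) x :=
    A.anchor_bracket u v x
  have : CompleteSpace EM := FiniteDimensional.complete ℝ EM
  rw [h, dirDeriv_mlieBracket f.contMDiff ((contMDiff_anchor_sec u).mdiffAt x)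
    ((contMDiff_anchor_sec v).mdiffAt x) ((anchorDeriv u f).contMDiff.mdiffAt x)
    ((anchorDeriv v f).contMDiff.mdiffAt x)]
  rfl

/-- Locality of the bracket: `χ (v - w)` is zero for a bump function `χ` supported where `v = w`.
The Leibniz rule for it at `x`, where `χ = 1` and `v - w` vanishes, leaves only `⁅u, v - w⁆ x`. -/
theorem lie_congr {u v w : A.Sec} {x : M} (h : ∀ᶠ y in 𝓝 x, v y = w y) :
    ⁅u, v⁆ x = ⁅u, w⁆ x := by
  obtain ⟨χ, hχ, -⟩ := (SmoothBumpFunction.nhds_basis_support (I := 𝓘(ℝ, EM)) h).mem_iff.1 h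
  let χ' : C^∞⟮𝓘(ℝ, EM), M; ℝ⟯ := ⟨χ, χ.contMDiff⟩
  have h0 : fsmul χ' (v - w) = 0 := by
    refine Sec.ext fun y => ?_
    rw [fsmul_apply, Sec.sub_apply, Sec.zero_apply]
    by_cases hy : y ∈ tsupport χ
    · have : v y = w y := hχ hy
      rw [this, sub_self, smul_zero]
    · have : χ' y = 0 := image_eq_zero_of_notMem_tsupport hy
      rw [this, zero_smul]
  have h1 := lie_fsmul u (v - w) χ' x
  have h2 : χ' x = 1 := χ.eq_one
  have h3 : (v - w) x = 0 := by rw [Sec.sub_apply, h.self_of_nhds, sub_self]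
  rw [h0, lie_zero, h2, h3, smul_zero, one_smul, add_zero, lie_sub, Sec.sub_apply,
    Sec.zero_apply] at h1
  exact (sub_eq_zero.1 h1.symm)

/-- The Leibniz rule for a section expanded in a local frame. -/
theorem lie_eq_sum {n : ℕ} {s : Fin n → A.Sec} {θ : Fin n → ∀ y, E y →ₗ[ℝ] ℝ}
    (hθ : ∀ i, IsOneForm (EM := EM) (F := F) (θ i)) {x : M} (u w : A.Sec)
    (h : ∀ᶠ y in 𝓝 x, ∀ a : E y, ∑ i, θ i y a • s i y = a) :
    ⁅u, w⁆ x = ∑ i, (θ i x (w x) • ⁅u, s i⁆ x +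
      dirDeriv 𝓘(ℝ, EM) (fun y => θ i y (w y)) x (A.anchor x (u x)) • s i x) := by
  have h1 : ⁅u, w⁆ x = ⁅u, ∑ i, fsmul (pairing (hθ i) w) (s i)⁆ x := by
    refine lie_congr ?_
    filter_upwards [h] with y hy
    rw [Sec.sum_apply]
    exact (hy (w y)).symm
  rw [h1, lie_sum, Sec.sum_apply]
  exact Finset.sum_congr rfl fun i _ => lie_fsmul u (s i) (pairing (hθ i) w) x

theorem exists_frame_sec (A : LieAlgebroid EM M F E) (x : M) :
    ∃ (s : Fin (Module.finrank ℝ F) → A.Sec)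
      (θ : Fin (Module.finrank ℝ F) → ∀ y, E y →ₗ[ℝ] ℝ),
      (∀ i, IsOneForm (EM := EM) (F := F) (θ i)) ∧
      ∀ᶠ y in 𝓝 x, ∀ a : E y, ∑ i, θ i y a • s i y = a := by
  obtain ⟨s, θ, hθ, h⟩ := exists_frame (EM := EM) (F := F) (E := E) x
  exact ⟨s, θ, hθ, h.mono fun y hy => hy.1⟩

/-- When the coefficients of `w` in a frame vanish at `x`, only their derivatives survive, both in
the bracket and in `ρ(u)(α(w))`. This is what makes the tangent lift and the differential `d_E`
independent of the sections chosen. -/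
theorem oneForm_lie_of_eq_zero {α : ∀ x, E x →ₗ[ℝ] ℝ} (hα : IsOneForm (EM := EM) (F := F) α)
    (u : A.Sec) {w : A.Sec} {x : M} (hw : w x = 0) :
    α x (⁅u, w⁆ x) = dirDeriv 𝓘(ℝ, EM) (fun y => α y (w y)) x (A.anchor x (u x)) := by
  obtain ⟨s, θ, hθ, h'⟩ := A.exists_frame_sec x
  rw [lie_eq_sum hθ u w h']
  have h1 : (fun y => α y (w y)) =ᶠ[𝓝 x] fun y => ∑ i, θ i y (w y) * α y (s i y) := by
    filter_upwards [h'] with y hy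
    conv_lhs => rw [← hy (w y)]
    simp
  rw [dirDeriv_congr h1, dirDeriv_sum (f := fun i y => θ i y (w y) * α y (s i y))
    fun i _ => ((pairing (hθ i) w).contMDiff.mdiffAt x).mul
      ((pairing hα (s i)).contMDiff.mdiffAt x)]
  rw [map_sum]
  refine Finset.sum_congr rfl fun i _ => ?_
  rw [dirDeriv_mul (f := fun y => θ i y (w y)) (f' := fun y => α y (s i y))
    ((pairing (hθ i) w).contMDiff.mdiffAt x) ((pairing hα (s i)).contMDiff.mdiffAt x)]
  simp [hw, mul_comm]

/-- A tangent vector of the total space is determined by the derivatives of basic functions and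
of one-forms. -/
theorem eq_zero_of_dirDeriv_eq_zero {e : TotalSpace F E}
    {ξ : TangentSpace (𝓘(ℝ, EM).prod 𝓘(ℝ, F)) e}
    (h₀ : ∀ f : C^∞⟮𝓘(ℝ, EM), M; ℝ⟯,
      dirDeriv (𝓘(ℝ, EM).prod 𝓘(ℝ, F)) (fun e' : TotalSpace F E => f e'.1) e ξ = 0)
    (h₁ : ∀ α : ∀ x, E x →ₗ[ℝ] ℝ, IsOneForm (EM := EM) (F := F) α →
      dirDeriv (𝓘(ℝ, EM).prod 𝓘(ℝ, F)) (fun e' : TotalSpace F E => α e'.1 e'.2) e ξ = 0) :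
    ξ = 0 := by
  obtain ⟨s, θ, hθ, h⟩ := exists_frame (EM := EM) (F := F) (E := E) e.1
  let L₁ : TotalSpace F E → (Fin (Module.finrank ℝ F) → ℝ) := fun e' i => θ i e'.1 e'.2
  have hL₁ : ContMDiff (𝓘(ℝ, EM).prod 𝓘(ℝ, F)) 𝓘(ℝ, Fin (Module.finrank ℝ F) → ℝ) ∞ L₁ :=
    contMDiff_pi_space.2 hθ
  have hπ : ContMDiff (𝓘(ℝ, EM).prod 𝓘(ℝ, F)) 𝓘(ℝ, EM) ∞ (π F E) := contMDiff_proj E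
  have e₁ : mfderiv (𝓘(ℝ, EM).prod 𝓘(ℝ, F)) 𝓘(ℝ, Fin (Module.finrank ℝ F) → ℝ) L₁ e ξ = 0 := by
    funext i
    let p : (Fin (Module.finrank ℝ F) → ℝ) →L[ℝ] ℝ :=
      ContinuousLinearMap.proj (R := ℝ) (φ := fun _ => ℝ) i
    have hp : MDifferentiableAt 𝓘(ℝ, Fin (Module.finrank ℝ F) → ℝ) 𝓘(ℝ, ℝ)
        p (L₁ e) :=
      ContinuousLinearMap.mdifferentiableAt _
    have h2 := dirDeriv_comp hp (hL₁.mdiffAt e) ξ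
    exact (dirDeriv_continuousLinearMap p (L₁ e) _).symm.trans (h2.symm.trans (h₁ (θ i) (hθ i)))
  have e₂ : mfderiv (𝓘(ℝ, EM).prod 𝓘(ℝ, F)) 𝓘(ℝ, EM) (π F E) e ξ = 0 := by
    refine eq_zero_of_forall_dirDeriv_eq_zero (I := 𝓘(ℝ, EM)) fun f => ?_
    exact (dirDeriv_comp (f.contMDiff.mdiffAt _) (hπ.mdiffAt e) ξ).symm.trans (h₀ f)
  have hK := contMDiff_linearCombination s
  -- Near `e` the identity of the total space factors through the fibre coordinates and the
  -- projection. A tangent vector killed by the differentials of both is therefore zero.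
  have hid : (fun e' : TotalSpace F E =>
      (⟨e'.1, ∑ i, L₁ e' i • s i e'.1⟩ : TotalSpace F E)) =ᶠ[𝓝 e] id := by
    filter_upwards [(FiberBundle.continuous_proj F E).continuousAt.eventually h] with e' he'
    have := he'.1 e'.2
    exact congrArg (TotalSpace.mk e'.1) this
  have h3 := mfderiv_comp e (hK.mdiffAt (L₁ e, e.1)) ((hL₁.mdiffAt e).prodMk (hπ.mdiffAt e))
  have h4 := hid.mfderiv_eq (I := 𝓘(ℝ, EM).prod 𝓘(ℝ, F)) (I' := 𝓘(ℝ, EM).prod 𝓘(ℝ, F))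
  have h5 : mfderiv (𝓘(ℝ, EM).prod 𝓘(ℝ, F)) (𝓘(ℝ, EM).prod 𝓘(ℝ, F)) (fun e' : TotalSpace F E =>
      (⟨e'.1, ∑ i, L₁ e' i • s i e'.1⟩ : TotalSpace F E)) e ξ = ξ := by
    refine (DFunLike.congr_fun h4 ξ).trans ?_
    rw [mfderiv_id]
    rfl
  rw [← h5]
  refine (DFunLike.congr_fun h3 ξ).trans ?_
  have h6 : mfderiv (𝓘(ℝ, EM).prod 𝓘(ℝ, F))
      (𝓘(ℝ, Fin (Module.finrank ℝ F) → ℝ).prod 𝓘(ℝ, EM)) (fun e' => (L₁ e', π F E e')) e ξ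
      = 0 := by
    rw [mfderiv_prodMk (hL₁.mdiffAt e) (hπ.mdiffAt e)]
    exact Prod.ext e₁ e₂
  let D := mfderiv (𝓘(ℝ, Fin (Module.finrank ℝ F) → ℝ).prod 𝓘(ℝ, EM)) (𝓘(ℝ, EM).prod 𝓘(ℝ, F))
    (fun r : (Fin (Module.finrank ℝ F) → ℝ) × M =>
      (⟨r.2, ∑ i, r.1 i • s i r.2⟩ : TotalSpace F E)) (L₁ e, e.1)
  exact (congrArg D h6).trans D.map_zero

theorem contMDiff_add_smul {x : M} (a w : E x) : ContMDiff 𝓘(ℝ, ℝ) (𝓘(ℝ, EM).prod 𝓘(ℝ, F)) ∞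
    (fun s : ℝ => (⟨x, a + s • w⟩ : TotalSpace F E)) := by
  intro s
  refine ContMDiffAt.totalSpace_add (b := fun _ => x) (s := fun _ => a) (s' := fun s => s • w)
    contMDiffAt_const ?_
  exact ContMDiffAt.totalSpace_smul (b := fun _ => x) contMDiffAt_id
    (s := fun _ => w) contMDiffAt_const

theorem dirDeriv_verticalLift {q : TotalSpace F E → ℝ} {e : TotalSpace F E}
    (hq : MDifferentiableAt (𝓘(ℝ, EM).prod 𝓘(ℝ, F)) 𝓘(ℝ, ℝ) q e) (w : E e.1) :
    dirDeriv (𝓘(ℝ, EM).prod 𝓘(ℝ, F)) q e (verticalLift e w) =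
      deriv (fun s : ℝ => q ⟨e.1, e.2 + s • w⟩) 0 := by
  have h0 : (⟨e.1, e.2 + (0 : ℝ) • w⟩ : TotalSpace F E) = e := by simp
  have h1 := (hasDerivAt_comp_curve (q := q) (c := fun s : ℝ => (⟨e.1, e.2 + s • w⟩ : TotalSpace F E))
    (t := 0) (by rwa [h0]) ((contMDiff_add_smul (EM := EM) e.2 w).mdiffAt 0)).deriv
  rw [h1]
  -- The points `e + 0 • w` and `e` are only propositionally equal. All tangent spaces are the model
  -- space `EM × F`, so the vector is kept fixed while the base point is rewritten.
  let D : TotalSpace F E → EM × F → ℝ := fun e ξ => dirDeriv (𝓘(ℝ, EM).prod 𝓘(ℝ, F)) q e ξ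
  exact congrArg (fun e => D e (mfderiv 𝓘(ℝ, ℝ) (𝓘(ℝ, EM).prod 𝓘(ℝ, F))
    (fun s : ℝ => (⟨_, _ + s • w⟩ : TotalSpace F E)) 0 (1 : ℝ))) h0.symm

theorem dirDeriv_lift_of_section {q : TotalSpace F E → ℝ} {x : M} (u v : A.Sec)
    (hq : MDifferentiableAt (𝓘(ℝ, EM).prod 𝓘(ℝ, F)) 𝓘(ℝ, ℝ) q ⟨x, v x⟩) :
    dirDeriv (𝓘(ℝ, EM).prod 𝓘(ℝ, F)) q ⟨x, v x⟩
      (mfderiv 𝓘(ℝ, EM) (𝓘(ℝ, EM).prod 𝓘(ℝ, F)) (fun y => (⟨y, v y⟩ : TotalSpace F E)) x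
        (A.anchor x (u x)) - verticalLift (⟨x, v x⟩ : TotalSpace F E) (⁅u, v⁆ x)) =
    dirDeriv 𝓘(ℝ, EM) (fun y => q ⟨y, v y⟩) x (A.anchor x (u x))
      - deriv (fun s : ℝ => q ⟨x, v x + s • ⁅u, v⁆ x⟩) 0 := by
  rw [dirDeriv_vec_sub, dirDeriv_verticalLift hq,
    dirDeriv_comp (F := fun y => (⟨y, v y⟩ : TotalSpace F E)) hq ((contMDiff_sec v).mdiffAt x)]

/-- The witness is the section chosen in the definition of `tangentLift`. Later arguments use only
that it passes through `e`, so the choice is never inspected again. -/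
theorem lieDeriv_eq_sectionThrough {q : TotalSpace F E → ℝ} {e : TotalSpace F E} (u : A.Sec)
    (hq : MDifferentiableAt (𝓘(ℝ, EM).prod 𝓘(ℝ, F)) 𝓘(ℝ, ℝ) q e) :
    ∃ v : A.Sec, v e.1 = e.2 ∧ A.lieDeriv u q e =
      dirDeriv 𝓘(ℝ, EM) (fun y => q ⟨y, v y⟩) e.1 (A.anchor e.1 (u e.1))
        - deriv (fun s : ℝ => q ⟨e.1, e.2 + s • ⁅u, v⁆ e.1⟩) 0 := by
  obtain ⟨v, hv, hve⟩ : ∃ v : A.Sec, v = (sectionThrough e : A.Sec) ∧ v e.1 = e.2 :=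
    ⟨_, rfl, (exists_section_through e).choose_spec⟩
  refine ⟨v, hve, ?_⟩
  have he : (⟨e.1, v e.1⟩ : TotalSpace F E) = e := by rw [hve]
  have h := dirDeriv_lift_of_section (x := e.1) (q := q) u v (by rwa [he])
  rw [hve] at h
  subst hv
  exact h

theorem lieDeriv_basic (u : A.Sec) (f : C^∞⟮𝓘(ℝ, EM), M; ℝ⟯) (e : TotalSpace F E) :
    A.lieDeriv u (fun e' : TotalSpace F E => f e'.1) e = anchorDeriv u f e.1 := by
  obtain ⟨v, -, h⟩ := lieDeriv_eq_sectionThrough u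
    ((f.contMDiff.comp (contMDiff_proj E)).mdiffAt (I := 𝓘(ℝ, EM).prod 𝓘(ℝ, F)) e)
  refine h.trans ?_
  simp only [Function.comp_def, deriv_const', sub_zero]
  rfl

theorem deriv_oneForm_add_smul (α : ∀ x, E x →ₗ[ℝ] ℝ) {x : M} (a w : E x) :
    deriv (fun s : ℝ => α x (a + s • w)) 0 = α x w := by
  simp

/-- The expression is additive in the section, and for the difference `v - v'`, which vanishes at
`x`, its two terms are equal. -/
theorem dirDeriv_sub_oneForm_lie_congr {α : ∀ x, E x →ₗ[ℝ] ℝ}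
    (hα : IsOneForm (EM := EM) (F := F) α) (u : A.Sec) {v v' : A.Sec} {x : M} (h : v x = v' x) :
    dirDeriv 𝓘(ℝ, EM) (fun y => α y (v y)) x (A.anchor x (u x)) - α x (⁅u, v⁆ x) =
      dirDeriv 𝓘(ℝ, EM) (fun y => α y (v' y)) x (A.anchor x (u x)) - α x (⁅u, v'⁆ x) := by
  have h1 := oneForm_lie_of_eq_zero hα u (w := v - v') (x := x)
    (by rw [Sec.sub_apply, h, sub_self])
  have h2 : (fun y => α y ((v - v') y)) = fun y => α y (v y) - α y (v' y) := by
    ext y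
    rw [Sec.sub_apply, map_sub]
  rw [h2, dirDeriv_sub (f := fun y => α y (v y)) (f' := fun y => α y (v' y)) ((pairing hα v).contMDiff.mdiffAt x) ((pairing hα v').contMDiff.mdiffAt x),
    lie_sub, Sec.sub_apply, map_sub] at h1
  linarith

theorem lieDeriv_oneForm {α : ∀ x, E x →ₗ[ℝ] ℝ} (hα : IsOneForm (EM := EM) (F := F) α)
    (u v : A.Sec) (x : M) :
    A.lieDeriv u (fun e : TotalSpace F E => α e.1 e.2) ⟨x, v x⟩ =
      anchorDeriv u (pairing hα v) x - α x (⁅u, v⁆ x) := by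
  obtain ⟨v', hv', h⟩ := lieDeriv_eq_sectionThrough (e := ⟨x, v x⟩) u
    (ContMDiff.mdiffAt (f := fun e : TotalSpace F E => α e.1 e.2) hα _)
  rw [h]
  have := deriv_oneForm_add_smul α (v x) (⁅u, v'⁆ x)
  simp only at this ⊢
  rw [this]
  exact dirDeriv_sub_oneForm_lie_congr hα u hv'

/-- The defining formula of the tangent lift holds for every section. -/
theorem tangentLift_eq (u v : A.Sec) (x : M) : A.tangentLift u ⟨x, v x⟩ =
    mfderiv 𝓘(ℝ, EM) (𝓘(ℝ, EM).prod 𝓘(ℝ, F)) (fun y => (⟨y, v y⟩ : TotalSpace F E)) x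
      (A.anchor x (u x)) - verticalLift (⟨x, v x⟩ : TotalSpace F E) (⁅u, v⁆ x) := by
  rw [← sub_eq_zero]
  -- On basic functions the vertical part contributes nothing; on one-forms the two sides differ
  -- only in the extension of `v x` to a section.
  refine eq_zero_of_dirDeriv_eq_zero (fun f => ?_) fun α hα => ?_
  · have h1 := lieDeriv_basic u f ⟨x, v x⟩
    have h2 := dirDeriv_lift_of_section u v
      ((f.contMDiff.comp (contMDiff_proj E)).mdiffAt (I := 𝓘(ℝ, EM).prod 𝓘(ℝ, F)) ⟨x, v x⟩)
    rw [dirDeriv_vec_sub]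
    refine sub_eq_zero.2 (h1.trans (Eq.trans ?_ h2.symm))
    simp only [Function.comp_def, deriv_const', sub_zero]
    rfl
  · have h1 := lieDeriv_oneForm hα u v x
    have h2 := dirDeriv_lift_of_section u v
      (ContMDiff.mdiffAt (f := fun e : TotalSpace F E => α e.1 e.2) hα ⟨x, v x⟩)
    rw [dirDeriv_vec_sub]
    refine sub_eq_zero.2 (h1.trans (Eq.trans ?_ h2.symm))
    rw [deriv_oneForm_add_smul]
    rfl

end LieAlgebroid

end Algebroid

/-! ### The Lie derivative as a homomorphism into derivations -/

section Algebroid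

variable {EM : Type*} [NormedAddCommGroup EM] [NormedSpace ℝ EM] [FiniteDimensional ℝ EM]
  {M : Type*} [TopologicalSpace M] [ChartedSpace EM M] [IsManifold 𝓘(ℝ, EM) ∞ M]
  [T2Space M] [SigmaCompactSpace M]
  {F : Type*} [NormedAddCommGroup F] [NormedSpace ℝ F] [FiniteDimensional ℝ F]
  {E : M → Type*} [∀ x, AddCommGroup (E x)] [∀ x, Module ℝ (E x)]
  [∀ x, TopologicalSpace (E x)] [TopologicalSpace (TotalSpace F E)]
  [FiberBundle F E] [VectorBundle ℝ F E] [ContMDiffVectorBundle ∞ F E 𝓘(ℝ, EM)]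
  {A : LieAlgebroid EM M F E}

namespace LieAlgebroid

/-- Linearity on the fibre comes from linearity in the section `v` of `ρ(u)(α(v)) - α([u, v])`, once
the points are written as values of sections. -/
theorem lieDeriv_oneForm_add {α : ∀ x, E x →ₗ[ℝ] ℝ} (hα : IsOneForm (EM := EM) (F := F) α)
    (u : A.Sec) (x : M) (a b : E x) :
    A.lieDeriv u (fun e : TotalSpace F E => α e.1 e.2) ⟨x, a + b⟩ =
      A.lieDeriv u (fun e : TotalSpace F E => α e.1 e.2) ⟨x, a⟩ +
      A.lieDeriv u (fun e : TotalSpace F E => α e.1 e.2) ⟨x, b⟩ := by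
  obtain ⟨v, hv⟩ := A.exists_sec ⟨x, a⟩
  obtain ⟨w, hw⟩ := A.exists_sec ⟨x, b⟩
  simp only at hv hw
  subst hv hw
  rw [← Sec.add_apply, lieDeriv_oneForm hα, lieDeriv_oneForm hα, lieDeriv_oneForm hα, lie_add,
    Sec.add_apply, map_add, anchorDeriv_apply, anchorDeriv_apply, anchorDeriv_apply]
  have h : ⇑(pairing hα (v + w)) = fun y => pairing hα v y + pairing hα w y := by
    ext y
    exact map_add (α y) _ _
  rw [h, dirDeriv_add ((pairing hα v).contMDiff.mdiffAt x) ((pairing hα w).contMDiff.mdiffAt x)]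
  ring

theorem lieDeriv_oneForm_smul {α : ∀ x, E x →ₗ[ℝ] ℝ} (hα : IsOneForm (EM := EM) (F := F) α)
    (u : A.Sec) (x : M) (c : ℝ) (a : E x) :
    A.lieDeriv u (fun e : TotalSpace F E => α e.1 e.2) ⟨x, c • a⟩ =
      c * A.lieDeriv u (fun e : TotalSpace F E => α e.1 e.2) ⟨x, a⟩ := by
  obtain ⟨v, hv⟩ := A.exists_sec ⟨x, a⟩
  simp only at hv
  subst hv
  rw [← Sec.smul_apply, lieDeriv_oneForm hα, lieDeriv_oneForm hα, lie_smul,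
    Sec.smul_apply, map_smul, anchorDeriv_apply, anchorDeriv_apply]
  have h : ⇑(pairing hα (c • v)) = fun y => c * pairing hα v y := by
    ext y
    exact map_smul (α y) _ _
  rw [h, dirDeriv_const_mul ((pairing hα v).contMDiff.mdiffAt x), smul_eq_mul]
  ring

/-- The Lie derivative of a one-form. -/
def lieOneForm (u : A.Sec) {α : ∀ x, E x →ₗ[ℝ] ℝ} (hα : IsOneForm (EM := EM) (F := F) α) (x : M) :
    E x →ₗ[ℝ] ℝ where
  toFun a := A.lieDeriv u (fun e : TotalSpace F E => α e.1 e.2) ⟨x, a⟩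
  map_add' := lieDeriv_oneForm_add hα u x
  map_smul' c a := lieDeriv_oneForm_smul hα u x c a

theorem lieOneForm_sec (u v : A.Sec) {α : ∀ x, E x →ₗ[ℝ] ℝ}
    (hα : IsOneForm (EM := EM) (F := F) α) (x : M) :
    lieOneForm u hα x (v x) = anchorDeriv u (pairing hα v) x - α x (⁅u, v⁆ x) :=
  lieDeriv_oneForm hα u v x

/-- The tangent lift of `u` in terms of a local frame. -/
theorem tangentLift_eq_mfderiv {n : ℕ} {s : Fin n → A.Sec} {θ : Fin n → ∀ y, E y →ₗ[ℝ] ℝ}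
    {e : TotalSpace F E} (u : A.Sec) (h : ∀ a : E e.1, ∑ i, θ i e.1 a • s i e.1 = a) :
    A.tangentLift u e = mfderiv (𝓘(ℝ, Fin n → ℝ).prod 𝓘(ℝ, EM)) (𝓘(ℝ, EM).prod 𝓘(ℝ, F))
      (fun r : (Fin n → ℝ) × M => (⟨r.2, ∑ i, r.1 i • s i r.2⟩ : TotalSpace F E))
      ((fun i => θ i e.1 e.2), e.1)
      ((fun j => -∑ i, θ i e.1 e.2 * θ j e.1 (⁅u, s i⁆ e.1)), A.anchor e.1 (u e.1)) := by
  obtain ⟨x, a⟩ := e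
  simp only at h ⊢
  set c : Fin n → ℝ := fun i => θ i x a with hc
  -- The section through `e` with constant coefficients: its coordinates do not move along `ρ(u)`,
  -- and its bracket with `u` involves only the `⁅u, s i⁆`. The horizontal and the vertical part of
  -- the lift thus become the two components of one differential.
  set v : A.Sec := ∑ i, c i • s i with hv
  have hvy : ∀ y, v y = ∑ i, c i • s i y := fun y => by
    rw [hv, Sec.sum_apply]
    rfl
  have hvx : v x = a := by rw [hvy]; exact h a
  set w : E x := ⁅u, v⁆ x with hw
  have hwx : w = ∑ i, c i • ⁅u, s i⁆ x := by
    rw [hw, hv, lie_sum, Sec.sum_apply]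
    simp only [lie_smul]
    rfl
  have hK := (contMDiff_linearCombination (EM := EM) (F := F) (E := E) s).mdiffAt (c, x)
  set K : (Fin n → ℝ) × M → TotalSpace F E := fun r => ⟨r.2, ∑ i, r.1 i • s i r.2⟩ with hKdef
  have hneg : (fun j => -∑ i, c i * θ j x (⁅u, s i⁆ x)) = fun j => - θ j x w := by
    funext j
    rw [hwx, map_sum]
    simp
  rw [hneg]
  have h1 : mfderiv 𝓘(ℝ, EM) (𝓘(ℝ, EM).prod 𝓘(ℝ, F)) (fun y => (⟨y, v y⟩ : TotalSpace F E)) x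
      (A.anchor x (u x)) = mfderiv (𝓘(ℝ, Fin n → ℝ).prod 𝓘(ℝ, EM)) (𝓘(ℝ, EM).prod 𝓘(ℝ, F))
        K (c, x) (0, A.anchor x (u x)) := by
    have e1 : (fun y => (⟨y, v y⟩ : TotalSpace F E)) = K ∘ fun y => (c, y) := by
      funext y
      simp only [hvy, hKdef, Function.comp_apply]
    have h2 := mfderiv_comp x (f := fun y => (c, y)) (I' := 𝓘(ℝ, Fin n → ℝ).prod 𝓘(ℝ, EM)) hK
      (mdifferentiableAt_const.prodMk mdifferentiableAt_id)
    rw [mfderiv_prod_right] at h2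
    rw [e1]
    exact DFunLike.congr_fun h2 (A.anchor x (u x))
  have h3 : verticalLift (⟨x, a⟩ : TotalSpace F E) w =
      mfderiv (𝓘(ℝ, Fin n → ℝ).prod 𝓘(ℝ, EM)) (𝓘(ℝ, EM).prod 𝓘(ℝ, F))
        K (c, x) ((fun j => θ j x w), 0) := by
    have e1 : (fun t : ℝ => (⟨x, a + t • w⟩ : TotalSpace F E)) =
        K ∘ fun t : ℝ => (c + t • (fun j => θ j x w), x) := by
      funext t
      refine congrArg (TotalSpace.mk x) ?_
      have := h (a + t • w)
      rw [← this]
      simp [hc]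
    have d1 : HasDerivAt (fun t : ℝ => c + t • (fun j => θ j x w)) (fun j => θ j x w) 0 := by
      simpa using ((hasDerivAt_id (0 : ℝ)).smul_const (fun j => θ j x w)).const_add c
    have hc0 : (c + (0 : ℝ) • (fun j => θ j x w), x) = (c, x) := by simp
    have h2 := mfderiv_comp (0 : ℝ) (f := fun t : ℝ => (c + t • (fun j => θ j x w), x))
      (I' := 𝓘(ℝ, Fin n → ℝ).prod 𝓘(ℝ, EM)) (g := K) (by rw [hc0]; exact hK)
      (d1.differentiableAt.mdifferentiableAt.prodMk mdifferentiableAt_const)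
    rw [mfderiv_prodMk d1.differentiableAt.mdifferentiableAt mdifferentiableAt_const] at h2
    unfold verticalLift
    simp only
    rw [e1]
    refine (DFunLike.congr_fun h2 (1 : ℝ)).trans ?_
    let D : (Fin n → ℝ) × M → (Fin n → ℝ) × EM → EM × F := fun r ξ =>
      mfderiv (𝓘(ℝ, Fin n → ℝ).prod 𝓘(ℝ, EM)) (𝓘(ℝ, EM).prod 𝓘(ℝ, F)) K r ξ
    have h4 : mfderiv 𝓘(ℝ, ℝ) 𝓘(ℝ, Fin n → ℝ) (fun t : ℝ => c + t • (fun j => θ j x w)) 0 (1 : ℝ)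
        = fun j => θ j x w := by
      rw [mfderiv_eq_fderiv]
      exact d1.deriv
    have h5 : mfderiv 𝓘(ℝ, ℝ) 𝓘(ℝ, EM) (fun _ : ℝ => x) 0 (1 : ℝ) = 0 := by
      rw [mfderiv_const]
      rfl
    have h6 : D (c + (0 : ℝ) • (fun j => θ j x w), x)
        (mfderiv 𝓘(ℝ, ℝ) 𝓘(ℝ, Fin n → ℝ) (fun t : ℝ => c + t • (fun j => θ j x w)) 0 (1 : ℝ),
          mfderiv 𝓘(ℝ, ℝ) 𝓘(ℝ, EM) (fun _ : ℝ => x) 0 (1 : ℝ)) =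
        D (c, x) ((fun j => θ j x w), 0) := by
      rw [hc0]
      exact congrArg _ (Prod.ext h4 h5)
    exact h6
  have h7 := tangentLift_eq u v x
  rw [hvx] at h7
  refine h7.trans ((congrArg₂ (fun a b : EM × F => a - b) h1 h3).trans ?_)
  let D := mfderiv (𝓘(ℝ, Fin n → ℝ).prod 𝓘(ℝ, EM)) (𝓘(ℝ, EM).prod 𝓘(ℝ, F)) K (c, x)
  refine (D.map_sub _ _).symm.trans (congrArg D ?_)
  refine Prod.ext ?_ (sub_zero _)
  funext j
  exact zero_sub _

/-- The tangent lift is a smooth vector field. -/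
theorem contMDiff_tangentLift (u : A.Sec) :
    ContMDiff (𝓘(ℝ, EM).prod 𝓘(ℝ, F)) (𝓘(ℝ, EM).prod 𝓘(ℝ, F)).tangent ∞
      (fun e : TotalSpace F E =>
        (⟨e, A.tangentLift u e⟩ : TangentBundle (𝓘(ℝ, EM).prod 𝓘(ℝ, F)) (TotalSpace F E))) := by
  intro e₀
  obtain ⟨s, θ, hθ, h⟩ := A.exists_frame_sec e₀.1
  have hK : ContMDiff (𝓘(ℝ, Fin (Module.finrank ℝ F) → ℝ).prod 𝓘(ℝ, EM)).tangent
      (𝓘(ℝ, EM).prod 𝓘(ℝ, F)).tangent ∞ _ :=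
    (contMDiff_linearCombination (EM := EM) (F := F) (E := E) s).contMDiff_tangentMap
      (m := ∞) (by simp)
  have h1 : ContMDiff (𝓘(ℝ, EM).prod 𝓘(ℝ, F)) 𝓘(ℝ, Fin (Module.finrank ℝ F) → ℝ).tangent ∞
      (fun e : TotalSpace F E => (⟨fun i => θ i e.1 e.2,
        fun j => -∑ i, θ i e.1 e.2 * θ j e.1 (⁅u, s i⁆ e.1)⟩ :
        TangentBundle 𝓘(ℝ, Fin (Module.finrank ℝ F) → ℝ) (Fin (Module.finrank ℝ F) → ℝ))) := by
    have hb : ContMDiff (𝓘(ℝ, EM).prod 𝓘(ℝ, F)) 𝓘(ℝ, Fin (Module.finrank ℝ F) → ℝ) ∞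
        (fun (e : TotalSpace F E) i => θ i e.1 e.2) := contMDiff_pi_space.2 hθ
    have hf : ContMDiff (𝓘(ℝ, EM).prod 𝓘(ℝ, F)) 𝓘(ℝ, Fin (Module.finrank ℝ F) → ℝ) ∞
        (fun (e : TotalSpace F E) j => -∑ i, θ i e.1 e.2 * θ j e.1 (⁅u, s i⁆ e.1)) := by
      refine contMDiff_pi_space.2 fun j => ?_
      refine ContMDiff.neg ?_
      refine contMDiff_finsetSum fun i _ => ?_
      exact ContMDiff.mul (hθ i)
        ((pairing (hθ j) ⁅u, s i⁆).contMDiff.comp (contMDiff_proj E))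
    intro e
    refine Bundle.contMDiffAt_totalSpace.2 ⟨hb e, ?_⟩
    simpa using hf e
  have h2 : ContMDiff (𝓘(ℝ, EM).prod 𝓘(ℝ, F)) 𝓘(ℝ, EM).tangent ∞
      (fun e : TotalSpace F E => (⟨e.1, A.anchor e.1 (u e.1)⟩ : TangentBundle 𝓘(ℝ, EM) M)) :=
    (contMDiff_anchor_sec u).comp (contMDiff_proj E)
  -- The lift is the tangent map of the frame parametrisation applied to a vector field with smooth
  -- components.
  refine (hK.contMDiffAt.comp e₀ (contMDiffAt_tangentBundle_prodMk (h1 e₀) (h2 e₀))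
    ).congr_of_eventuallyEq ?_
  filter_upwards [(FiberBundle.continuous_proj F E).continuousAt.eventually h] with e he
  have h3 := tangentLift_eq_mfderiv u he
  have h4 : (⟨e.1, ∑ i, θ i e.1 e.2 • s i e.1⟩ : TotalSpace F E) = e :=
    congrArg (TotalSpace.mk e.1) (he e.2)
  let T : TotalSpace F E → EM × F → TangentBundle (𝓘(ℝ, EM).prod 𝓘(ℝ, F)) (TotalSpace F E) :=
    fun e ξ => ⟨e, ξ⟩
  exact (congrArg (T e) h3).trans (congrArg (fun e' => T e' _) h4.symm)

theorem contMDiff_lieDeriv (u : A.Sec) {q : TotalSpace F E → ℝ}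
    (hq : ContMDiff (𝓘(ℝ, EM).prod 𝓘(ℝ, F)) 𝓘(ℝ, ℝ) ∞ q) :
    ContMDiff (𝓘(ℝ, EM).prod 𝓘(ℝ, F)) 𝓘(ℝ, ℝ) ∞ (A.lieDeriv u q) :=
  hq.dirDeriv (contMDiff_tangentLift u)

theorem isOneForm_lieOneForm (u : A.Sec) {α : ∀ x, E x →ₗ[ℝ] ℝ}
    (hα : IsOneForm (EM := EM) (F := F) α) :
    IsOneForm (EM := EM) (F := F) (lieOneForm u hα) :=
  contMDiff_lieDeriv u (q := fun e : TotalSpace F E => α e.1 e.2) hα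

/-- The Lie derivatives form a representation of the Lie algebra of sections. -/
theorem lieDeriv_lie (u v : A.Sec) {q : TotalSpace F E → ℝ}
    (hq : ContMDiff (𝓘(ℝ, EM).prod 𝓘(ℝ, F)) 𝓘(ℝ, ℝ) ∞ q) (e : TotalSpace F E) :
    A.lieDeriv ⁅u, v⁆ q e = A.lieDeriv u (A.lieDeriv v q) e - A.lieDeriv v (A.lieDeriv u q) e := by
  have : CompleteSpace EM := FiniteDimensional.complete ℝ EM
  have : CompleteSpace F := FiniteDimensional.complete ℝ F
  have key : ∀ {q : TotalSpace F E → ℝ}, ContMDiff (𝓘(ℝ, EM).prod 𝓘(ℝ, F)) 𝓘(ℝ, ℝ) ∞ q →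
      dirDeriv (𝓘(ℝ, EM).prod 𝓘(ℝ, F)) q e
        (VectorField.mlieBracket (𝓘(ℝ, EM).prod 𝓘(ℝ, F)) (A.tangentLift u) (A.tangentLift v) e) =
      A.lieDeriv u (A.lieDeriv v q) e - A.lieDeriv v (A.lieDeriv u q) e := fun hq =>
    dirDeriv_mlieBracket hq ((contMDiff_tangentLift u).mdiffAt e)
      ((contMDiff_tangentLift v).mdiffAt e) ((contMDiff_lieDeriv u hq).mdiffAt e)
      ((contMDiff_lieDeriv v hq).mdiffAt e)
  -- The identity is first proved for vector fields, tested on basic functions and one-forms only.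
  -- It then holds on every smooth `q`.
  have h0 : A.tangentLift ⁅u, v⁆ e - VectorField.mlieBracket (𝓘(ℝ, EM).prod 𝓘(ℝ, F))
      (A.tangentLift u) (A.tangentLift v) e = 0 := by
    refine eq_zero_of_dirDeriv_eq_zero (fun f => ?_) fun α hα => ?_
    · rw [dirDeriv_vec_sub, sub_eq_zero,
        key (q := fun e' : TotalSpace F E => f e'.1) (f.contMDiff.comp (contMDiff_proj E))]
      refine (lieDeriv_basic ⁅u, v⁆ f e).trans ?_
      rw [anchorDeriv_lie]
      have h1 : ∀ w : A.Sec, A.lieDeriv w (fun e' : TotalSpace F E => f e'.1) =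
          fun e' => anchorDeriv w f e'.1 := fun w => funext fun e' => lieDeriv_basic w f e'
      rw [h1, h1, lieDeriv_basic, lieDeriv_basic]
    · rw [dirDeriv_vec_sub, sub_eq_zero, key (q := fun e : TotalSpace F E => α e.1 e.2) hα]
      obtain ⟨x, a⟩ := e
      obtain ⟨w, hw⟩ := A.exists_sec ⟨x, a⟩
      simp only at hw
      subst hw
      refine (lieDeriv_oneForm hα ⁅u, v⁆ w x).trans ?_
      -- The two middle terms are together symmetric in `u'` and `v'` and drop out of the
      -- commutator. The rest is the anchor identity on the pairing and the Jacobi identity inside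
      -- `α`.
      have h1 : ∀ u' v' : A.Sec,
          A.lieDeriv u' (A.lieDeriv v' (fun e : TotalSpace F E => α e.1 e.2)) ⟨x, w x⟩ =
          anchorDeriv u' (anchorDeriv v' (pairing hα w)) x
            - anchorDeriv u' (pairing hα ⁅v', w⁆) x
            - anchorDeriv v' (pairing hα ⁅u', w⁆) x + α x (⁅v', ⁅u', w⁆⁆ x) := by
        intro u' v'
        refine (lieDeriv_oneForm (isOneForm_lieOneForm v' hα) u' w x).trans ?_
        rw [lieOneForm_sec]
        have h2 : ⇑(pairing (isOneForm_lieOneForm v' hα) w) = fun y =>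
            anchorDeriv v' (pairing hα w) y - pairing hα ⁅v', w⁆ y := by
          funext y
          exact lieOneForm_sec v' w hα y
        rw [anchorDeriv_apply u' (pairing (isOneForm_lieOneForm v' hα) w), h2,
          dirDeriv_sub ((anchorDeriv v' (pairing hα w)).contMDiff.mdiffAt x)
            ((pairing hα ⁅v', w⁆).contMDiff.mdiffAt x),
          ← anchorDeriv_apply, ← anchorDeriv_apply]
        ring
      rw [h1, h1, anchorDeriv_lie, leibniz_lie u v w, Sec.add_apply, map_add]
      ring
  rw [← key hq, ← sub_eq_zero.1 h0]
  rfl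

theorem tangentLift_add (u v : A.Sec) (e : TotalSpace F E) :
    A.tangentLift (u + v) e = A.tangentLift u e + A.tangentLift v e := by
  rw [← sub_eq_zero]
  refine eq_zero_of_dirDeriv_eq_zero (fun f => ?_) fun α hα => ?_
  · rw [dirDeriv_vec_sub, dirDeriv_vec_add, sub_eq_zero]
    refine (lieDeriv_basic (u + v) f e).trans
      (Eq.trans ?_ (congrArg₂ (· + ·) (lieDeriv_basic u f e) (lieDeriv_basic v f e)).symm)
    rw [anchorDeriv_apply, Sec.add_apply, map_add, dirDeriv_vec_add]
    rfl
  · rw [dirDeriv_vec_sub, dirDeriv_vec_add, sub_eq_zero]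
    obtain ⟨x, a⟩ := e
    obtain ⟨w, hw⟩ := A.exists_sec ⟨x, a⟩
    simp only at hw
    subst hw
    refine (lieDeriv_oneForm hα (u + v) w x).trans
      (Eq.trans ?_ (congrArg₂ (· + ·) (lieDeriv_oneForm hα u w x)
        (lieDeriv_oneForm hα v w x)).symm)
    rw [anchorDeriv_apply, Sec.add_apply, map_add, dirDeriv_vec_add, add_lie, Sec.add_apply,
      map_add, ← anchorDeriv_apply, ← anchorDeriv_apply]
    ring

theorem tangentLift_smul (c : ℝ) (u : A.Sec) (e : TotalSpace F E) :
    A.tangentLift (c • u) e = c • A.tangentLift u e := by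
  rw [← sub_eq_zero]
  refine eq_zero_of_dirDeriv_eq_zero (fun f => ?_) fun α hα => ?_
  · rw [dirDeriv_vec_sub, dirDeriv_vec_smul, sub_eq_zero]
    refine (lieDeriv_basic (c • u) f e).trans
      (Eq.trans ?_ (congrArg (c * ·) (lieDeriv_basic u f e)).symm)
    rw [anchorDeriv_apply, Sec.smul_apply, map_smul, dirDeriv_vec_smul]
    rfl
  · rw [dirDeriv_vec_sub, dirDeriv_vec_smul, sub_eq_zero]
    obtain ⟨x, a⟩ := e
    obtain ⟨w, hw⟩ := A.exists_sec ⟨x, a⟩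
    simp only at hw
    subst hw
    refine (lieDeriv_oneForm hα (c • u) w x).trans
      (Eq.trans ?_ (congrArg (c * ·) (lieDeriv_oneForm hα u w x)).symm)
    rw [anchorDeriv_apply, Sec.smul_apply, map_smul, dirDeriv_vec_smul, smul_lie, Sec.smul_apply,
      map_smul, ← anchorDeriv_apply, smul_eq_mul]
    ring

/-- The derivation of the functions on the total space given by the tangent lift. -/
def lieDerivation (u : A.Sec) : Derivation ℝ C^∞⟮𝓘(ℝ, EM).prod 𝓘(ℝ, F), TotalSpace F E; ℝ⟯
    C^∞⟮𝓘(ℝ, EM).prod 𝓘(ℝ, F), TotalSpace F E; ℝ⟯ :=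
  Derivation.mk'
    { toFun := fun f => ⟨A.lieDeriv u f, contMDiff_lieDeriv u f.contMDiff⟩
      map_add' := fun f f' => ContMDiffMap.ext fun e =>
        dirDeriv_add (f.contMDiff.mdiffAt e) (f'.contMDiff.mdiffAt e) _
      map_smul' := fun c f => ContMDiffMap.ext fun e =>
        dirDeriv_const_mul (f.contMDiff.mdiffAt e) c _ }
    fun f f' => ContMDiffMap.ext fun e =>
      dirDeriv_mul (f.contMDiff.mdiffAt e) (f'.contMDiff.mdiffAt e) _

variable (A) in
/-- The homomorphism `u ↦ d_T(u)` into the vector fields on the total space. -/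
def lieHom : A.Sec →ₗ⁅ℝ⁆ Derivation ℝ C^∞⟮𝓘(ℝ, EM).prod 𝓘(ℝ, F), TotalSpace F E; ℝ⟯
    C^∞⟮𝓘(ℝ, EM).prod 𝓘(ℝ, F), TotalSpace F E; ℝ⟯ where
  toFun := lieDerivation
  map_add' u v := Derivation.ext fun f => ContMDiffMap.ext fun e => by
    change dirDeriv _ _ _ _ = dirDeriv _ _ _ _ + dirDeriv _ _ _ _
    rw [tangentLift_add, dirDeriv_vec_add]
  map_smul' c u := Derivation.ext fun f => ContMDiffMap.ext fun e => by
    change dirDeriv _ _ _ _ = c * dirDeriv _ _ _ _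
    rw [tangentLift_smul, dirDeriv_vec_smul]
  map_lie' {u v} := Derivation.ext fun f => ContMDiffMap.ext fun e => by
    rw [Derivation.commutator_apply]
    exact lieDeriv_lie u v f.contMDiff e

theorem lieHom_apply (u : A.Sec)
    (f : C^∞⟮𝓘(ℝ, EM).prod 𝓘(ℝ, F), TotalSpace F E; ℝ⟯) (e : TotalSpace F E) :
    A.lieHom u f e = A.lieDeriv u f e := rfl

/-- The scalar multiplication of the bundle by a constant. -/
theorem contMDiff_smul_total (c : ℝ) :
    ContMDiff (𝓘(ℝ, EM).prod 𝓘(ℝ, F)) (𝓘(ℝ, EM).prod 𝓘(ℝ, F)) ∞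
      (fun e : TotalSpace F E => (⟨e.1, c • e.2⟩ : TotalSpace F E)) := fun _ =>
  ContMDiffAt.totalSpace_smul (b := fun e : TotalSpace F E => e.1) (s := fun e => e.2)
    contMDiffAt_const contMDiffAt_id

/-- The tangent lift is a linear vector field. -/
theorem tangentLift_smul_total (u : A.Sec) (c : ℝ) (e : TotalSpace F E) :
    A.tangentLift u (⟨e.1, c • e.2⟩ : TotalSpace F E) =
      mfderiv (𝓘(ℝ, EM).prod 𝓘(ℝ, F)) (𝓘(ℝ, EM).prod 𝓘(ℝ, F))
        (fun e : TotalSpace F E => (⟨e.1, c • e.2⟩ : TotalSpace F E)) e (A.tangentLift u e) := by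
  have hm := (contMDiff_smul_total (EM := EM) (F := F) (E := E) c).mdiffAt e
  rw [← sub_eq_zero]
  -- Fibre scaling fixes basic functions and multiplies one-forms by `c`; the Lie derivative of a
  -- one-form is again fibrewise linear.
  refine eq_zero_of_dirDeriv_eq_zero (fun f => ?_) fun α hα => ?_
  · rw [dirDeriv_vec_sub, sub_eq_zero, ← dirDeriv_comp
      (q := fun e' : TotalSpace F E => f e'.1) ((f.contMDiff.comp (contMDiff_proj E)).mdiffAt _) hm]
    exact (lieDeriv_basic u f _).trans (lieDeriv_basic u f e).symm
  · rw [dirDeriv_vec_sub, sub_eq_zero, ← dirDeriv_comp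
      (ContMDiff.mdiffAt (f := fun e : TotalSpace F E => α e.1 e.2) hα _) hm]
    have h1 : (fun e : TotalSpace F E => α e.1 (c • e.2)) = fun e => c * α e.1 e.2 := by
      funext e
      exact map_smul (α e.1) c e.2
    simp only
    rw [h1, dirDeriv_const_mul (ContMDiff.mdiffAt (f := fun e : TotalSpace F E => α e.1 e.2) hα _)]
    exact map_smul (lieOneForm u hα e.1) c e.2

end LieAlgebroid

end Algebroid

/-! ### Killing sections, central sections and first variations -/

section Algebroid

variable {EM : Type*} [NormedAddCommGroup EM] [NormedSpace ℝ EM] [FiniteDimensional ℝ EM]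
  {M : Type*} [TopologicalSpace M] [ChartedSpace EM M] [IsManifold 𝓘(ℝ, EM) ∞ M]
  [T2Space M] [SigmaCompactSpace M]
  {F : Type*} [NormedAddCommGroup F] [NormedSpace ℝ F] [FiniteDimensional ℝ F]
  {E : M → Type*} [∀ x, AddCommGroup (E x)] [∀ x, Module ℝ (E x)]
  [∀ x, TopologicalSpace (E x)] [TopologicalSpace (TotalSpace F E)]
  [FiberBundle F E] [VectorBundle ℝ F E] [ContMDiffVectorBundle ∞ F E 𝓘(ℝ, EM)]
  {V H Q : Type*} [NormedAddCommGroup V] [NormedSpace ℝ V] [TopologicalSpace H]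
  {I : ModelWithCorners ℝ V H} [TopologicalSpace Q] [ChartedSpace H Q]
  {A : LieAlgebroid EM M F E}

section Metric

variable [∀ x, IsTopologicalAddGroup (E x)] [∀ x, ContinuousConstSMul ℝ (E x)]
  (G : ContMDiffRiemannianMetric 𝓘(ℝ, EM) ∞ F E)

theorem Bundle.ContMDiffRiemannianMetric.contMDiffAt_inner {b : Q → M} {v w : ∀ q, E (b q)} {q : Q}
    (hv : ContMDiffAt I (𝓘(ℝ, EM).prod 𝓘(ℝ, F)) ∞ (fun q => (⟨b q, v q⟩ : TotalSpace F E)) q)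
    (hw : ContMDiffAt I (𝓘(ℝ, EM).prod 𝓘(ℝ, F)) ∞ (fun q => (⟨b q, w q⟩ : TotalSpace F E)) q) :
    ContMDiffAt I 𝓘(ℝ, ℝ) ∞ (fun q => G.inner (b q) (v q) (w q)) q := by
  have hb : ContMDiffAt I 𝓘(ℝ, EM) ∞ b q := (contMDiffAt_totalSpace.1 hv).1
  have h1 := ContMDiffAt.clm_bundle_apply₂ (F₁ := F) (F₂ := F) (F₃ := ℝ)
    (E₃ := Bundle.Trivial M ℝ) (G.contMDiff.contMDiffAt.comp q hb) hv hw
  have h2 := (contMDiffAt_totalSpace.1 h1).2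
  simpa using h2

theorem contMDiff_metricFunction :
    ContMDiff (𝓘(ℝ, EM).prod 𝓘(ℝ, F)) 𝓘(ℝ, ℝ) ∞ (metricFunction G) := fun _ =>
  G.contMDiffAt_inner (b := fun e : TotalSpace F E => e.1) (v := fun e => e.2) (w := fun e => e.2)
    contMDiffAt_id contMDiffAt_id

namespace LieAlgebroid

/-- The metric dual of a section: a one-form that is positive on `w` wherever `w` does not vanish,
used to detect a non-zero bracket. -/
theorem isOneForm_inner (w : A.Sec) :
    IsOneForm (EM := EM) (F := F) fun x => (G.inner x (w x) : E x →ₗ[ℝ] ℝ) := fun e =>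
  G.contMDiffAt_inner (b := fun e : TotalSpace F E => e.1) (v := fun e => w e.1)
    (w := fun e => e.2) (((contMDiff_sec w).comp (contMDiff_proj E)) e) contMDiffAt_id

theorem metricFunction_smul (c : ℝ) (e : TotalSpace F E) :
    metricFunction G ⟨e.1, c • e.2⟩ = c ^ 2 * metricFunction G e := by
  change G.inner e.1 (c • e.2) (c • e.2) = c ^ 2 * G.inner e.1 e.2 e.2
  rw [map_smul, map_smul]
  change c * (c * G.inner e.1 e.2 e.2) = _
  ring

/-- Fibre scaling by `c` carries `d_T(u)` to itself and pulls `G` back to `c² G`. Only this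
homogeneity of `L_u G` is needed for fields of rank one. -/
theorem lieDeriv_metricFunction_smul (u : A.Sec) (c : ℝ) (e : TotalSpace F E) :
    A.lieDeriv u (metricFunction G) ⟨e.1, c • e.2⟩ =
      c ^ 2 * A.lieDeriv u (metricFunction G) e := by
  have hG := contMDiff_metricFunction G
  rw [lieDeriv, tangentLift_smul_total, ← dirDeriv_comp (hG.mdiffAt _)
    ((contMDiff_smul_total (EM := EM) (F := F) (E := E) c).mdiffAt e)]
  simp only [metricFunction_smul]
  exact dirDeriv_const_mul (hG.mdiffAt e) _ _

/-- The Lie algebra of Killing sections. -/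
def killing (A : LieAlgebroid EM M F E) : LieSubalgebra ℝ A.Sec where
  carrier := {u | A.IsKilling G u}
  add_mem' {u v} hu hv e := by
    have h : A.lieDeriv (u + v) (metricFunction G) e =
        A.lieDeriv u (metricFunction G) e + A.lieDeriv v (metricFunction G) e := by
      rw [lieDeriv, tangentLift_add, dirDeriv_vec_add]
      rfl
    rw [h, hu e, hv e, add_zero]
  zero_mem' e := by
    have h : A.tangentLift (0 : A.Sec) e = 0 := by
      have := tangentLift_smul (A := A) 0 0 e
      rwa [zero_smul, zero_smul] at this
    rw [lieDeriv, h, dirDeriv_zero]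
  smul_mem' c u hu e := by
    have h : A.lieDeriv (c • u) (metricFunction G) e =
        c * A.lieDeriv u (metricFunction G) e := by
      rw [lieDeriv, tangentLift_smul, dirDeriv_vec_smul]
      rfl
    rw [h, hu e, mul_zero]
  lie_mem' {u v} hu hv e := by
    have hu' : A.lieDeriv u (metricFunction G) = fun _ => 0 := funext hu
    have hv' : A.lieDeriv v (metricFunction G) = fun _ => 0 := funext hv
    rw [lieDeriv_lie u v (contMDiff_metricFunction G), hu', hv', lieDeriv, lieDeriv,
      dirDeriv_const, dirDeriv_const, sub_zero]

theorem mem_killing (u : A.Sec) : u ∈ A.killing G ↔ A.IsKilling G u := Iff.rfl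

/-- If the lift vanishes, evaluating it on the metric dual of `⁅u, v⁆` gives minus the squared
length of the bracket. Conversely, for central `u` the Leibniz rule reduces to `(ρ(u) f) v = 0`; a
section with `v x ≠ 0` forces `ρ(u)` to vanish at `x`, and where the fibre is zero this is
automatic. Both terms of the lift are then zero. -/
theorem lieHom_eq_zero_iff (G : ContMDiffRiemannianMetric 𝓘(ℝ, EM) ∞ F E) (u : A.Sec) : A.lieHom u = 0 ↔ ∀ v : A.Sec, ⁅u, v⁆ = 0 := by
  constructor
  · intro h v
    have hz : ∀ (q : TotalSpace F E → ℝ), ContMDiff (𝓘(ℝ, EM).prod 𝓘(ℝ, F)) 𝓘(ℝ, ℝ) ∞ q →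
        ∀ e, A.lieDeriv u q e = 0 := by
      intro q hq e
      have := lieHom_apply u ⟨q, hq⟩ e
      rw [h] at this
      exact this.symm
    refine Sec.ext fun x => ?_
    have hα := isOneForm_inner G ⁅u, v⁆
    have h1 := hz _ hα ⟨x, v x⟩
    rw [lieDeriv_oneForm hα] at h1
    have h2 : anchorDeriv u (pairing hα v) x = 0 := by
      have h3 := hz (fun e => pairing hα v e.1)
        ((pairing hα v).contMDiff.comp (contMDiff_proj E)) ⟨x, v x⟩
      rwa [lieDeriv_basic] at h3
    rw [h2, zero_sub, neg_eq_zero] at h1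
    by_contra hne
    exact (G.pos x (⁅u, v⁆ x) hne).ne' h1
  · intro h
    have hρ : ∀ x, A.anchor x (u x) = 0 := by
      intro x
      by_cases hx : ∃ a : E x, a ≠ 0
      · obtain ⟨a, ha⟩ := hx
        obtain ⟨v, hv⟩ := A.exists_sec ⟨x, a⟩
        simp only at hv
        refine eq_zero_of_forall_dirDeriv_eq_zero (I := 𝓘(ℝ, EM)) fun f => ?_
        have h1 := lie_fsmul u v f x
        rw [h, h, Sec.zero_apply, smul_zero, zero_add, hv] at h1
        exact (smul_eq_zero.1 h1.symm).resolve_right ha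
      · push Not at hx
        rw [hx (u x), map_zero]
    have ht : ∀ e, A.tangentLift u e = 0 := by
      intro e
      refine eq_zero_of_dirDeriv_eq_zero (fun f => ?_) fun α hα => ?_
      · refine (lieDeriv_basic u f e).trans ?_
        rw [anchorDeriv_apply, hρ, dirDeriv_zero]
      · obtain ⟨x, a⟩ := e
        obtain ⟨v, hv⟩ := A.exists_sec ⟨x, a⟩
        simp only at hv
        subst hv
        refine (lieDeriv_oneForm hα u v x).trans ?_
        rw [anchorDeriv_apply, hρ, dirDeriv_zero, h, Sec.zero_apply, map_zero, sub_zero]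
    refine Derivation.ext fun f => ContMDiffMap.ext fun e => ?_
    rw [lieHom_apply, lieDeriv, ht, dirDeriv_zero]
    rfl

end LieAlgebroid

end Metric

section Fields

variable {k : ℕ} {N : Type*} [TopologicalSpace N] [ChartedSpace (EuclideanSpace ℝ (Fin k)) N]
  [IsManifold (𝓡 k) ∞ N]

namespace LieAlgebroid

theorem IsRedefinitionFamily.contMDiff_curve {u : A.Sec} {Ψ : ℝ → BundleMap EM F E k N}
    (hΨ : A.IsRedefinitionFamily u Ψ) (p : TangentBundle (𝓡 k) N) :
    ContMDiff 𝓘(ℝ, ℝ) (𝓘(ℝ, EM).prod 𝓘(ℝ, F)) ∞ (fun t => (Ψ t).toMap p) :=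
  hΨ.1.comp (contMDiff_id.prodMk contMDiff_const)

/-- The first variation of a function evaluated on the field at a point. -/
theorem IsRedefinitionFamily.hasDerivAt {u : A.Sec} {Ψ : ℝ → BundleMap EM F E k N}
    (hΨ : A.IsRedefinitionFamily u Ψ) {q : TotalSpace F E → ℝ}
    (hq : ContMDiff (𝓘(ℝ, EM).prod 𝓘(ℝ, F)) 𝓘(ℝ, ℝ) ∞ q) (p : TangentBundle (𝓡 k) N) :
    HasDerivAt (fun t => q ((Ψ t).toMap p)) (A.lieDeriv u q ((Ψ 0).toMap p)) 0 := by
  have h := hasDerivAt_comp_curve (hq.mdiffAt _) ((hΨ.contMDiff_curve p).mdiffAt 0)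
  rw [hΨ.2 p] at h
  exact h

theorem hasVariation_eval (u : A.Sec) {q : TotalSpace F E → ℝ}
    (hq : ContMDiff (𝓘(ℝ, EM).prod 𝓘(ℝ, F)) 𝓘(ℝ, ℝ) ∞ q) (p : TangentBundle (𝓡 k) N) :
    A.HasVariation u (fun Φ : BundleMap EM F E k N => q (Φ.toMap p))
      (fun Φ => A.lieDeriv u q (Φ.toMap p)) := fun _ hΨ => hΨ.hasDerivAt hq p

end LieAlgebroid

end Fields

end Algebroid

/-! ### The Lie derivative commutes with the algebroid differential -/

section Morphisms

variable {EM : Type*} [NormedAddCommGroup EM] [NormedSpace ℝ EM] [FiniteDimensional ℝ EM]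
  {M : Type*} [TopologicalSpace M] [ChartedSpace EM M] [IsManifold 𝓘(ℝ, EM) ∞ M]
  [T2Space M] [SigmaCompactSpace M]
  {F : Type*} [NormedAddCommGroup F] [NormedSpace ℝ F] [FiniteDimensional ℝ F]
  {E : M → Type*} [∀ x, AddCommGroup (E x)] [∀ x, Module ℝ (E x)]
  [∀ x, TopologicalSpace (E x)] [TopologicalSpace (TotalSpace F E)]
  [FiberBundle F E] [VectorBundle ℝ F E] [ContMDiffVectorBundle ∞ F E 𝓘(ℝ, EM)]
  {A : LieAlgebroid EM M F E}

namespace LieAlgebroid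

variable (A) in
/-- The algebroid differential `d_E f` of a function. -/
def dFunction (f : C^∞⟮𝓘(ℝ, EM), M; ℝ⟯) (x : M) : E x →ₗ[ℝ] ℝ where
  toFun a := dirDeriv 𝓘(ℝ, EM) f x (A.anchor x a)
  map_add' a b := by rw [map_add, dirDeriv_vec_add]
  map_smul' c a := by rw [map_smul, dirDeriv_vec_smul]; rfl

theorem isOneForm_dFunction (f : C^∞⟮𝓘(ℝ, EM), M; ℝ⟯) :
    IsOneForm (EM := EM) (F := F) (A.dFunction f) :=
  f.contMDiff.dirDeriv A.contMDiff_anchor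

/-- Evaluated on a section `v`, this is the commutator formula for `ρ([u, v])` on `f`: the Lie
derivative commutes with `d_E` in degree zero. -/
theorem lieOneForm_dFunction (u : A.Sec) (f : C^∞⟮𝓘(ℝ, EM), M; ℝ⟯) (x : M) (a : E x) :
    lieOneForm u (isOneForm_dFunction (A := A) f) x a = A.dFunction (anchorDeriv u f) x a := by
  obtain ⟨v, hv⟩ := A.exists_sec ⟨x, a⟩
  simp only at hv
  subst hv
  have h1 := lieOneForm_sec u v (isOneForm_dFunction (A := A) f) x
  have h2 : pairing (isOneForm_dFunction (A := A) f) v = anchorDeriv v f :=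
    ContMDiffMap.ext fun y => rfl
  rw [h2] at h1
  have h3 := anchorDeriv_lie u v f x
  have h4 : A.dFunction f x (⁅u, v⁆ x) = anchorDeriv ⁅u, v⁆ f x := rfl
  have h5 : A.dFunction (anchorDeriv u f) x (v x) = anchorDeriv v (anchorDeriv u f) x := rfl
  rw [h1, h4, h3, h5]
  ring

variable {α : ∀ x, E x →ₗ[ℝ] ℝ} (hα : IsOneForm (EM := EM) (F := F) α)
include hα

/-- The two chosen sections are replaced one at a time. Skew-symmetry of the bracket moves each of
them into the slot where independence of the extension is known. -/
theorem dOneForm_sec (v w : A.Sec) (x : M) :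
    A.dOneForm α x (v x) (w x) =
      anchorDeriv v (pairing hα w) x - anchorDeriv w (pairing hα v) x - α x (⁅v, w⁆ x) := by
  set v' : A.Sec := sectionThrough (⟨x, v x⟩ : TotalSpace F E) with hv'
  set w' : A.Sec := sectionThrough (⟨x, w x⟩ : TotalSpace F E) with hw'
  have ev : v' x = v x := (exists_section_through (⟨x, v x⟩ : TotalSpace F E)).choose_spec
  have ew : w' x = w x := (exists_section_through (⟨x, w x⟩ : TotalSpace F E)).choose_spec
  have h1 := dirDeriv_sub_oneForm_lie_congr hα v' ew
  have h2 := dirDeriv_sub_oneForm_lie_congr hα w ev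
  have h3 : ∀ a b : A.Sec, α x (⁅a, b⁆ x) = -α x (⁅b, a⁆ x) := by
    intro a b
    have : ⁅a, b⁆ x = (-1 : ℝ) • ⁅b, a⁆ x := by
      rw [← Sec.smul_apply, neg_one_smul, lie_skew]
    rw [this, map_smul, smul_eq_mul, neg_one_mul]
  have h4 : A.dOneForm α x (v x) (w x) = dirDeriv 𝓘(ℝ, EM) (fun y => α y (w' y)) x
      (A.anchor x (v x)) - dirDeriv 𝓘(ℝ, EM) (fun y => α y (v' y)) x (A.anchor x (w x))
        - α x (⁅v', w'⁆ x) := rfl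
  have h5 : anchorDeriv v (pairing hα w) x =
    dirDeriv 𝓘(ℝ, EM) (fun y => α y (w y)) x (A.anchor x (v x)) := rfl
  have h6 : anchorDeriv w (pairing hα v) x =
    dirDeriv 𝓘(ℝ, EM) (fun y => α y (v y)) x (A.anchor x (w x)) := rfl
  rw [h4, h5, h6, h3 v w]
  rw [ev, h3 v' w] at h1
  linarith

/-- Cartan's formula for the contraction of `d_E α` with a section. -/
theorem dOneForm_sec_right (w : A.Sec) (x : M) (a : E x) :
    A.dOneForm α x a (w x) = A.dFunction (pairing hα w) x a - lieOneForm w hα x a := by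
  obtain ⟨v, hv⟩ := A.exists_sec ⟨x, a⟩
  simp only at hv
  subst hv
  rw [dOneForm_sec hα, lieOneForm_sec]
  have h3 : α x (⁅v, w⁆ x) = -α x (⁅w, v⁆ x) := by
    have : ⁅v, w⁆ x = (-1 : ℝ) • ⁅w, v⁆ x := by
      rw [← Sec.smul_apply, neg_one_smul, lie_skew]
    rw [this, map_smul, smul_eq_mul, neg_one_mul]
  have h5 : A.dFunction (pairing hα w) x (v x) = anchorDeriv v (pairing hα w) x := rfl
  rw [h3, h5]
  ring

omit hα in
theorem anchorDeriv_add_sec (v w : A.Sec) (f : C^∞⟮𝓘(ℝ, EM), M; ℝ⟯) (x : M) :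
    anchorDeriv (v + w) f x = anchorDeriv v f x + anchorDeriv w f x :=
  map_add (A.dFunction f x) (v x) (w x)

/-- `d_E α` as a linear form in its second argument. -/
def dOneFormRight (x : M) (a : E x) : E x →ₗ[ℝ] ℝ where
  toFun b := A.dOneForm α x a b
  map_add' b c := by
    obtain ⟨v, hv⟩ := A.exists_sec ⟨x, a⟩
    obtain ⟨w, hw⟩ := A.exists_sec ⟨x, b⟩
    obtain ⟨w', hw'⟩ := A.exists_sec ⟨x, c⟩
    simp only at hv hw hw'
    subst hv hw hw'
    rw [← Sec.add_apply, dOneForm_sec hα, dOneForm_sec hα, dOneForm_sec hα, lie_add,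
      Sec.add_apply, map_add, anchorDeriv_add_sec]
    have h : anchorDeriv v (pairing hα (w + w')) x =
        anchorDeriv v (pairing hα w) x + anchorDeriv v (pairing hα w') x := by
      refine Eq.trans ?_ (dirDeriv_add (f := pairing hα w) (f' := pairing hα w')
        ((pairing hα w).contMDiff.mdiffAt x) ((pairing hα w').contMDiff.mdiffAt x) _)
      refine congrArg (fun f => dirDeriv 𝓘(ℝ, EM) f x (A.anchor x (v x))) (funext fun y => ?_)
      exact map_add (α y) (w y) (w' y)
    rw [h]
    ring
  map_smul' r b := by
    obtain ⟨v, hv⟩ := A.exists_sec ⟨x, a⟩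
    obtain ⟨w, hw⟩ := A.exists_sec ⟨x, b⟩
    simp only at hv hw
    subst hv hw
    rw [← Sec.smul_apply, dOneForm_sec hα, dOneForm_sec hα, lie_smul, Sec.smul_apply, map_smul,
      RingHom.id_apply, smul_eq_mul, smul_eq_mul]
    have h : anchorDeriv v (pairing hα (r • w)) x = r * anchorDeriv v (pairing hα w) x := by
      refine Eq.trans ?_ (dirDeriv_const_mul (f := pairing hα w)
        ((pairing hα w).contMDiff.mdiffAt x) r _)
      refine congrArg (fun f => dirDeriv 𝓘(ℝ, EM) f x (A.anchor x (v x))) (funext fun y => ?_)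
      exact map_smul (α y) r (w y)
    have h' : anchorDeriv (r • w) (pairing hα v) x = r * anchorDeriv w (pairing hα v) x :=
      map_smul (A.dFunction (pairing hα v) x) r (w x)
    rw [h, h']
    ring

/-- The contraction of `d_E α` with a section. -/
def contraction (w : A.Sec) (x : M) : E x →ₗ[ℝ] ℝ :=
  A.dFunction (pairing hα w) x - lieOneForm w hα x

theorem isOneForm_contraction (w : A.Sec) :
    IsOneForm (EM := EM) (F := F) (contraction hα w) :=
  (isOneForm_dFunction (A := A) _).sub (isOneForm_lieOneForm w hα)

/-- This is `L_u d_E α = d_E L_u α`, contracted with `w`. It follows from Cartan's formula, `L_u d_E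
f = d_E (ρ(u) f)` and `L_[u,w] = [L_u, L_w]`. -/
theorem lieOneForm_contraction (u w : A.Sec) (x : M) (a : E x) :
    lieOneForm u (isOneForm_contraction hα w) x a =
      A.dOneForm (lieOneForm u hα) x a (w x) + A.dOneForm α x a (⁅u, w⁆ x) := by
  rw [dOneForm_sec_right (isOneForm_lieOneForm u hα), dOneForm_sec_right hα]
  have h1 : lieOneForm u (isOneForm_contraction hα w) x a =
      lieOneForm u (isOneForm_dFunction (A := A) (pairing hα w)) x a -
        lieOneForm u (isOneForm_lieOneForm w hα) x a :=
    dirDeriv_sub ((isOneForm_dFunction (A := A) (pairing hα w)).mdiffAt _)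
      ((isOneForm_lieOneForm w hα).mdiffAt _) _
  have h2 := lieDeriv_lie u w hα ⟨x, a⟩
  have h3 : lieOneForm ⁅u, w⁆ hα x a = lieOneForm u (isOneForm_lieOneForm w hα) x a -
    lieOneForm w (isOneForm_lieOneForm u hα) x a := h2
  have h4 : A.dFunction (pairing (isOneForm_lieOneForm u hα) w) x a =
      A.dFunction (anchorDeriv u (pairing hα w)) x a
        - A.dFunction (pairing hα ⁅u, w⁆) x a := by
    refine Eq.trans ?_ (dirDeriv_sub (f := anchorDeriv u (pairing hα w))
      (f' := pairing hα ⁅u, w⁆) ((anchorDeriv u (pairing hα w)).contMDiff.mdiffAt x)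
      ((pairing hα ⁅u, w⁆).contMDiff.mdiffAt x) _)
    refine congrArg (fun f => dirDeriv 𝓘(ℝ, EM) f x (A.anchor x a)) (funext fun y => ?_)
    exact lieOneForm_sec u w hα y
  rw [h1, lieOneForm_dFunction, h3, h4]
  ring

section Fields

variable {k : ℕ} {N : Type*} [TopologicalSpace N] [ChartedSpace (EuclideanSpace ℝ (Fin k)) N]
  [IsManifold (𝓡 k) ∞ N]

/-- The first variation of `Φ^*(d_E α)` is `Φ^*(d_E (L_u α))`. -/
theorem IsRedefinitionFamily.hasDerivAt_dOneForm {u : A.Sec} {Ψ : ℝ → BundleMap EM F E k N}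
    (hΨ : A.IsRedefinitionFamily u Ψ) (z : N) (X Y : TangentSpace (𝓡 k) z) :
    HasDerivAt (fun t => A.dOneForm α ((Ψ t).base z) ((Ψ t).fiber z X) ((Ψ t).fiber z Y))
      (A.dOneForm (lieOneForm u hα) ((Ψ 0).base z) ((Ψ 0).fiber z X) ((Ψ 0).fiber z Y)) 0 := by
  obtain ⟨s, θ, hθ, hs⟩ := A.exists_frame_sec ((Ψ 0).base z)
  have hbase : Continuous fun t => (Ψ t).base z :=
    ((contMDiff_proj E (n := ∞) (IB := 𝓘(ℝ, EM)) (F := F)).comp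
      (hΨ.contMDiff_curve ⟨z, 0⟩)).continuous
  -- A frame around the initial base point still works for small `t`. Expanding the second argument
  -- turns `d_E α` into a sum of products of one-forms, each evaluated at a single point of the
  -- field, whose variations are known.
  have hev : ∀ᶠ t in 𝓝 (0 : ℝ), A.dOneForm α ((Ψ t).base z) ((Ψ t).fiber z X) ((Ψ t).fiber z Y) =
      ∑ j, θ j ((Ψ t).base z) ((Ψ t).fiber z Y) *
        contraction hα (s j) ((Ψ t).base z) ((Ψ t).fiber z X) := by
    filter_upwards [hbase.continuousAt.eventually hs] with t ht
    have h1 := map_sum (dOneFormRight (A := A) hα ((Ψ t).base z) ((Ψ t).fiber z X))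
      (fun j => θ j ((Ψ t).base z) ((Ψ t).fiber z Y) • s j ((Ψ t).base z)) Finset.univ
    rw [ht] at h1
    refine h1.trans (Finset.sum_congr rfl fun j _ => ?_)
    rw [map_smul, smul_eq_mul]
    exact congrArg _ (dOneForm_sec_right hα (s j) _ _)
  refine HasDerivAt.congr_of_eventuallyEq ?_ hev
  have hsum := HasDerivAt.fun_sum (u := Finset.univ) fun j _ =>
    (hΨ.hasDerivAt (hθ j) ⟨z, Y⟩).mul (hΨ.hasDerivAt (isOneForm_contraction hα (s j)) ⟨z, X⟩)
  refine hsum.congr_deriv ?_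
  have hs0 := hs.self_of_nhds
  obtain ⟨w, hw⟩ := A.exists_sec ⟨(Ψ 0).base z, (Ψ 0).fiber z Y⟩
  simp only at hw
  set x := (Ψ 0).base z with hx
  set a := (Ψ 0).fiber z X with ha
  have hl := lie_eq_sum hθ u w hs
  -- The derivative along `u` of the frame expansion of the identity: the Leibniz expansion of `⁅u,
  -- w⁆ x` minus the expansion of this vector in the frame.
  have hc : ∑ j, (lieOneForm u (hθ j) x (w x) • s j x + θ j x (w x) • ⁅u, s j⁆ x) = 0 := by
    have h1 : ∀ j, lieOneForm u (hθ j) x (w x) • s j x + θ j x (w x) • ⁅u, s j⁆ x =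
        (θ j x (w x) • ⁅u, s j⁆ x +
          dirDeriv 𝓘(ℝ, EM) (fun y => θ j y (w y)) x (A.anchor x (u x)) • s j x)
          - θ j x (⁅u, w⁆ x) • s j x := by
      intro j
      rw [lieOneForm_sec, sub_smul]
      have : anchorDeriv u (pairing (hθ j) w) x =
        dirDeriv 𝓘(ℝ, EM) (fun y => θ j y (w y)) x (A.anchor x (u x)) := rfl
      rw [this]
      abel
    rw [Finset.sum_congr rfl fun j _ => h1 j, Finset.sum_sub_distrib, ← hl, hs0, sub_self]
  have hc' := congrArg (dOneFormRight (A := A) hα x a) hc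
  rw [map_zero, map_sum] at hc'
  have hd := map_sum (dOneFormRight (A := A) (isOneForm_lieOneForm u hα) x a)
    (fun j => θ j x (w x) • s j x) Finset.univ
  rw [hs0] at hd
  -- In each term the product rule separates a part that sums to zero by `hc'` from a part that
  -- reassembles `d_E (L_u α)`.
  have hterm : ∀ j, A.lieDeriv u (fun e : TotalSpace F E => θ j e.1 e.2) ((Ψ 0).toMap ⟨z, Y⟩) *
      contraction hα (s j) x a + θ j x (w x) *
        A.lieDeriv u (fun e : TotalSpace F E => contraction hα (s j) e.1 e.2)
          ((Ψ 0).toMap ⟨z, X⟩) =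
      dOneFormRight (A := A) hα x a (lieOneForm u (hθ j) x (w x) • s j x + θ j x (w x) • ⁅u, s j⁆ x) +
        dOneFormRight (A := A) (isOneForm_lieOneForm u hα) x a (θ j x (w x) • s j x) := by
    intro j
    have e1 : A.lieDeriv u (fun e : TotalSpace F E => θ j e.1 e.2) ((Ψ 0).toMap ⟨z, Y⟩) =
      lieOneForm u (hθ j) x (w x) := by rw [hw]; rfl
    have e2 : A.lieDeriv u (fun e : TotalSpace F E => contraction hα (s j) e.1 e.2)
          ((Ψ 0).toMap ⟨z, X⟩) = lieOneForm u (isOneForm_contraction hα (s j)) x a := rfl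
    have e3 : contraction hα (s j) x a = dOneFormRight (A := A) hα x a (s j x) :=
      (dOneForm_sec_right hα (s j) x a).symm
    rw [e1, e2, lieOneForm_contraction, e3, map_add, map_smul, map_smul, map_smul]
    change _ + _ * (dOneFormRight (A := A) (isOneForm_lieOneForm u hα) x a (s j x) +
      dOneFormRight (A := A) hα x a (⁅u, s j⁆ x)) = _
    simp only [smul_eq_mul]
    ring
  rw [← hw]
  refine (Finset.sum_congr rfl fun j _ => ?_).trans
    ((Finset.sum_add_distrib (f := fun j => dOneFormRight (A := A) hα x a
      (lieOneForm u (hθ j) x (w x) • s j x + θ j x (w x) • ⁅u, s j⁆ x))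
      (g := fun j => dOneFormRight (A := A) (isOneForm_lieOneForm u hα) x a
        (θ j x (w x) • s j x))).trans ?_)
  · refine Eq.trans ?_ (hterm j)
    rw [hw]
    rfl
  · rw [hc', zero_add]
    exact hd.symm

/-- The derivative in the family parameter is exchanged with the derivative along `X`; inside, it
turns `α` into `L_u α`. -/
theorem IsRedefinitionFamily.hasDerivAt_dirDeriv_oneForm {u : A.Sec}
    {Ψ : ℝ → BundleMap EM F E k N} (hΨ : A.IsRedefinitionFamily u Ψ)
    (Y : Cₛ^∞⟮𝓡 k; EuclideanSpace ℝ (Fin k), (TangentSpace (𝓡 k) : N → Type _)⟯) (z : N)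
    (X : TangentSpace (𝓡 k) z) :
    HasDerivAt (fun t => dirDeriv (𝓡 k) (fun w => α ((Ψ t).base w) ((Ψ t).fiber w (Y w))) z X)
      (dirDeriv (𝓡 k) (fun w => lieOneForm u hα ((Ψ 0).base w) ((Ψ 0).fiber w (Y w))) z X) 0 := by
  have hsm : ContMDiff (𝓘(ℝ, ℝ).prod (𝓡 k)) 𝓘(ℝ, ℝ) ∞
      (fun r : ℝ × N => α ((Ψ r.1).base r.2) ((Ψ r.1).fiber r.2 (Y r.2))) :=
    (hα.comp hΨ.1).comp (contMDiff_fst.prodMk (Y.contMDiff.comp contMDiff_snd))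
  refine (hasDerivAt_dirDeriv hsm 0 z X).congr_deriv ?_
  refine congrArg (fun f => dirDeriv (𝓡 k) f z X) (funext fun w => ?_)
  exact (hΨ.hasDerivAt hα ⟨w, Y w⟩).deriv

end Fields

end LieAlgebroid

end Morphisms

/-! ### Redefinitions are tangent to the space of morphisms -/

section Preserves

variable {EM : Type*} [NormedAddCommGroup EM] [NormedSpace ℝ EM] [FiniteDimensional ℝ EM]
  {M : Type*} [TopologicalSpace M] [ChartedSpace EM M] [IsManifold 𝓘(ℝ, EM) ∞ M]
  [T2Space M] [SigmaCompactSpace M]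
  {F : Type*} [NormedAddCommGroup F] [NormedSpace ℝ F] [FiniteDimensional ℝ F]
  {E : M → Type*} [∀ x, AddCommGroup (E x)] [∀ x, Module ℝ (E x)]
  [∀ x, TopologicalSpace (E x)] [TopologicalSpace (TotalSpace F E)]
  [FiberBundle F E] [VectorBundle ℝ F E] [ContMDiffVectorBundle ∞ F E 𝓘(ℝ, EM)]
  {A : LieAlgebroid EM M F E}
  {k : ℕ} {N : Type*} [TopologicalSpace N] [ChartedSpace (EuclideanSpace ℝ (Fin k)) N]
  [IsManifold (𝓡 k) ∞ N]

/-- The first variation of the defect at `f` is the defect at `ρ(u) f`, and that of the defect at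
`α` is the defect at `L_u α`. Both are taken at the initial field, so only `Ψ 0` has to be a
morphism. -/
theorem LieAlgebroid.preservesMorphisms (u : A.Sec) : A.PreservesMorphisms k N u := by
  intro Ψ hΨ hmor
  constructor
  · intro f z X
    have hsm : ContMDiff (𝓘(ℝ, ℝ).prod (𝓡 k)) 𝓘(ℝ, ℝ) ∞
        (fun r : ℝ × N => f ((Ψ r.1).base r.2)) :=
      (f.contMDiff.comp ((contMDiff_proj E).comp hΨ.1)).comp
        (contMDiff_fst.prodMk ((contMDiff_zeroSection ℝ (TangentSpace (𝓡 k))).comp contMDiff_snd))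
    have h1 := hasDerivAt_dirDeriv hsm 0 z X
    have h1' : (fun w => deriv (fun t => f ((Ψ t).base w)) 0) =
        fun w => anchorDeriv u f ((Ψ 0).base w) := funext fun w => by
      have := hΨ.hasDerivAt (q := fun e => f e.1) (f.contMDiff.comp (contMDiff_proj E)) ⟨w, 0⟩
      rw [lieDeriv_basic] at this
      exact this.deriv
    have h2 := hΨ.hasDerivAt (isOneForm_dFunction (A := A) f) ⟨z, X⟩
    have h2' := lieOneForm_dFunction u f ((Ψ 0).base z) ((Ψ 0).fiber z X)
    have h3 := hmor.1 (anchorDeriv u f) z X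
    refine (h1.sub h2).congr_deriv ?_
    refine Eq.trans ?_ h3
    refine congrArg₂ (· - ·) (congrArg (fun f => dirDeriv (𝓡 k) f z X) h1') h2'
  · intro α X Y z hα
    have h3 := hmor.2 (lieOneForm u hα) X Y z (isOneForm_lieOneForm u hα)
    refine ((((hΨ.hasDerivAt_dirDeriv_oneForm hα Y z (X z)).sub
      (hΨ.hasDerivAt_dirDeriv_oneForm hα X z (Y z))).sub
      (hΨ.hasDerivAt hα ⟨z, VectorField.mlieBracket (𝓡 k) X Y z⟩)).sub
      (hΨ.hasDerivAt_dOneForm hα z (X z) (Y z))).congr_deriv ?_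
    exact h3

end Preserves

/-! ### Traces of quadratic forms -/

section Trace

/-- A change of basis `C` turns `g⁻¹ Bᵀ` into a conjugate by `C`, and the trace does not see it. -/
theorem sum_inv_toMatrix_mul_eq {V ι : Type*} [AddCommGroup V] [Module ℝ V] [Fintype ι]
    [DecidableEq ι] (b c : Module.Basis ι ℝ V) (g B : LinearMap.BilinForm ℝ V) :
    ∑ i, ∑ j, (LinearMap.BilinForm.toMatrix b g)⁻¹ i j * B (b i) (b j) =
      ∑ i, ∑ j, (LinearMap.BilinForm.toMatrix c g)⁻¹ i j * B (c i) (c j) := by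
  have key : ∀ d : Module.Basis ι ℝ V,
      ∑ i, ∑ j, (LinearMap.BilinForm.toMatrix d g)⁻¹ i j * B (d i) (d j) =
      ((LinearMap.BilinForm.toMatrix d g)⁻¹ *
        (LinearMap.BilinForm.toMatrix d B).transpose).trace := by
    intro d
    simp only [Matrix.trace, Matrix.diag, Matrix.mul_apply, Matrix.transpose_apply,
      LinearMap.BilinForm.toMatrix_apply]
  rw [key b, key c]
  set C := b.toMatrix c with hC
  set C' := c.toMatrix b with hC'
  have h1 : C * C' = 1 := b.toMatrix_mul_toMatrix_flip c
  have hinv : C⁻¹ = C' := Matrix.inv_eq_right_inv h1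
  have hinvT : C.transpose⁻¹ = C'.transpose := by rw [← Matrix.transpose_nonsing_inv, hinv]
  rw [← LinearMap.BilinForm.toMatrix_mul_basis_toMatrix (b := b) (c := c) g,
    ← LinearMap.BilinForm.toMatrix_mul_basis_toMatrix (b := b) (c := c) B, ← hC,
    Matrix.mul_inv_rev, Matrix.mul_inv_rev, hinv, hinvT, Matrix.transpose_mul,
    Matrix.transpose_mul, Matrix.transpose_transpose]
  have h3 : C' * ((LinearMap.BilinForm.toMatrix b g)⁻¹ * C'.transpose) *
      (C.transpose * ((LinearMap.BilinForm.toMatrix b B).transpose * C)) =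
      C' * (((LinearMap.BilinForm.toMatrix b g)⁻¹ *
        (LinearMap.BilinForm.toMatrix b B).transpose) * C) := by
    have : C'.transpose * C.transpose = 1 := by
      rw [← Matrix.transpose_mul, h1, Matrix.transpose_one]
    simp only [Matrix.mul_assoc]
    rw [← Matrix.mul_assoc C'.transpose, this, Matrix.one_mul]
  rw [h3, Matrix.trace_mul_comm C', Matrix.mul_assoc, h1, Matrix.mul_one]

variable {k : ℕ} {N : Type*} [TopologicalSpace N] [ChartedSpace (EuclideanSpace ℝ (Fin k)) N]
  [IsManifold (𝓡 k) ∞ N]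
  (g : ContMDiffRiemannianMetric (𝓡 k) ∞ (EuclideanSpace ℝ (Fin k))
      (TangentSpace (𝓡 k) : N → Type _))

/-- The Riemannian metric on one tangent space as a bilinear form. -/
def metricForm (z : N) : LinearMap.BilinForm ℝ (TangentSpace (𝓡 k) z) :=
  LinearMap.mk₂ ℝ (fun X Y => g.inner z X Y)
    (fun X X' Y => by rw [map_add]; rfl) (fun c X Y => by rw [map_smul]; rfl)
    (fun X Y Y' => map_add _ _ _) (fun c X Y => map_smul _ _ _)

/-- The coordinate basis of a tangent space. -/
def coordBasis (z : N) : Module.Basis (Fin k) ℝ (TangentSpace (𝓡 k) z) :=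
  (EuclideanSpace.basisFun (Fin k) ℝ).toBasis

theorem toMatrix_metricForm {z : N} (b : Module.Basis (Fin k) ℝ (TangentSpace (𝓡 k) z)) :
    LinearMap.BilinForm.toMatrix b (metricForm g z) = gramMatrix g z b := by
  ext i j
  rw [LinearMap.BilinForm.toMatrix_apply]
  rfl

/-- The coordinate basis in the definition of the trace belongs to the preferred chart at `z` and
may jump with `z`. Passing to an arbitrary basis allows smooth frames, in which continuity can be
read off. -/
theorem metricTrace_eq (z : N) (B : LinearMap.BilinForm ℝ (TangentSpace (𝓡 k) z))
    (hB : ∀ X Y, B X Y = B Y X) (c : Module.Basis (Fin k) ℝ (TangentSpace (𝓡 k) z)) :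
    metricTrace g z (fun X => B X X) =
      ∑ i, ∑ j, (gramMatrix g z c)⁻¹ i j * B (c i) (c j) := by
  rw [← toMatrix_metricForm, ← sum_inv_toMatrix_mul_eq (coordBasis z) c, toMatrix_metricForm]
  have h : (fun i => EuclideanSpace.basisFun (Fin k) ℝ i : Fin k → TangentSpace (𝓡 k) z) =
      coordBasis z := by
    funext i
    exact (congrFun (EuclideanSpace.basisFun (Fin k) ℝ).coe_toBasis i).symm
  unfold metricTrace
  rw [h]
  refine Finset.sum_congr rfl fun i _ => Finset.sum_congr rfl fun j _ => ?_
  congr 1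
  simp only [map_add, LinearMap.add_apply]
  rw [hB (coordBasis z j) (coordBasis z i)]
  ring

theorem posDef_gramMatrix {z : N} {b : Fin k → TangentSpace (𝓡 k) z}
    (hb : LinearIndependent ℝ b) : (gramMatrix g z b).PosDef := by
  refine Matrix.PosDef.of_dotProduct_mulVec_pos ?_ ?_
  · ext i j
    simp only [Matrix.conjTranspose_apply, gramMatrix, Matrix.of_apply, star_trivial]
    exact g.symm z _ _
  · intro x hx
    have h1 : ∑ i, x i • b i ≠ 0 := by
      intro h
      exact hx (funext (Fintype.linearIndependent_iff.1 hb x h))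
    have h2 := g.pos z _ h1
    have h3 : star x ⬝ᵥ (gramMatrix g z b).mulVec x =
        metricForm g z (∑ i, x i • b i) (∑ i, x i • b i) := by
      simp only [map_sum, LinearMap.sum_apply, map_smul, LinearMap.smul_apply, dotProduct,
        Matrix.mulVec, gramMatrix, Matrix.of_apply, star_trivial, smul_eq_mul, Finset.mul_sum]
      rw [Finset.sum_comm]
      refine Finset.sum_congr rfl fun i _ => Finset.sum_congr rfl fun j _ => ?_
      change _ = x i * (x j * g.inner z (b j) (b i))
      ring
    rw [h3]
    exact h2

theorem det_gramMatrix_pos {z : N} {b : Fin k → TangentSpace (𝓡 k) z}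
    (hb : LinearIndependent ℝ b) : 0 < (gramMatrix g z b).det := (posDef_gramMatrix g hb).det_pos

/-- The trace is the quadratic form of the inverse Gram matrix on the components of `l`, that is,
the squared length of the covector. -/
theorem metricTrace_mul_sq_pos {z : N} (l : TangentSpace (𝓡 k) z →ₗ[ℝ] ℝ) (hl : l ≠ 0) :
    0 < metricTrace g z fun X => l X * l X := by
  have h := metricTrace_eq g z (LinearMap.mk₂ ℝ (fun X Y => l X * l Y)
    (fun X X' Y => by rw [map_add, add_mul]) (fun c X Y => by simp [mul_assoc])
    (fun X Y Y' => by rw [map_add, mul_add]) (fun c X Y => by simp [mul_left_comm]))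
    (fun X Y => mul_comm _ _) (coordBasis z)
  have hx : (fun i => l (coordBasis z i)) ≠ 0 := by
    intro h0
    exact hl ((coordBasis z).ext fun i => congrFun h0 i)
  have hp := (posDef_gramMatrix g (coordBasis z).linearIndependent).inv.dotProduct_mulVec_pos hx
  simp only [LinearMap.mk₂_apply] at h
  rw [h]
  refine lt_of_lt_of_eq hp ?_
  simp only [dotProduct, Matrix.mulVec, star_trivial, Finset.mul_sum]
  refine Finset.sum_congr rfl fun i _ => Finset.sum_congr rfl fun j _ => ?_
  ring

variable [T2Space N] [SigmaCompactSpace N]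

theorem continuousAt_gramMatrix {Q : Type*} [TopologicalSpace Q]
    {V H : Type*} [NormedAddCommGroup V] [NormedSpace ℝ V] [TopologicalSpace H]
    {I : ModelWithCorners ℝ V H} [ChartedSpace H Q] {b : Q → N}
    {X : Fin k → ∀ q, TangentSpace (𝓡 k) (b q)} {q : Q}
    (hX : ∀ i, ContMDiffAt I (𝓡 k).tangent ∞ (fun q => (⟨b q, X i q⟩ : TangentBundle (𝓡 k) N)) q) :
    ContinuousAt (fun q => gramMatrix g (b q) (fun i => X i q)) q := by
  refine continuousAt_pi.2 fun i => continuousAt_pi.2 fun j => ?_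
  exact (g.contMDiffAt_inner (hX i) (hX j)).continuousAt

/-- Near every point the tangent bundle is framed by global vector fields. -/
theorem exists_frame_tangent (z₀ : N) :
    ∃ X : Fin k → Cₛ^∞⟮𝓡 k; EuclideanSpace ℝ (Fin k), (TangentSpace (𝓡 k) : N → Type _)⟯,
      ∀ᶠ z in 𝓝 z₀, LinearIndependent ℝ (fun i => X i z) := by
  obtain ⟨s, θ, -, hs⟩ := exists_frame (EM := EuclideanSpace ℝ (Fin k))
    (F := EuclideanSpace ℝ (Fin k)) (E := (TangentSpace (𝓡 k) : N → Type _)) z₀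
  let e : Fin k ≃ Fin (Module.finrank ℝ (EuclideanSpace ℝ (Fin k))) :=
    finCongr (by simp)
  refine ⟨fun i => s (e i), ?_⟩
  filter_upwards [hs] with z hz
  rw [Fintype.linearIndependent_iff]
  intro c hc i
  have h := congrArg (θ (e i) z) hc
  rw [map_sum, map_zero] at h
  have h' : ∀ j, θ (e i) z (c j • s (e j) z) = if i = j then c j else 0 := by
    intro j
    rw [map_smul, hz.2, smul_eq_mul]
    by_cases hij : i = j <;> simp [hij]
  rw [Finset.sum_congr rfl fun j _ => h' j] at h
  simpa using h

end Trace

/-! ### The Lagrangian density of a smooth family of fields -/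

section Lagrangian

variable {EM : Type*} [NormedAddCommGroup EM] [NormedSpace ℝ EM] [FiniteDimensional ℝ EM]
  {M : Type*} [TopologicalSpace M] [ChartedSpace EM M] [IsManifold 𝓘(ℝ, EM) ∞ M]
  [T2Space M] [SigmaCompactSpace M]
  {F : Type*} [NormedAddCommGroup F] [NormedSpace ℝ F] [FiniteDimensional ℝ F]
  {E : M → Type*} [∀ x, AddCommGroup (E x)] [∀ x, Module ℝ (E x)]
  [∀ x, TopologicalSpace (E x)] [∀ x, IsTopologicalAddGroup (E x)]
  [∀ x, ContinuousConstSMul ℝ (E x)] [TopologicalSpace (TotalSpace F E)]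
  [FiberBundle F E] [VectorBundle ℝ F E] [ContMDiffVectorBundle ∞ F E 𝓘(ℝ, EM)]
  {A : LieAlgebroid EM M F E} (G : ContMDiffRiemannianMetric 𝓘(ℝ, EM) ∞ F E)
  {k : ℕ} {N : Type*} [TopologicalSpace N] [ChartedSpace (EuclideanSpace ℝ (Fin k)) N]
  [IsManifold (𝓡 k) ∞ N]
  (g : ContMDiffRiemannianMetric (𝓡 k) ∞ (EuclideanSpace ℝ (Fin k))
      (TangentSpace (𝓡 k) : N → Type _))

namespace BundleMap

/-- The pullback of the metric of `E` to `T_z N`. -/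
def pullbackForm (Φ : BundleMap EM F E k N) (z : N) :
    LinearMap.BilinForm ℝ (TangentSpace (𝓡 k) z) :=
  LinearMap.mk₂ ℝ (fun X Y => G.inner (Φ.base z) (Φ.fiber z X) (Φ.fiber z Y))
    (fun X X' Y => by rw [map_add, map_add]; rfl) (fun c X Y => by rw [map_smul, map_smul]; rfl)
    (fun X Y Y' => by rw [map_add, map_add]) (fun c X Y => by rw [map_smul, map_smul])

theorem pullbackTrace_eq (Φ : BundleMap EM F E k N) {z : N} {b : Fin k → TangentSpace (𝓡 k) z}
    (hb : LinearIndependent ℝ b) :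
    Φ.pullbackTrace g (metricFunction G) z = ∑ i, ∑ j, (gramMatrix g z b)⁻¹ i j *
      G.inner (Φ.base z) (Φ.fiber z (b i)) (Φ.fiber z (b j)) := by
  have hfd : FiniteDimensional ℝ (TangentSpace (𝓡 k) z) := (coordBasis z).finiteDimensional_of_finite
  let c : Module.Basis (Fin k) ℝ (TangentSpace (𝓡 k) z) :=
    basisOfLinearIndependentOfCardEqFinrank' b hb
      (Module.finrank_eq_card_basis (coordBasis z)).symm
  have hc : (c : Fin k → TangentSpace (𝓡 k) z) = b :=
    coe_basisOfLinearIndependentOfCardEqFinrank' _ _ _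
  have h := metricTrace_eq g z (Φ.pullbackForm G z) (fun X Y => G.symm _ _ _) c
  rw [hc] at h
  exact h

variable [T2Space N] [SigmaCompactSpace N]

/-- Near every point the Lagrangian density is a combination of products of smooth functions of the
field with continuous coefficients. -/
theorem exists_pullbackTrace_eq_sum (z₀ : N) :
    ∃ (X : Fin k → Cₛ^∞⟮𝓡 k; EuclideanSpace ℝ (Fin k), (TangentSpace (𝓡 k) : N → Type _)⟯)
      (c : Fin k → Fin k → N → ℝ), (∀ i j, ContinuousAt (c i j) z₀) ∧
      ∀ᶠ z in 𝓝 z₀, ∀ Φ : BundleMap EM F E k N,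
        Φ.pullbackTrace g (metricFunction G) z =
          ∑ i, ∑ j, c i j z * G.inner (Φ.base z) (Φ.fiber z (X i z)) (Φ.fiber z (X j z)) := by
  obtain ⟨X, hX⟩ := exists_frame_tangent (k := k) z₀
  -- The coefficients are the entries of the inverse Gram matrix of a smooth frame; they are
  -- continuous because its determinant is positive.
  refine ⟨X, fun i j z => (gramMatrix g z fun i => X i z)⁻¹ i j, fun i j => ?_, ?_⟩
  · have h1 := continuousAt_gramMatrix g (b := fun z => z) (X := fun i z => X i z)
      fun i => (X i).contMDiff.contMDiffAt (x := z₀)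
    have h2 : ContinuousAt Inv.inv (gramMatrix g z₀ fun i => X i z₀) := by
      refine continuousAt_matrix_inv _ ?_
      rw [Ring.inverse_eq_inv']
      exact continuousAt_inv₀ (det_gramMatrix_pos g hX.self_of_nhds).ne'
    exact continuousAt_pi.1 (continuousAt_pi.1 (ContinuousAt.comp (x := z₀) h2 h1) i) j
  · filter_upwards [hX] with z hz Φ
    exact Φ.pullbackTrace_eq G g hz

end BundleMap

variable [T2Space N] [SigmaCompactSpace N]
  {Ψ : ℝ → BundleMap EM F E k N}
  (hΨ : ContMDiff (𝓘(ℝ, ℝ).prod (𝓡 k).tangent) (𝓘(ℝ, EM).prod 𝓘(ℝ, F)) ∞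
    (fun r : ℝ × TangentBundle (𝓡 k) N => (Ψ r.1).toMap r.2))

include hΨ in
theorem contMDiff_inner_family
    (X Y : Cₛ^∞⟮𝓡 k; EuclideanSpace ℝ (Fin k), (TangentSpace (𝓡 k) : N → Type _)⟯) :
    ContMDiff (𝓘(ℝ, ℝ).prod (𝓡 k)) 𝓘(ℝ, ℝ) ∞ (fun r : ℝ × N =>
      G.inner ((Ψ r.1).base r.2) ((Ψ r.1).fiber r.2 (X r.2)) ((Ψ r.1).fiber r.2 (Y r.2))) :=
  fun r => G.contMDiffAt_inner
    ((hΨ.comp (contMDiff_fst.prodMk (X.contMDiff.comp contMDiff_snd))) r)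
    ((hΨ.comp (contMDiff_fst.prodMk (Y.contMDiff.comp contMDiff_snd))) r)

include hΨ in
theorem continuous_pullbackTrace_family :
    Continuous fun r : ℝ × N => (Ψ r.1).pullbackTrace g (metricFunction G) r.2 := by
  refine continuous_iff_continuousAt.2 fun r => ?_
  obtain ⟨X, c, hc, hev⟩ := BundleMap.exists_pullbackTrace_eq_sum (EM := EM) G g r.2
  have h1 : ContinuousAt (fun r : ℝ × N => ∑ i, ∑ j, c i j r.2 *
      G.inner ((Ψ r.1).base r.2) ((Ψ r.1).fiber r.2 (X i r.2)) ((Ψ r.1).fiber r.2 (X j r.2))) r := by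
    refine tendsto_finsetSum _ fun i _ => tendsto_finsetSum _ fun j _ => Filter.Tendsto.mul ?_ ?_
    · exact ContinuousAt.comp (x := r) (hc i j) continuousAt_snd
    · exact (contMDiff_inner_family G hΨ (X i) (X j)).continuous.continuousAt
  refine h1.congr ?_
  filter_upwards [continuousAt_snd.eventually hev] with r' hr'
  exact (hr' _).symm

-- The formula for the derivative holds for all `z` near `z₀` and all `t`, while its continuity is
-- claimed only over `z₀`. Letting `z₀` vary, this gives joint continuity of the derivative.
include hΨ in
theorem hasDerivAt_pullbackTrace_family_aux (z₀ : N) :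
    ∃ D : ℝ × N → ℝ, (∀ t, ContinuousAt D (t, z₀)) ∧ ∀ᶠ z in 𝓝 z₀, ∀ t,
      HasDerivAt (fun s => (Ψ s).pullbackTrace g (metricFunction G) z) (D (t, z)) t := by
  obtain ⟨X, c, hc, hev⟩ := BundleMap.exists_pullbackTrace_eq_sum (EM := EM) G g z₀
  have hB := fun i j => contMDiff_inner_family G hΨ (X i) (X j)
  refine ⟨fun r => ∑ i, ∑ j, c i j r.2 * deriv (fun s => G.inner ((Ψ s).base r.2)
    ((Ψ s).fiber r.2 (X i r.2)) ((Ψ s).fiber r.2 (X j r.2))) r.1, fun t => ?_, ?_⟩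
  · refine tendsto_finsetSum _ fun i _ => tendsto_finsetSum _ fun j _ => Filter.Tendsto.mul ?_ ?_
    · exact ContinuousAt.comp (x := (t, z₀)) (hc i j) continuousAt_snd
    · exact (contMDiff_deriv_fst (hB i j)).continuous.continuousAt
  · filter_upwards [hev] with z hz t
    have h1 : (fun s => (Ψ s).pullbackTrace g (metricFunction G) z) = fun s => ∑ i, ∑ j, c i j z *
        G.inner ((Ψ s).base z) ((Ψ s).fiber z (X i z)) ((Ψ s).fiber z (X j z)) :=
      funext fun s => hz (Ψ s)
    rw [h1]
    refine HasDerivAt.fun_sum fun i _ => HasDerivAt.fun_sum fun j _ => HasDerivAt.const_mul _ ?_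
    exact (deriv_eq_dirDeriv (hB i j) t z).differentiableAt.hasDerivAt

include hΨ in
theorem differentiableAt_pullbackTrace_family (t : ℝ) (z : N) :
    DifferentiableAt ℝ (fun s => (Ψ s).pullbackTrace g (metricFunction G) z) t := by
  obtain ⟨D, -, hev⟩ := hasDerivAt_pullbackTrace_family_aux G g hΨ z
  exact (hev.self_of_nhds t).differentiableAt

include hΨ in
theorem continuous_deriv_pullbackTrace_family :
    Continuous fun r : ℝ × N =>
      deriv (fun s => (Ψ s).pullbackTrace g (metricFunction G) r.2) r.1 := by
  refine continuous_iff_continuousAt.2 fun r => ?_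
  obtain ⟨D, hD, hev⟩ := hasDerivAt_pullbackTrace_family_aux G g hΨ r.2
  refine (hD r.1).congr ?_
  filter_upwards [continuousAt_snd.eventually hev] with r' hr'
  exact (hr' r'.1).deriv.symm

/-- The first variation of the Lagrangian density. -/
theorem LieAlgebroid.hasVariation_pullbackTrace (u : A.Sec) (z : N) : A.HasVariation u
    (fun Φ : BundleMap EM F E k N => Φ.pullbackTrace g (metricFunction G) z)
    (fun Φ => Φ.pullbackTrace g (A.lieDeriv u (metricFunction G)) z) := by
  intro Ψ hΨ
  have h := fun X : TangentSpace (𝓡 k) z =>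
    hΨ.hasDerivAt (contMDiff_metricFunction G) ⟨z, X⟩
  simp only [BundleMap.pullbackTrace, metricTrace]
  exact HasDerivAt.fun_sum fun i _ => HasDerivAt.fun_sum fun j _ => HasDerivAt.const_mul _
    ((((h _).sub (h _)).sub (h _)).div_const 2)

end Lagrangian

/-! ### The Riemannian volume -/

section Volume

variable {k : ℕ} {N : Type*} [TopologicalSpace N] [ChartedSpace (EuclideanSpace ℝ (Fin k)) N]
  [IsManifold (𝓡 k) ∞ N]
  (g : ContMDiffRiemannianMetric (𝓡 k) ∞ (EuclideanSpace ℝ (Fin k))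
      (TangentSpace (𝓡 k) : N → Type _))

/-- The field is the tangent map of the inverse chart applied to a constant field. -/
theorem contMDiffAt_coordField {c : N} {y : EuclideanSpace ℝ (Fin k)}
    (hy : y ∈ (chartAt (EuclideanSpace ℝ (Fin k)) c).target) (X : EuclideanSpace ℝ (Fin k)) :
    ContMDiffAt (𝓡 k) (𝓡 k).tangent ∞
      (fun y => (⟨(chartAt (EuclideanSpace ℝ (Fin k)) c).symm y,
        mfderiv (𝓡 k) (𝓡 k) (chartAt (EuclideanSpace ℝ (Fin k)) c).symm y X⟩ :
          TangentBundle (𝓡 k) N)) y := by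
  set ψ := (chartAt (EuclideanSpace ℝ (Fin k)) c).symm with hψ
  have ho : IsOpen (chartAt (EuclideanSpace ℝ (Fin k)) c).target :=
    (chartAt (EuclideanSpace ℝ (Fin k)) c).open_target
  have h1 : ContMDiffOn (𝓡 k).tangent (𝓡 k).tangent ∞
      (tangentMapWithin (𝓡 k) (𝓡 k) ψ (chartAt (EuclideanSpace ℝ (Fin k)) c).target)
      (TotalSpace.proj ⁻¹' (chartAt (EuclideanSpace ℝ (Fin k)) c).target) :=
    ContMDiffOn.contMDiffOn_tangentMapWithin (contMDiffOn_chart_symm (I := 𝓡 k) (n := ∞) (x := c))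
      (by simp) ho.uniqueMDiffOn
  have h2 : ContMDiff (𝓡 k) (𝓡 k).tangent ∞ (fun y : EuclideanSpace ℝ (Fin k) =>
      (⟨y, X⟩ : TangentBundle (𝓡 k) (EuclideanSpace ℝ (Fin k)))) := by
    intro y
    rw [contMDiffAt_totalSpace]
    refine ⟨contMDiffAt_id, ?_⟩
    refine (contMDiffAt_const (c := X)).congr_of_eventuallyEq ?_
    filter_upwards with y
    simp
  have h3 := ((h1.contMDiffAt ((ho.preimage
    (FiberBundle.continuous_proj (EuclideanSpace ℝ (Fin k)) _)).mem_nhds hy)).comp y (h2 y) :)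
  refine h3.congr_of_eventuallyEq ?_
  filter_upwards [ho.mem_nhds hy] with y' hy'
  refine congrArg (TotalSpace.mk (ψ y')) ?_
  rw [mfderivWithin_of_isOpen ho hy']

theorem linearIndependent_coordField {c : N} {y : EuclideanSpace ℝ (Fin k)}
    (hy : y ∈ (chartAt (EuclideanSpace ℝ (Fin k)) c).target) :
    LinearIndependent ℝ fun i : Fin k => mfderiv (𝓡 k) (𝓡 k)
      (chartAt (EuclideanSpace ℝ (Fin k)) c).symm y (EuclideanSpace.basisFun (Fin k) ℝ i) := by
  have hinj : Function.Injective (mfderiv (𝓡 k) (𝓡 k)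
      (chartAt (EuclideanSpace ℝ (Fin k)) c).symm y) :=
    (mdifferentiable_chart c).symm.mfderiv_injective hy
  exact (EuclideanSpace.basisFun (Fin k) ℝ).toBasis.linearIndependent.map'
    (mfderiv (𝓡 k) (𝓡 k) (chartAt (EuclideanSpace ℝ (Fin k)) c).symm y).toLinearMap
    (LinearMap.ker_eq_bot.2 hinj)

variable [T2Space N] [SigmaCompactSpace N]

/-- The density of the Riemannian measure in the chart at `c`. -/
def chartDensity (c : N) (y : EuclideanSpace ℝ (Fin k)) : ℝ :=
  Real.sqrt (gramMatrix g ((chartAt (EuclideanSpace ℝ (Fin k)) c).symm y) fun i =>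
    mfderiv (𝓡 k) (𝓡 k) (chartAt (EuclideanSpace ℝ (Fin k)) c).symm y
      (EuclideanSpace.basisFun (Fin k) ℝ i)).det

theorem continuousAt_chartDensity {c : N} {y : EuclideanSpace ℝ (Fin k)}
    (hy : y ∈ (chartAt (EuclideanSpace ℝ (Fin k)) c).target) :
    ContinuousAt (chartDensity g c) y := by
  have h1 := continuousAt_gramMatrix g (b := (chartAt (EuclideanSpace ℝ (Fin k)) c).symm)
    (X := fun i y => mfderiv (𝓡 k) (𝓡 k) (chartAt (EuclideanSpace ℝ (Fin k)) c).symm y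
      (EuclideanSpace.basisFun (Fin k) ℝ i)) (q := y)
    fun i => contMDiffAt_coordField hy (EuclideanSpace.basisFun (Fin k) ℝ i)
  have hd : Continuous fun a : Matrix (Fin k) (Fin k) ℝ => a.det := continuous_id.matrix_det
  exact Real.continuous_sqrt.continuousAt.comp (hd.continuousAt.comp h1)

theorem chartDensity_pos {c : N} {y : EuclideanSpace ℝ (Fin k)}
    (hy : y ∈ (chartAt (EuclideanSpace ℝ (Fin k)) c).target) : 0 < chartDensity g c y :=
  Real.sqrt_pos.2 (det_gramMatrix_pos g (linearIndependent_coordField hy))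

variable [MeasurableSpace N] [BorelSpace N]

theorem aemeasurable_chartDensity (c : N) :
    AEMeasurable (fun y => ENNReal.ofReal (chartDensity g c y))
      (volume.restrict (chartAt (EuclideanSpace ℝ (Fin k)) c).target) :=
  (ContinuousOn.aemeasurable (fun _ hy => (continuousAt_chartDensity g hy).continuousWithinAt)
    (chartAt (EuclideanSpace ℝ (Fin k)) c).open_target.measurableSet).ennreal_ofReal

theorem chartVolume_apply (c : N) {s : Set N} (hs : MeasurableSet s) :
    chartVolume g c s = ((volume.restrict (chartAt (EuclideanSpace ℝ (Fin k)) c).target).withDensity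
      fun y => ENNReal.ofReal (chartDensity g c y))
        ((chartAt (EuclideanSpace ℝ (Fin k)) c).symm ⁻¹' s) := by
  have h : AEMeasurable (chartAt (EuclideanSpace ℝ (Fin k)) c).symm
      ((volume.restrict (chartAt (EuclideanSpace ℝ (Fin k)) c).target).withDensity
      fun y => ENNReal.ofReal (chartDensity g c y)) :=
    (ContinuousOn.aemeasurable (chartAt (EuclideanSpace ℝ (Fin k)) c).continuousOn_symm
      (chartAt (EuclideanSpace ℝ (Fin k)) c).open_target.measurableSet).mono_ac
      (withDensity_absolutelyContinuous _ _)
  exact Measure.map_apply_of_aemeasurable h hs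

/-- The density is continuous, hence bounded on a small coordinate ball, and the ball has finite
Lebesgue measure. -/
theorem exists_chartVolume_lt_top {c z : N} (hz : z ∈ (chartAt (EuclideanSpace ℝ (Fin k)) c).source) :
    ∃ W, IsOpen W ∧ z ∈ W ∧ chartVolume g c W < ⊤ := by
  set φ := chartAt (EuclideanSpace ℝ (Fin k)) c with hφ
  have h1 : ∀ᶠ y in 𝓝 (φ z), chartDensity g c y < chartDensity g c (φ z) + 1 :=
    (continuousAt_chartDensity g (φ.map_source hz)).eventually (gt_mem_nhds (by linarith))
  obtain ⟨r, hr, hb⟩ := Metric.eventually_nhds_iff_ball.1 h1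
  set W : Set N := φ.source ∩ φ ⁻¹' Metric.ball (φ z) r with hW
  have hWo : IsOpen W := φ.isOpen_inter_preimage Metric.isOpen_ball
  refine ⟨W, hWo, ⟨hz, Metric.mem_ball_self hr⟩, ?_⟩
  rw [chartVolume_apply g c hWo.measurableSet]
  have hsub : φ.symm ⁻¹' W ∩ φ.target ⊆ Metric.ball (φ z) r := by
    rintro y ⟨⟨-, hy⟩, hyt⟩
    rwa [mem_preimage, φ.right_inv hyt] at hy
  set ν := (volume.restrict φ.target).withDensity fun y => ENNReal.ofReal (chartDensity g c y)
  -- Outside the target the inverse chart has no meaning, so the preimage of `W` may contain stray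
  -- points there; they carry no mass.
  have hac : ν (φ.target)ᶜ = 0 := by
    refine withDensity_absolutelyContinuous _ _ ?_
    rw [Measure.restrict_apply φ.open_target.measurableSet.compl, compl_inter_self, measure_empty]
  calc ν (φ.symm ⁻¹' W) ≤ ν (Metric.ball (φ z) r ∪ (φ.target)ᶜ) := measure_mono fun y hy => by
        by_cases hyt : y ∈ φ.target
        · exact Or.inl (hsub ⟨hy, hyt⟩)
        · exact Or.inr hyt
    _ ≤ ν (Metric.ball (φ z) r) + ν (φ.target)ᶜ := measure_union_le _ _
    _ = ν (Metric.ball (φ z) r) := by rw [hac, add_zero]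
    _ = ∫⁻ y in Metric.ball (φ z) r, ENNReal.ofReal (chartDensity g c y)
          ∂(volume.restrict φ.target) := withDensity_apply _ measurableSet_ball
    _ ≤ ∫⁻ y in Metric.ball (φ z) r, ENNReal.ofReal (chartDensity g c (φ z) + 1)
          ∂(volume.restrict φ.target) :=
        setLIntegral_mono measurable_const fun y hy => ENNReal.ofReal_le_ofReal (hb y hy).le
    _ = ENNReal.ofReal (chartDensity g c (φ z) + 1) *
          (volume.restrict φ.target) (Metric.ball (φ z) r) := setLIntegral_const _ _
    _ < ⊤ := by
        refine ENNReal.mul_lt_top ENNReal.ofReal_lt_top ?_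
        exact (Measure.restrict_le_self _).trans_lt measure_ball_lt_top

theorem chartVolume_pos {c : N} {U : Set N} (hU : IsOpen U)
    (hne : (U ∩ (chartAt (EuclideanSpace ℝ (Fin k)) c).source).Nonempty) :
    chartVolume g c U ≠ 0 := by
  set φ := chartAt (EuclideanSpace ℝ (Fin k)) c with hφ
  rw [chartVolume_apply g c hU.measurableSet]
  intro h
  rw [withDensity_apply_eq_zero' (aemeasurable_chartDensity g c)] at h
  have ho : IsOpen (φ.target ∩ φ.symm ⁻¹' U) := φ.symm.isOpen_inter_preimage hU
  obtain ⟨z, hzU, hz⟩ := hne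
  have hne' : (φ.target ∩ φ.symm ⁻¹' U).Nonempty :=
    ⟨φ z, φ.map_source hz, by rwa [mem_preimage, φ.left_inv hz]⟩
  refine (ho.measure_pos volume hne').ne' ?_
  have h2 : volume.restrict φ.target (φ.target ∩ φ.symm ⁻¹' U) = 0 := by
    refine measure_mono_null ?_ h
    rintro y ⟨hy, hyU⟩
    exact ⟨(ENNReal.ofReal_pos.2 (chartDensity_pos g hy)).ne', hyU⟩
  rwa [Measure.restrict_apply ho.measurableSet,
    inter_eq_left.2 (inter_subset_left (s := φ.target) (t := φ.symm ⁻¹' U))] at h2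

theorem chartPartition_isSubordinate :
    (chartPartition k N).IsSubordinate fun c => (chartAt (EuclideanSpace ℝ (Fin k)) c).source :=
  (SmoothPartitionOfUnity.exists_isSubordinate_chartAt_source (𝓡 k) N).choose_spec

theorem measurable_chartPartition (c : N) :
    Measurable fun z => ENNReal.ofReal (chartPartition k N c z) :=
  (chartPartition k N c).2.continuous.measurable.ennreal_ofReal

/-- Near `z` only finitely many terms of the glued sum are non-zero. Each is finite near `z`: either
`z` lies in the support of the partition function, hence in the chart, or the term vanishes around
`z`. Compact sets therefore have finite volume. -/
instance isLocallyFiniteMeasure_riemannianVolume :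
    IsLocallyFiniteMeasure (riemannianVolume g) where
  finiteAtNhds z := by
    obtain ⟨U, hU, hfin⟩ := (chartPartition k N).locallyFinite z
    have hW : ∀ c : N, ∃ W, IsOpen W ∧ z ∈ W ∧ (chartVolume g c).withDensity
        (fun z => ENNReal.ofReal (chartPartition k N c z)) W < ⊤ := by
      intro c
      by_cases hz : z ∈ tsupport (chartPartition k N c)
      · obtain ⟨W, hWo, hW, hlt⟩ :=
          exists_chartVolume_lt_top g (chartPartition_isSubordinate (k := k) c hz)
        refine ⟨W, hWo, hW, lt_of_le_of_lt ?_ hlt⟩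
        have hle : (chartVolume g c).withDensity
            (fun z => ENNReal.ofReal (chartPartition k N c z)) ≤
            (chartVolume g c).withDensity (fun _ => 1) :=
          withDensity_mono (Filter.Eventually.of_forall fun z =>
            ENNReal.ofReal_le_one.2 ((chartPartition k N).le_one c z))
        rw [show (fun _ : N => (1 : ENNReal)) = 1 from rfl, withDensity_one] at hle
        exact hle W
      · refine ⟨(tsupport (chartPartition k N c))ᶜ,
          (isClosed_tsupport _).isOpen_compl, hz, ?_⟩
        rw [withDensity_apply _ (isClosed_tsupport _).measurableSet.compl]
        refine lt_of_eq_of_lt (setLIntegral_eq_zero (isClosed_tsupport _).measurableSet.compl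
          fun y hy => ?_) ENNReal.zero_lt_top
        rw [image_eq_zero_of_notMem_tsupport hy, ENNReal.ofReal_zero]
        rfl
    choose W hWo hWz hWlt using hW
    set S := interior U ∩ ⋂ c ∈ hfin.toFinset, W c with hS
    have hSo : IsOpen S := isOpen_interior.inter (isOpen_biInter_finset fun c _ => hWo c)
    refine ⟨S, hSo.mem_nhds ⟨mem_interior_iff_mem_nhds.2 hU, mem_iInter₂.2 fun c _ => hWz c⟩, ?_⟩
    rw [riemannianVolume, Measure.sum_apply _ hSo.measurableSet,
      tsum_eq_sum (s := hfin.toFinset) fun c hc => ?_]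
    · exact ENNReal.sum_lt_top.2 fun c hc => (measure_mono (inter_subset_right.trans
        (biInter_subset_of_mem hc))).trans_lt (hWlt c)
    · rw [withDensity_apply _ hSo.measurableSet]
      refine setLIntegral_eq_zero hSo.measurableSet fun y hy => ?_
      have h0 : chartPartition k N c y = 0 := by
        by_contra hne
        exact hc (hfin.mem_toFinset.2 ⟨y, hne, interior_subset hy.1⟩)
      rw [h0, ENNReal.ofReal_zero]
      rfl

/-- Some partition function is positive at a point of `U`, and where it is positive the chart
measure has a positive density. This turns pointwise positivity into positivity of an integral in
the converse. -/
instance isOpenPosMeasure_riemannianVolume : (riemannianVolume g).IsOpenPosMeasure where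
  open_pos U hU hne := by
    obtain ⟨z, hz⟩ := hne
    obtain ⟨c, hc⟩ : ∃ c, 0 < chartPartition k N c z :=
      (chartPartition k N).exists_pos_of_mem (mem_univ z)
    intro h
    have h1 : (chartVolume g c).withDensity
        (fun z => ENNReal.ofReal (chartPartition k N c z)) U = 0 := by
      refine nonpos_iff_eq_zero.1 (le_trans ?_ h.le)
      rw [riemannianVolume, Measure.sum_apply _ hU.measurableSet]
      exact ENNReal.le_tsum c
    rw [withDensity_apply_eq_zero' (measurable_chartPartition c).aemeasurable] at h1
    have ho : IsOpen {z | 0 < chartPartition k N c z} :=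
      isOpen_lt continuous_const (chartPartition k N c).2.continuous
    refine chartVolume_pos g (ho.inter hU) ⟨z, ⟨hc, hz⟩, chartPartition_isSubordinate (k := k) c
      (subset_tsupport _ hc.ne')⟩ (measure_mono_null ?_ h1)
    rintro y ⟨hy, hyU⟩
    exact ⟨(ENNReal.ofReal_pos.2 hy).ne', hyU⟩

end Volume

/-! ### The first variation of the action -/

section Action

variable {EM : Type*} [NormedAddCommGroup EM] [NormedSpace ℝ EM] [FiniteDimensional ℝ EM]
  {M : Type*} [TopologicalSpace M] [ChartedSpace EM M] [IsManifold 𝓘(ℝ, EM) ∞ M]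
  [T2Space M] [SigmaCompactSpace M]
  {F : Type*} [NormedAddCommGroup F] [NormedSpace ℝ F] [FiniteDimensional ℝ F]
  {E : M → Type*} [∀ x, AddCommGroup (E x)] [∀ x, Module ℝ (E x)]
  [∀ x, TopologicalSpace (E x)] [∀ x, IsTopologicalAddGroup (E x)]
  [∀ x, ContinuousConstSMul ℝ (E x)] [TopologicalSpace (TotalSpace F E)]
  [FiberBundle F E] [VectorBundle ℝ F E] [ContMDiffVectorBundle ∞ F E 𝓘(ℝ, EM)]
  {A : LieAlgebroid EM M F E} (G : ContMDiffRiemannianMetric 𝓘(ℝ, EM) ∞ F E)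
  {k : ℕ} {N : Type*} [TopologicalSpace N] [ChartedSpace (EuclideanSpace ℝ (Fin k)) N]
  [IsManifold (𝓡 k) ∞ N] [T2Space N] [SigmaCompactSpace N] [MeasurableSpace N] [BorelSpace N]
  (g : ContMDiffRiemannianMetric (𝓡 k) ∞ (EuclideanSpace ℝ (Fin k))
      (TangentSpace (𝓡 k) : N → Type _))

/-- The derivative of the density is jointly continuous, hence bounded by a constant on `[-1, 1] ×
K`. On a set of finite volume this constant dominates. -/
theorem hasDerivAt_action_of_subset_isCompact {Ψ : ℝ → BundleMap EM F E k N}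
    (hΨ : ContMDiff (𝓘(ℝ, ℝ).prod (𝓡 k).tangent) (𝓘(ℝ, EM).prod 𝓘(ℝ, F)) ∞
      (fun r : ℝ × TangentBundle (𝓡 k) N => (Ψ r.1).toMap r.2))
    {D K : Set N} (hD : MeasurableSet D) (hK : IsCompact K) (hDK : D ⊆ K) :
    HasDerivAt (fun t => (Ψ t).action g G D)
      (∫ z in D, deriv (fun s => (Ψ s).pullbackTrace g (metricFunction G) z) 0
        ∂(riemannianVolume g)) 0 := by
  have hf := continuous_pullbackTrace_family G g hΨ
  have hf' := continuous_deriv_pullbackTrace_family G g hΨ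
  obtain ⟨b, hb⟩ := ((isCompact_Icc (a := (-1 : ℝ)) (b := 1)).prod hK).exists_bound_of_continuousOn
    hf'.continuousOn
  have hfin : riemannianVolume g D < ⊤ := (measure_mono hDK).trans_lt hK.measure_lt_top
  refine (hasDerivAt_integral_of_dominated_loc_of_deriv_le
    (F := fun t z => (Ψ t).pullbackTrace g (metricFunction G) z)
    (F' := fun t z => deriv (fun s => (Ψ s).pullbackTrace g (metricFunction G) z) t)
    (μ := (riemannianVolume g).restrict D) (bound := fun _ => b)
    (Icc_mem_nhds (by norm_num : (-1 : ℝ) < 0) (by norm_num : (0 : ℝ) < 1))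
    (Filter.Eventually.of_forall fun t => ?_) ?_ ?_ ?_ ?_ ?_).2
  · exact (hf.comp (continuous_const.prodMk continuous_id)).aestronglyMeasurable
  · exact ((hf.comp (continuous_const.prodMk continuous_id)).continuousOn.integrableOn_compact
      hK).mono_set hDK
  · exact (hf'.comp (continuous_const.prodMk continuous_id)).aestronglyMeasurable
  · exact (ae_restrict_iff' hD).2 (Filter.Eventually.of_forall fun z hz t ht =>
      hb (t, z) ⟨ht, hDK hz⟩)
  · exact integrableOn_const hfin.ne
  · exact Filter.Eventually.of_forall fun z t _ =>
      (differentiableAt_pullbackTrace_family G g hΨ t z).hasDerivAt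

theorem metricTrace_zero (z : N) : metricTrace g z (fun _ => 0) = 0 := by
  simp [metricTrace]

theorem BundleMap.pullbackTrace_eq_zero {Φ : BundleMap EM F E k N} {z : N} (h : Φ.fiber z = 0)
    {q : TotalSpace F E → ℝ} (hq : ∀ x, q ⟨x, 0⟩ = 0) : Φ.pullbackTrace g q z = 0 := by
  have h1 : (fun X => q (Φ.toMap ⟨z, X⟩)) = fun _ => 0 := funext fun X => by
    have : Φ.toMap ⟨z, X⟩ = ⟨Φ.base z, 0⟩ := by
      rw [BundleMap.toMap, h]
      rfl
    rw [this, hq]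
  exact (congrArg (metricTrace g z) h1).trans (metricTrace_zero g z)

namespace LieAlgebroid

theorem metricFunction_zero (x : M) : metricFunction G (⟨x, 0⟩ : TotalSpace F E) = 0 := by
  change G.inner x 0 0 = 0
  rw [map_zero]

theorem lieDeriv_metricFunction_zero (u : A.Sec) (x : M) :
    A.lieDeriv u (metricFunction G) (⟨x, 0⟩ : TotalSpace F E) = 0 := by
  have h := lieDeriv_metricFunction_smul G u 0 (⟨x, 0⟩ : TotalSpace F E)
  simpa using h

/-- The first variation of the action for fields which vanish outside a compact set. -/
theorem IsRedefinitionFamily.hasDerivAt_action {u : A.Sec} {Ψ : ℝ → BundleMap EM F E k N}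
    (hΨ : A.IsRedefinitionFamily u Ψ) {D C : Set N} (hD : MeasurableSet D) (hC : IsCompact C)
    (h : ∀ t, ∀ z ∈ D \ C, (Ψ t).fiber z = 0) :
    HasDerivAt (fun t => (Ψ t).action g G D)
      (∫ z in D, (Ψ 0).pullbackTrace g (A.lieDeriv u (metricFunction G)) z
        ∂(riemannianVolume g)) 0 := by
  -- Off `C` the field vanishes, and both `G` and `L_u G` are zero on the zero section; the
  -- integrals over `D` and `D ∩ C` agree.
  have h1 := hasDerivAt_action_of_subset_isCompact G g hΨ.1 (hD.inter hC.measurableSet) hC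
    inter_subset_right
  have hdiff : ∀ z ∈ D \ (D ∩ C), z ∈ D \ C := fun z hz => ⟨hz.1, fun hzC => hz.2 ⟨hz.1, hzC⟩⟩
  have h2 : (fun t => (Ψ t).action g G (D ∩ C)) = fun t => (Ψ t).action g G D := funext fun t =>
    (setIntegral_eq_of_subset_of_forall_sdiff_eq_zero hD inter_subset_left fun z hz =>
      BundleMap.pullbackTrace_eq_zero g (h t z (hdiff z hz)) (metricFunction_zero G)).symm
  have h3 : ∀ z, deriv (fun s => (Ψ s).pullbackTrace g (metricFunction G) z) 0 =
      (Ψ 0).pullbackTrace g (A.lieDeriv u (metricFunction G)) z := fun z =>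
    (hasVariation_pullbackTrace G g u z Ψ hΨ).deriv
  rw [h2] at h1
  refine h1.congr_deriv ?_
  simp only [h3]
  exact (setIntegral_eq_of_subset_of_forall_sdiff_eq_zero hD inter_subset_left fun z hz =>
    BundleMap.pullbackTrace_eq_zero g (h 0 z (hdiff z hz)) (lieDeriv_metricFunction_zero G u)).symm

theorem hasVariation_action (u : A.Sec) {D : Set N} (hD : IsCompact D) : A.HasVariation u
    (fun Φ : BundleMap EM F E k N => Φ.action g G D)
    (fun Φ => ∫ z in D, Φ.pullbackTrace g (A.lieDeriv u (metricFunction G)) z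
      ∂(riemannianVolume g)) := fun _ hΨ =>
  hΨ.hasDerivAt_action G g hD.measurableSet hD fun _ _ hz => absurd hz.1 hz.2

theorem IsKilling.leavesActionInvariant {u : A.Sec} (hu : A.IsKilling G u) {D : Set N}
    (hD : MeasurableSet D) : A.LeavesActionInvariant g G D u := by
  rintro Ψ hΨ - ⟨C, hC, h⟩
  refine (hΨ.hasDerivAt_action G g hD hC h).congr_deriv ?_
  have h1 : A.lieDeriv u (metricFunction G) = fun _ => 0 := funext hu
  rw [h1]
  have h2 : ∀ z, (Ψ 0).pullbackTrace g (fun _ => 0) z = 0 := metricTrace_zero g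
  simp only [h2, integral_zero]

end LieAlgebroid

end Action

/-! ### Smooth integral curves and bump functions -/

section Curves

variable {V H P : Type*} [NormedAddCommGroup V] [NormedSpace ℝ V] [TopologicalSpace H]
  {I : ModelWithCorners ℝ V H} [TopologicalSpace P] [ChartedSpace H P]

/-- Picard–Lindelöf provides a differentiable integral curve. In a chart it solves an equation with
smooth right-hand side, and bootstrapping makes it smooth. -/
theorem exists_smooth_integralCurve [IsManifold I ∞ P] [I.Boundaryless] [CompleteSpace V]
    {Z : ∀ p : P, TangentSpace I p}
    (hZ : ContMDiff I I.tangent ∞ (fun p => (⟨p, Z p⟩ : TangentBundle I P))) (p₀ : P) :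
    ∃ γ : ℝ → P, γ 0 = p₀ ∧ ∀ᶠ s in 𝓝 (0 : ℝ), ContMDiffAt 𝓘(ℝ, ℝ) I ∞ γ s ∧
      mfderiv 𝓘(ℝ, ℝ) I γ s (1 : ℝ) = Z (γ s) := by
  have : IsManifold I 1 P := IsManifold.of_le (n := ∞) (by simp)
  obtain ⟨γ, h0, hγ⟩ := exists_isMIntegralCurveAt_of_contMDiffAt_boundaryless (t₀ := 0)
    ((hZ p₀).of_le (by simp))
  refine ⟨γ, h0, ?_⟩
  let φ := extChartAt I p₀
  let z : V → V := fun y => mfderiv I 𝓘(ℝ, V) φ (φ.symm y) (Z (φ.symm y))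
  have hz : ContDiffOn ℝ ∞ z φ.target := by
    rw [← contMDiffOn_iff_contDiffOn]
    exact (contMDiffOn_mfderiv_extChartAt hZ p₀).comp (contMDiffOn_extChartAt_symm p₀)
      fun y hy => φ.map_target hy
  have hsrc : ∀ᶠ s in 𝓝 (0 : ℝ), γ s ∈ φ.source :=
    hγ.continuousAt.eventually ((isOpen_extChartAt_source p₀).mem_nhds
      (by rw [h0]; exact mem_extChartAt_source p₀))
  obtain ⟨ε, hε, hb⟩ := Metric.eventually_nhds_iff_ball.1 (hsrc.and hγ)
  -- Half the radius leaves room for a closed interval, on which the regularity bootstrap takes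
  -- place.
  have hmem : ∀ s ∈ Icc (-(ε / 2)) (ε / 2), s ∈ Metric.ball (0 : ℝ) ε := fun s hs => by
    rw [Metric.mem_ball, Real.dist_eq, sub_zero, abs_lt]
    exact ⟨by linarith [hs.1], by linarith [hs.2]⟩
  have hd : ∀ s ∈ Icc (-(ε / 2)) (ε / 2), HasDerivAt (fun s => φ (γ s)) (z (φ (γ s))) s := by
    intro s hs
    obtain ⟨h1, h2⟩ := hb s (hmem s hs)
    have h3 : HasMFDerivAt I 𝓘(ℝ, V) φ (γ s) (mfderiv I 𝓘(ℝ, V) φ (γ s)) :=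
      (mdifferentiableAt_extChartAt (by simpa [φ] using h1)).hasMFDerivAt
    let L : ℝ →L[ℝ] V := (mfderiv I 𝓘(ℝ, V) φ (γ s)).comp
      ((1 : ℝ →L[ℝ] ℝ).smulRight (Z (γ s)))
    have h4 : HasFDerivAt (fun s => φ (γ s)) L s := (h3.comp s h2).hasFDerivAt
    refine h4.hasDerivAt.congr_deriv ?_
    have h5 : z (φ (γ s)) = mfderiv I 𝓘(ℝ, V) φ (γ s) (Z (γ s)) := by
      let D : P → V := fun p => mfderiv I 𝓘(ℝ, V) φ p (Z p)
      exact congrArg D (φ.left_inv h1)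
    rw [h5]
    exact congrArg (mfderiv I 𝓘(ℝ, V) φ (γ s)) (one_smul ℝ (Z (γ s)))
  have hsm : ContDiffOn ℝ ∞ (fun s => φ (γ s)) (Icc (-(ε / 2)) (ε / 2)) :=
    ODE.contDiffOn_enat_Icc_of_hasDerivWithinAt (n := ⊤) (f := fun _ y => z y) (u := φ.target)
      (hz.comp contDiffOn_snd fun r hr => hr.2) (fun s hs => (hd s hs).hasDerivWithinAt)
      fun s hs => φ.map_source (hb s (hmem s hs)).1
  have hI : Ioo (-(ε / 2)) (ε / 2) ∈ 𝓝 (0 : ℝ) := Ioo_mem_nhds (by linarith) (by linarith)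
  filter_upwards [hI] with s hs
  have hs' : s ∈ Icc (-(ε / 2)) (ε / 2) := Ioo_subset_Icc_self hs
  obtain ⟨h1, h2⟩ := hb s (hmem s hs')
  refine ⟨?_, ?_⟩
  · have h3 : ContMDiffAt 𝓘(ℝ, ℝ) 𝓘(ℝ, V) ∞ (fun s => φ (γ s)) s :=
      (hsm.contDiffAt (Icc_mem_nhds hs.1 hs.2)).contMDiffAt
    have h4 : ContMDiffAt 𝓘(ℝ, V) I ∞ φ.symm (φ (γ s)) :=
      (contMDiffOn_extChartAt_symm (I := I) (n := ∞) p₀).contMDiffAt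
        ((isOpen_extChartAt_target p₀).mem_nhds (φ.map_source h1))
    refine (h4.comp s h3).congr_of_eventuallyEq ?_
    filter_upwards [Ioo_mem_nhds hs.1 hs.2] with r hr
    exact (φ.left_inv (hb r (hmem r (Ioo_subset_Icc_self hr))).1).symm
  · have h3 := DFunLike.congr_fun h2.mfderiv (1 : ℝ)
    exact h3.trans (one_smul ℝ (Z (γ s)))

/-- There are arbitrarily small compactly supported functions with non-zero differential at a
given point. -/
theorem exists_small_function [IsManifold I ∞ P] [I.Boundaryless] [T2Space P]
    [FiniteDimensional ℝ V] {x : P} {X : TangentSpace I x} (hX : X ≠ 0) {ε : ℝ} (hε : 0 < ε) :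
    ∃ h : C^∞⟮I, P; ℝ⟯, HasCompactSupport h ∧ (∀ y, |h y| < ε) ∧ dirDeriv I h x X ≠ 0 := by
  obtain ⟨f, hf⟩ : ∃ f : C^∞⟮I, P; ℝ⟯, dirDeriv I f x X ≠ 0 := by
    by_contra hne
    push Not at hne
    exact hX (eq_zero_of_forall_dirDeriv_eq_zero hne)
  obtain ⟨χ⟩ : Nonempty (SmoothBumpFunction I x) := inferInstance
  have hsm : ContMDiff I 𝓘(ℝ, ℝ) ∞ fun y => χ y * f y := χ.contMDiff.mul f.contMDiff
  have hc : HasCompactSupport fun y => χ y * f y := χ.hasCompactSupport.mul_right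
  obtain ⟨b, hb⟩ := hc.exists_bound_of_continuous hsm.continuous
  have hd : dirDeriv I (fun y => χ y * f y) x X = dirDeriv I f x X := by
    refine dirDeriv_congr ?_ X
    filter_upwards [χ.eventuallyEq_one] with y hy
    rw [hy, Pi.one_apply, one_mul]
  have hb0 : 0 < |b| + 1 := by positivity
  -- Rescaling makes the values smaller than `ε` and multiplies the differential by a non-zero
  -- constant.
  refine ⟨⟨fun y => ε / (|b| + 1) * (χ y * f y), contMDiff_const.mul hsm⟩, hc.mul_left,
    fun y => ?_, ?_⟩
  · change |ε / (|b| + 1) * (χ y * f y)| < ε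
    rw [abs_mul, abs_of_pos (by positivity)]
    have h1 : |χ y * f y| < |b| + 1 := by
      have := hb y
      rw [Real.norm_eq_abs] at this
      linarith [le_abs_self b]
    calc ε / (|b| + 1) * |χ y * f y| < ε / (|b| + 1) * (|b| + 1) :=
          mul_lt_mul_of_pos_left h1 (by positivity)
      _ = ε := by field_simp
  · have h1 := dirDeriv_const_mul (hsm.mdiffAt x) (ε / (|b| + 1)) X
    refine ne_of_eq_of_ne h1 ?_
    rw [hd]
    exact mul_ne_zero (by positivity) hf

end Curves

/-! ### Fields of rank one, and the converse -/

section RankOne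

variable {EM : Type*} [NormedAddCommGroup EM] [NormedSpace ℝ EM] [FiniteDimensional ℝ EM]
  {M : Type*} [TopologicalSpace M] [ChartedSpace EM M] [IsManifold 𝓘(ℝ, EM) ∞ M]
  [T2Space M] [SigmaCompactSpace M]
  {F : Type*} [NormedAddCommGroup F] [NormedSpace ℝ F] [FiniteDimensional ℝ F]
  {E : M → Type*} [∀ x, AddCommGroup (E x)] [∀ x, Module ℝ (E x)]
  [∀ x, TopologicalSpace (E x)] [TopologicalSpace (TotalSpace F E)]
  [FiberBundle F E] [VectorBundle ℝ F E] [ContMDiffVectorBundle ∞ F E 𝓘(ℝ, EM)]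
  {A : LieAlgebroid EM M F E}
  {k : ℕ} {N : Type*} [TopologicalSpace N] [ChartedSpace (EuclideanSpace ℝ (Fin k)) N]
  [IsManifold (𝓡 k) ∞ N]

open LieAlgebroid

namespace BundleMap

/-- The bundle map `X ↦ dh(X) w(z)`, `X ∈ T_z N`. -/
def rankOne (h : C^∞⟮𝓡 k, N; ℝ⟯) (w : N → TotalSpace F E)
    (hw : ContMDiff (𝓡 k) (𝓘(ℝ, EM).prod 𝓘(ℝ, F)) ∞ w) : BundleMap EM F E k N where
  base z := (w z).1
  fiber z :=
    { toFun := fun X => dirDeriv (𝓡 k) h z X • (w z).2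
      map_add' := fun X Y => by rw [dirDeriv_vec_add, add_smul]
      map_smul' := fun c X => by rw [dirDeriv_vec_smul, mul_smul]; rfl }
  contMDiff := fun p => ContMDiffAt.totalSpace_smul (b := fun p : TangentBundle (𝓡 k) N => (w p.1).1)
    (c := fun p : TangentBundle (𝓡 k) N => dirDeriv (𝓡 k) h p.1 p.2)
    (s := fun p : TangentBundle (𝓡 k) N => (w p.1).2)
    (h.contMDiff.dirDeriv contMDiff_id p) ((hw.comp (contMDiff_proj (TangentSpace (𝓡 k)))) p)

theorem rankOne_congr (h : C^∞⟮𝓡 k, N; ℝ⟯) {w w' : N → TotalSpace F E}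
    (hw : ContMDiff (𝓡 k) (𝓘(ℝ, EM).prod 𝓘(ℝ, F)) ∞ w)
    (hw' : ContMDiff (𝓡 k) (𝓘(ℝ, EM).prod 𝓘(ℝ, F)) ∞ w') (e : w = w') :
    rankOne h w hw = rankOne h w' hw' := by
  subst e
  rfl

/-- The map is `Th : TN → Tℝ` followed by the map `Tℝ → E` that sends `∂_s` to `v(γ(s))`. The second
is a morphism because `γ` is an integral curve of `ρ(v)`. In degree one, `d_E α` vanishes on two
multiples of one vector, and `d((β ∘ h) dh) = 0` because `dh ∧ dh = 0`. -/
theorem isLieAlgebroidMorphism_rankOne (h : C^∞⟮𝓡 k, N; ℝ⟯) (v : A.Sec) {γ : ℝ → M}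
    (hγ : ∀ z, ContMDiffAt 𝓘(ℝ, ℝ) 𝓘(ℝ, EM) ∞ γ (h z))
    (hγ' : ∀ z, mfderiv 𝓘(ℝ, ℝ) 𝓘(ℝ, EM) γ (h z) (1 : ℝ) = A.anchor (γ (h z)) (v (γ (h z))))
    (hw : ContMDiff (𝓡 k) (𝓘(ℝ, EM).prod 𝓘(ℝ, F)) ∞
      (fun z => (⟨γ (h z), v (γ (h z))⟩ : TotalSpace F E))) :
    (rankOne h _ hw).IsLieAlgebroidMorphism A := by
  have key : ∀ (f : C^∞⟮𝓘(ℝ, EM), M; ℝ⟯) (z : N) (X : TangentSpace (𝓡 k) z),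
      dirDeriv (𝓡 k) (fun w => f (γ (h w))) z X =
        dirDeriv (𝓡 k) h z X * anchorDeriv v f (γ (h z)) := by
    intro f z X
    have h1 := dirDeriv_comp (I := 𝓡 k) (I' := 𝓘(ℝ, ℝ)) (q := fun s => f (γ s)) (F := h) (x := z)
      (((f.contMDiff.contMDiffAt).comp (h z) (hγ z)).mdiffAt) (h.contMDiff.mdiffAt z) X
    refine h1.trans ((dirDeriv_real _ _ _).trans ?_)
    refine congrArg (dirDeriv (𝓡 k) h z X * ·) ?_
    have h2 := hasDerivAt_comp_curve (f.contMDiff.mdiffAt (γ (h z))) (hγ z).mdiffAt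
    rw [h2.deriv]
    exact congrArg (dirDeriv 𝓘(ℝ, EM) f (γ (h z))) (hγ' z)
  constructor
  · intro f z X
    refine sub_eq_zero.2 ((key f z X).trans ?_)
    refine Eq.trans ?_ (congrArg (dirDeriv 𝓘(ℝ, EM) f (γ (h z)))
      (map_smul (A.anchor (γ (h z))) (dirDeriv (𝓡 k) h z X) (v (γ (h z))))).symm
    exact (dirDeriv_vec_smul _ _ _ _).symm
  · intro α X Y z hα
    have hX : ContMDiff (𝓡 k) 𝓘(ℝ, ℝ) ∞ fun w => dirDeriv (𝓡 k) h w (X w) :=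
      h.contMDiff.dirDeriv X.contMDiff
    have hY : ContMDiff (𝓡 k) 𝓘(ℝ, ℝ) ∞ fun w => dirDeriv (𝓡 k) h w (Y w) :=
      h.contMDiff.dirDeriv Y.contMDiff
    have hβ : ContMDiff (𝓡 k) 𝓘(ℝ, ℝ) ∞ fun w => pairing hα v (γ (h w)) := fun w =>
      (pairing hα v).contMDiff.contMDiffAt.comp w ((hγ w).comp w h.contMDiff.contMDiffAt)
    -- Expanding `dh([X, Y])` cancels the second derivatives of `h`; the remaining terms are
    -- symmetric in `X` and `Y`.
    have hbr := dirDeriv_mlieBracket h.contMDiff (X.contMDiff.mdiffAt z) (Y.contMDiff.mdiffAt z)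
      (hX.mdiffAt z) (hY.mdiffAt z)
    have hexp : ∀ (Z : Cₛ^∞⟮𝓡 k; EuclideanSpace ℝ (Fin k), (TangentSpace (𝓡 k) : N → Type _)⟯)
        (Z' : TangentSpace (𝓡 k) z), dirDeriv (𝓡 k) (fun w => α ((rankOne h _ hw).base w)
          ((rankOne h _ hw).fiber w (Z w))) z Z' =
        dirDeriv (𝓡 k) h z (Z z) * (dirDeriv (𝓡 k) h z Z' *
          anchorDeriv v (pairing hα v) (γ (h z))) +
        pairing hα v (γ (h z)) * dirDeriv (𝓡 k) (fun w => dirDeriv (𝓡 k) h w (Z w)) z Z' := by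
      intro Z Z'
      have h1 : (fun w => α ((rankOne h _ hw).base w) ((rankOne h _ hw).fiber w (Z w))) =
          fun w => dirDeriv (𝓡 k) h w (Z w) * pairing hα v (γ (h w)) := funext fun w =>
        map_smul (α (γ (h w))) (dirDeriv (𝓡 k) h w (Z w)) (v (γ (h w)))
      rw [h1, ← key (pairing hα v) z Z']
      exact dirDeriv_mul (f := fun w => dirDeriv (𝓡 k) h w (Z w))
        (f' := fun w => pairing hα v (γ (h w)))
        ((h.contMDiff.dirDeriv Z.contMDiff).mdiffAt z) (hβ.mdiffAt z) Z'
    have hd : A.dOneForm α ((rankOne h _ hw).base z) ((rankOne h _ hw).fiber z (X z))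
        ((rankOne h _ hw).fiber z (Y z)) = 0 := by
      have h1 := map_smul (dOneFormRight (A := A) hα (γ (h z))
        (dirDeriv (𝓡 k) h z (X z) • v (γ (h z)))) (dirDeriv (𝓡 k) h z (Y z)) (v (γ (h z)))
      refine h1.trans ?_
      have h2 : dOneFormRight (A := A) hα (γ (h z)) (dirDeriv (𝓡 k) h z (X z) • v (γ (h z)))
          (v (γ (h z))) = 0 := by
        refine (dOneForm_sec_right hα v _ _).trans ?_
        refine (map_smul (contraction hα v (γ (h z))) (dirDeriv (𝓡 k) h z (X z))
          (v (γ (h z)))).trans ?_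
        have h3 : contraction hα v (γ (h z)) (v (γ (h z))) = 0 := by
          refine (dOneForm_sec_right hα v _ _).symm.trans ?_
          rw [dOneForm_sec hα, lie_self, Sec.zero_apply, map_zero]
          ring
        rw [h3, smul_zero]
      rw [h2, smul_zero]
    have hα3 : α ((rankOne h _ hw).base z) ((rankOne h _ hw).fiber z
        (VectorField.mlieBracket (𝓡 k) X Y z)) =
        dirDeriv (𝓡 k) h z (VectorField.mlieBracket (𝓡 k) X Y z) * pairing hα v (γ (h z)) :=
      map_smul (α (γ (h z))) _ (v (γ (h z)))
    rw [defectOne, hexp Y (X z), hexp X (Y z), hα3, hd, hbr]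
    ring

end BundleMap

end RankOne

/-! ### Invariance of the total action forces the Killing equation -/

section Converse

variable {EM : Type*} [NormedAddCommGroup EM] [NormedSpace ℝ EM] [FiniteDimensional ℝ EM]
  {M : Type*} [TopologicalSpace M] [ChartedSpace EM M] [IsManifold 𝓘(ℝ, EM) ∞ M]
  [T2Space M] [SigmaCompactSpace M]
  {F : Type*} [NormedAddCommGroup F] [NormedSpace ℝ F] [FiniteDimensional ℝ F]
  {E : M → Type*} [∀ x, AddCommGroup (E x)] [∀ x, Module ℝ (E x)]
  [∀ x, TopologicalSpace (E x)] [∀ x, IsTopologicalAddGroup (E x)]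
  [∀ x, ContinuousConstSMul ℝ (E x)] [TopologicalSpace (TotalSpace F E)]
  [FiberBundle F E] [VectorBundle ℝ F E] [ContMDiffVectorBundle ∞ F E 𝓘(ℝ, EM)]
  {A : LieAlgebroid EM M F E} {G : ContMDiffRiemannianMetric 𝓘(ℝ, EM) ∞ F E}
  {k : ℕ} {N : Type*} [TopologicalSpace N] [ChartedSpace (EuclideanSpace ℝ (Fin k)) N]
  [IsManifold (𝓡 k) ∞ N]

open BundleMap

namespace LieAlgebroid

/-- A family of fields of rank one realises the redefinition induced by `u` if the curves in `E`
from which it is built have velocity `d_T(u)`. -/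
theorem isRedefinitionFamily_rankOne (u : A.Sec) (h : C^∞⟮𝓡 k, N; ℝ⟯)
    {W : ℝ → N → TotalSpace F E} (hW : ContMDiff (𝓘(ℝ, ℝ).prod (𝓡 k)) (𝓘(ℝ, EM).prod 𝓘(ℝ, F)) ∞
      (fun r : ℝ × N => W r.1 r.2))
    (hWt : ∀ t, ContMDiff (𝓡 k) (𝓘(ℝ, EM).prod 𝓘(ℝ, F)) ∞ (W t))
    (hv : ∀ z, mfderiv 𝓘(ℝ, ℝ) (𝓘(ℝ, EM).prod 𝓘(ℝ, F)) (fun t => W t z) 0 (1 : ℝ) =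
      A.tangentLift u (W 0 z)) :
    A.IsRedefinitionFamily u fun t => rankOne h (W t) (hWt t) := by
  constructor
  · intro r
    have hbase : ContMDiff (𝓘(ℝ, ℝ).prod (𝓡 k).tangent) (𝓘(ℝ, EM).prod 𝓘(ℝ, F)) ∞
        (fun r : ℝ × TangentBundle (𝓡 k) N => W r.1 r.2.1) :=
      hW.comp (contMDiff_fst.prodMk ((contMDiff_proj (TangentSpace (𝓡 k))).comp contMDiff_snd))
    exact ContMDiffAt.totalSpace_smul (b := fun r : ℝ × TangentBundle (𝓡 k) N => (W r.1 r.2.1).1)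
      (c := fun r : ℝ × TangentBundle (𝓡 k) N => dirDeriv (𝓡 k) h r.2.1 r.2.2)
      (s := fun r : ℝ × TangentBundle (𝓡 k) N => (W r.1 r.2.1).2)
      (h.contMDiff.dirDeriv contMDiff_snd r) (hbase r)
  · intro p
    have hc : MDifferentiableAt 𝓘(ℝ, ℝ) (𝓘(ℝ, EM).prod 𝓘(ℝ, F)) (fun t => W t p.1) 0 :=
      (hW.comp (contMDiff_id.prodMk contMDiff_const)).mdiffAt 0
    -- The field at `p` is `W t z` scaled by the number `dh(p)`, which does not depend on `t`.
    -- Linearity of `d_T(u)` carries the velocity through the scaling.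
    have hm := (contMDiff_smul_total (EM := EM) (F := F) (E := E)
      (dirDeriv (𝓡 k) h p.1 p.2)).mdiffAt (W 0 p.1)
    have h1 := DFunLike.congr_fun (mfderiv_comp (0 : ℝ) hm hc) (1 : ℝ)
    refine Eq.trans h1 ?_
    refine Eq.trans (congrArg (mfderiv (𝓘(ℝ, EM).prod 𝓘(ℝ, F)) (𝓘(ℝ, EM).prod 𝓘(ℝ, F))
      (fun e : TotalSpace F E => (⟨e.1, dirDeriv (𝓡 k) h p.1 p.2 • e.2⟩ : TotalSpace F E))
      (W 0 p.1)) (hv p.1)) ?_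
    exact (tangentLift_smul_total u _ _).symm

variable [T2Space N] [SigmaCompactSpace N] [MeasurableSpace N] [BorelSpace N]
  (g : ContMDiffRiemannianMetric (𝓡 k) ∞ (EuclideanSpace ℝ (Fin k))
      (TangentSpace (𝓡 k) : N → Type _))

/-- `L_u G` is homogeneous of degree two on the fibres, so it pulls back to `dh²` times its value at
`w z`. -/
theorem pullbackTrace_rankOne (u : A.Sec) (h : C^∞⟮𝓡 k, N; ℝ⟯) {w : N → TotalSpace F E}
    (hw : ContMDiff (𝓡 k) (𝓘(ℝ, EM).prod 𝓘(ℝ, F)) ∞ w) (z : N) :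
    (rankOne h w hw).pullbackTrace g (A.lieDeriv u (metricFunction G)) z =
      metricTrace g z (fun X => dirDeriv (𝓡 k) h z X * dirDeriv (𝓡 k) h z X) *
        A.lieDeriv u (metricFunction G) (w z) := by
  have h1 : (fun X => A.lieDeriv u (metricFunction G) ((rankOne h w hw).toMap ⟨z, X⟩)) =
      fun X => dirDeriv (𝓡 k) h z X * dirDeriv (𝓡 k) h z X *
        A.lieDeriv u (metricFunction G) (w z) := funext fun X => by
    rw [← pow_two]
    exact lieDeriv_metricFunction_smul G u (dirDeriv (𝓡 k) h z X) (w z)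
  refine (congrArg (metricTrace g z) h1).trans ?_
  simp only [metricTrace, Finset.sum_mul]
  refine Finset.sum_congr rfl fun i _ => Finset.sum_congr rfl fun j _ => ?_
  ring

/-- The differential of a function as a linear form. -/
def dirDerivForm (h : N → ℝ) (z : N) : TangentSpace (𝓡 k) z →ₗ[ℝ] ℝ where
  toFun := dirDeriv (𝓡 k) h z
  map_add' := dirDeriv_vec_add h z
  map_smul' := dirDeriv_vec_smul h z

theorem metricTrace_dirDeriv_nonneg (h : N → ℝ) (z : N) :
    0 ≤ metricTrace g z fun X => dirDeriv (𝓡 k) h z X * dirDeriv (𝓡 k) h z X := by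
  by_cases h0 : dirDerivForm (k := k) h z = 0
  · have h1 : (fun X => dirDeriv (𝓡 k) h z X * dirDeriv (𝓡 k) h z X) = fun _ => 0 :=
      funext fun X => by
        have : dirDeriv (𝓡 k) h z X = 0 := LinearMap.congr_fun h0 X
        rw [this, mul_zero]
    exact ((congrArg (metricTrace g z) h1).trans (metricTrace_zero g z)).ge
  · exact (metricTrace_mul_sq_pos g _ h0).le

/-- If the total action is invariant then `u` is Killing. -/
theorem isKilling_of_leavesActionInvariant (hk : 0 < k) [Nonempty N] {u : A.Sec}
    (hu : A.LeavesActionInvariant g G (univ : Set N) u) : A.IsKilling G u := by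
  intro e₀
  by_contra hne
  obtain ⟨v, hv⟩ := A.exists_sec e₀
  set L : TotalSpace F E → ℝ := A.lieDeriv u (metricFunction G) with hL
  have hLs : ContMDiff (𝓘(ℝ, EM).prod 𝓘(ℝ, F)) 𝓘(ℝ, ℝ) ∞ L :=
    contMDiff_lieDeriv u (contMDiff_metricFunction G)
  obtain ⟨U, hUo, hU0, R, hRs, hR0, hRv⟩ := exists_family_hasVelocity (contMDiff_tangentLift u) e₀
  obtain ⟨γ, hγ0, hγ⟩ := exists_smooth_integralCurve (contMDiff_anchor_sec v) e₀.1
  set c : ℝ → TotalSpace F E := fun s => ⟨γ s, v (γ s)⟩ with hc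
  have hcs : ∀ s, ContMDiffAt 𝓘(ℝ, ℝ) 𝓘(ℝ, EM) ∞ γ s →
      ContMDiffAt 𝓘(ℝ, ℝ) (𝓘(ℝ, EM).prod 𝓘(ℝ, F)) ∞ c s := fun s hs =>
    (contMDiff_sec v).contMDiffAt.comp s hs
  have hc0 : c 0 = e₀ := by
    have : c 0 = ⟨e₀.1, v e₀.1⟩ := congrArg (fun x => (⟨x, v x⟩ : TotalSpace F E)) hγ0
    rw [this, hv]
  have hcont : ContinuousAt c 0 := (hcs 0 hγ.self_of_nhds.1).continuousAt
  have hUc : ∀ᶠ s in 𝓝 (0 : ℝ), c s ∈ U :=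
    hcont.eventually (hUo.mem_nhds (by rw [hc0]; exact hU0))
  -- Multiplying by `L e₀` treats both signs at once: near `s = 0`, `L (c s)` has the sign of `L
  -- e₀`.
  have hLc : ∀ᶠ s in 𝓝 (0 : ℝ), 0 < L e₀ * L (c s) := by
    have h1 : ContinuousAt (fun s => L e₀ * L (c s)) 0 :=
      continuousAt_const.mul (hLs.continuous.continuousAt.comp hcont)
    refine h1.eventually (lt_mem_nhds ?_)
    change 0 < L e₀ * L (c 0)
    rw [hc0]
    exact mul_self_pos.2 hne
  obtain ⟨ε, hε, hb⟩ := Metric.eventually_nhds_iff_ball.1 (hγ.and (hUc.and hLc))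
  obtain ⟨z₀⟩ := ‹Nonempty N›
  obtain ⟨X₀, hX₀⟩ : ∃ X : TangentSpace (𝓡 k) z₀, X ≠ 0 :=
    ⟨coordBasis z₀ ⟨0, hk⟩, (coordBasis z₀).ne_zero _⟩
  -- With `|h| < ε` the curve is evaluated only where it is a smooth integral curve, lies in `U` and
  -- keeps the sign. Compact support lets the field vanish outside a compact set.
  obtain ⟨h, hcomp, hsmall, hd⟩ := exists_small_function hX₀ hε
  have hb' : ∀ z, (ContMDiffAt 𝓘(ℝ, ℝ) 𝓘(ℝ, EM) ∞ γ (h z) ∧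
      mfderiv 𝓘(ℝ, ℝ) 𝓘(ℝ, EM) γ (h z) (1 : ℝ) = A.anchor (γ (h z)) (v (γ (h z)))) ∧
      c (h z) ∈ U ∧ 0 < L e₀ * L (c (h z)) := fun z =>
    hb (h z) (by rw [Metric.mem_ball, Real.dist_eq, sub_zero]; exact hsmall z)
  have hch : ContMDiff (𝓡 k) (𝓘(ℝ, EM).prod 𝓘(ℝ, F)) ∞ fun z => c (h z) := fun z =>
    (hcs _ (hb' z).1.1).comp z h.contMDiff.contMDiffAt
  set W : ℝ → N → TotalSpace F E := fun t z => R t (c (h z)) with hWdef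
  have hW : ContMDiff (𝓘(ℝ, ℝ).prod (𝓡 k)) (𝓘(ℝ, EM).prod 𝓘(ℝ, F)) ∞
      (fun r : ℝ × N => W r.1 r.2) := fun r =>
    (hRs r.1 _ (hb' r.2).2.1).comp r
      (contMDiffAt_fst.prodMk (hch.contMDiffAt.comp r contMDiffAt_snd))
  have hWt : ∀ t, ContMDiff (𝓡 k) (𝓘(ℝ, EM).prod 𝓘(ℝ, F)) ∞ (W t) := fun t =>
    hW.comp (contMDiff_const.prodMk contMDiff_id)
  have hW0 : W 0 = fun z => c (h z) := funext fun z => hR0 _ (hb' z).2.1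
  have hvel : ∀ z, mfderiv 𝓘(ℝ, ℝ) (𝓘(ℝ, EM).prod 𝓘(ℝ, F)) (fun t => W t z) 0 (1 : ℝ) =
      A.tangentLift u (W 0 z) := fun z => by
    let D : TotalSpace F E → EM × F := fun e => A.tangentLift u e
    exact (hRv _ (hb' z).2.1).trans (congrArg D (congrFun hW0 z)).symm
  have hΨ := isRedefinitionFamily_rankOne u h hW hWt hvel
  have hΨ0 : rankOne h (W 0) (hWt 0) = rankOne h _ hch := rankOne_congr h _ _ hW0
  have hmor : (rankOne h (W 0) (hWt 0)).IsLieAlgebroidMorphism A := by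
    rw [hΨ0]
    exact isLieAlgebroidMorphism_rankOne h v (fun z => (hb' z).1.1) (fun z => (hb' z).1.2) hch
  have hoff : ∀ z ∉ tsupport h, ∀ X : TangentSpace (𝓡 k) z, dirDeriv (𝓡 k) h z X = 0 := by
    intro z hz X
    have h1 : (h : N → ℝ) =ᶠ[𝓝 z] fun _ => 0 := notMem_tsupport_iff_eventuallyEq.1 hz
    rw [dirDeriv_congr h1, dirDeriv_const]
  have hvan : ∀ t, ∀ z ∈ univ \ tsupport h, (rankOne h (W t) (hWt t)).fiber z = 0 := by
    intro t z hz
    refine LinearMap.ext fun X => ?_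
    change dirDeriv (𝓡 k) h z X • (W t z).2 = 0
    rw [hoff z hz.2, zero_smul]
  -- The action has two derivatives along this family, the general first variation and, by
  -- invariance, zero; hence the integral vanishes.
  have hder := hΨ.hasDerivAt_action G g MeasurableSet.univ hcomp hvan
  have hzero := hder.unique (hu _ hΨ hmor ⟨_, hcomp, hvan⟩)
  rw [Measure.restrict_univ] at hzero
  set J : N → ℝ := fun z =>
    (rankOne h (W 0) (hWt 0)).pullbackTrace g (A.lieDeriv u (metricFunction G)) z with hJ
  have hJc : Continuous J := by
    have h1 := (continuous_deriv_pullbackTrace_family G g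
      (Ψ := fun t => rankOne h (W t) (hWt t)) hΨ.1).comp
      (continuous_const.prodMk continuous_id : Continuous fun z : N => ((0 : ℝ), z))
    refine h1.congr fun z => ?_
    exact (hasVariation_pullbackTrace G g u z _ hΨ).deriv
  have hJeq : ∀ z, L e₀ * J z =
      metricTrace g z (fun X => dirDeriv (𝓡 k) h z X * dirDeriv (𝓡 k) h z X) *
        (L e₀ * L (c (h z))) := fun z => by
    have h1 : J z = _ := pullbackTrace_rankOne g u h (hWt 0) z
    rw [h1, congrFun hW0 z, ← hL]
    ring
  -- The integrand is `|dh|²` times a positive function: continuous, compactly supported,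
  -- non-negative, and positive at `z₀`, where `dh ≠ 0`.
  have hpos : 0 < ∫ z, L e₀ * J z ∂(riemannianVolume g) := by
    refine Continuous.integral_pos_of_hasCompactSupport_nonneg_nonzero (x := z₀)
      (continuous_const.mul hJc) ?_ ?_ ?_
    · refine HasCompactSupport.intro hcomp fun z hz => ?_
      rw [hJeq]
      have h1 : (fun X => dirDeriv (𝓡 k) h z X * dirDeriv (𝓡 k) h z X) = fun _ => 0 :=
        funext fun X => by rw [hoff z hz, mul_zero]
      rw [show metricTrace g z _ = 0 from
        (congrArg (metricTrace g z) h1).trans (metricTrace_zero g z), zero_mul]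
    · intro z
      change 0 ≤ L e₀ * J z
      rw [hJeq]
      exact mul_nonneg (metricTrace_dirDeriv_nonneg g h z) (hb' z).2.2.le
    · rw [hJeq]
      have hl : dirDerivForm (k := k) h z₀ ≠ 0 :=
        fun h0 => hd (LinearMap.congr_fun h0 X₀)
      exact (mul_pos (metricTrace_mul_sq_pos g _ hl) (hb' z₀).2.2).ne'
  rw [integral_const_mul, hzero, mul_zero] at hpos
  exact lt_irrefl _ hpos

end LieAlgebroid

end Converse

end

/-! ### The proposition -/

theorem mainTheorem7
    -- the target: a Lie algebroid `E → M` with a Riemannian metric `G`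
    {EM : Type*} [NormedAddCommGroup EM] [NormedSpace ℝ EM] [FiniteDimensional ℝ EM]
    {M : Type*} [TopologicalSpace M] [ChartedSpace EM M] [IsManifold 𝓘(ℝ, EM) ∞ M]
    [T2Space M] [SigmaCompactSpace M]
    {F : Type*} [NormedAddCommGroup F] [NormedSpace ℝ F] [FiniteDimensional ℝ F]
    {E : M → Type*} [∀ x, AddCommGroup (E x)] [∀ x, Module ℝ (E x)]
    [∀ x, TopologicalSpace (E x)] [∀ x, IsTopologicalAddGroup (E x)]
    [∀ x, ContinuousConstSMul ℝ (E x)] [TopologicalSpace (TotalSpace F E)]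
    [FiberBundle F E] [VectorBundle ℝ F E] [ContMDiffVectorBundle ∞ F E 𝓘(ℝ, EM)]
    (A : LieAlgebroid EM M F E) (G : ContMDiffRiemannianMetric 𝓘(ℝ, EM) ∞ F E)
    -- the source: a Riemannian manifold `(N, g)` of positive dimension, without boundary
    {k : ℕ} (hk : 0 < k) {N : Type*} [TopologicalSpace N]
    [ChartedSpace (EuclideanSpace ℝ (Fin k)) N] [IsManifold (𝓡 k) ∞ N]
    [T2Space N] [SigmaCompactSpace N] [MeasurableSpace N] [BorelSpace N] [Nonempty N]
    (g : ContMDiffRiemannianMetric (𝓡 k) ∞ (EuclideanSpace ℝ (Fin k))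
      (TangentSpace (𝓡 k) : N → Type _)) :
    -- the tangent lift is given by its defining formula on every section `v` of `E`
    (∀ (u v : A.Sec) (x : M), A.tangentLift u ⟨x, v x⟩ =
      mfderiv 𝓘(ℝ, EM) (𝓘(ℝ, EM).prod 𝓘(ℝ, F)) (fun y => (⟨y, v y⟩ : TotalSpace F E)) x
          (A.anchor x (u x))
        - LieAlgebroid.verticalLift (⟨x, v x⟩ : TotalSpace F E) (⁅u, v⁆ x)) ∧
    -- first variation of the Lagrangian and of the action over compact regions, at any field
    (∀ (u : A.Sec) (z : N), A.HasVariation u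
      (fun Φ : BundleMap EM F E k N => Φ.pullbackTrace g (metricFunction G) z)
      (fun Φ => Φ.pullbackTrace g (A.lieDeriv u (metricFunction G)) z)) ∧
    (∀ (u : A.Sec) (D : Set N), IsCompact D → A.HasVariation u
      (fun Φ : BundleMap EM F E k N => Φ.action g G D)
      (fun Φ => ∫ z in D, Φ.pullbackTrace g (A.lieDeriv u (metricFunction G)) z
        ∂(riemannianVolume g))) ∧
    -- field redefinitions are tangent to the space of Lie algebroid morphisms
    (∀ u : A.Sec, A.PreservesMorphisms k N u) ∧
    -- the sections inducing internal symmetries are exactly the Killing sections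
    (∀ u : A.Sec, List.TFAE [A.IsKilling G u, A.IsInternalSymmetry g G u,
      A.LeavesActionInvariant g G (univ : Set N) u]) ∧
    -- `δ` is the Lie algebra morphism `u ↦ d_T(u)` and `iso` is the Lie algebra of Killing sections
    ∃ (δ : A.Sec →ₗ⁅ℝ⁆ Derivation ℝ C^∞⟮𝓘(ℝ, EM).prod 𝓘(ℝ, F), TotalSpace F E; ℝ⟯
          C^∞⟮𝓘(ℝ, EM).prod 𝓘(ℝ, F), TotalSpace F E; ℝ⟯)
      (iso : LieSubalgebra ℝ A.Sec),
      (∀ u f e, δ u f e = A.lieDeriv u f e) ∧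
      (∀ u, u ∈ iso ↔ A.IsKilling G u) ∧
      -- the field redefinitions close off-shell: `[δ_u, δ_v] = δ_[u, v]` on arbitrary fields
      (∀ (u v : A.Sec) (f : C^∞⟮𝓘(ℝ, EM).prod 𝓘(ℝ, F), TotalSpace F E; ℝ⟯)
        (p : TangentBundle (𝓡 k) N),
        A.HasVariation v (fun Φ : BundleMap EM F E k N => f (Φ.toMap p))
          (fun Φ => δ v f (Φ.toMap p)) ∧
        A.HasVariation u (fun Φ : BundleMap EM F E k N => δ v f (Φ.toMap p))
          (fun Φ => δ u (δ v f) (Φ.toMap p)) ∧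
        A.HasVariation ⁅u, v⁆ (fun Φ : BundleMap EM F E k N => f (Φ.toMap p))
          (fun Φ => δ u (δ v f) (Φ.toMap p) - δ v (δ u f) (Φ.toMap p))) ∧
      -- the Lie algebra of internal symmetries is the image of `iso` under `δ`, and only central
      -- sections induce the trivial redefinition
      (∀ X, X ∈ iso.map δ ↔ ∃ u, A.IsInternalSymmetry g G u ∧ δ u = X) ∧
      (∀ u : A.Sec, δ u = 0 ↔ ∀ v : A.Sec, ⁅u, v⁆ = 0) := by
  refine ⟨LieAlgebroid.tangentLift_eq, LieAlgebroid.hasVariation_pullbackTrace G g,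
    fun u D hD => LieAlgebroid.hasVariation_action G g u hD,
    LieAlgebroid.preservesMorphisms, ?_, A.lieHom, A.killing G, LieAlgebroid.lieHom_apply,
    LieAlgebroid.mem_killing G, ?_, ?_, LieAlgebroid.lieHom_eq_zero_iff G⟩
  · intro u
    tfae_have 1 → 2 := fun h =>
      ⟨LieAlgebroid.preservesMorphisms u, fun D hD => h.leavesActionInvariant G g hD⟩
    tfae_have 2 → 3 := fun h => h.2 univ MeasurableSet.univ
    tfae_have 3 → 1 := LieAlgebroid.isKilling_of_leavesActionInvariant g hk
    tfae_finish
  · intro u v f p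
    refine ⟨LieAlgebroid.hasVariation_eval v f.contMDiff p,
      LieAlgebroid.hasVariation_eval u (A.lieHom v f).contMDiff p, fun Ψ hΨ => ?_⟩
    exact (hΨ.hasDerivAt f.contMDiff p).congr_deriv
      (LieAlgebroid.lieDeriv_lie u v f.contMDiff _)
  · intro X
    have hiff : ∀ u : A.Sec, A.IsInternalSymmetry g G u ↔ A.IsKilling G u := fun u =>
      ⟨fun h => LieAlgebroid.isKilling_of_leavesActionInvariant g hk (h.2 univ MeasurableSet.univ),
        fun h => ⟨LieAlgebroid.preservesMorphisms u, fun D hD => h.leavesActionInvariant G g hD⟩⟩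
    simp only [LieSubalgebra.mem_map, LieAlgebroid.mem_killing, hiff]
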